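/- Let $d\in\mathbb N$, let $\Omega\subset\mathbb R^d$ be a bounded open set (for instance a polyhedral Lipschitz domain) and let $\gamma>0$. There is a constant $C>0$, depending only on $\Omega$, $d$ and $\gamma$, such that the following holds. Let $s\in(0,1)$, $\alpha:=1-2s$, and write points of $\mathbb R^{d+1}_+:=\mathbb R^d\times(0,\infty)$ as $(x_1,\dots,x_{d+1})$. For $D\subseteq\mathbb R^{d+1}_+$ let $\|v\|_{L^2_\alpha(D)}^2=\int_D x_{d+1}^\alpha|v|^2\,dx$, and for open $D$ let $H^1_\alpha(D)$ be the space of functions that lie in $L^2_\alpha(D)$ together with their distributional gradient. Let $\mathcal B^1_\alpha$ be the space of functions on $\mathbb R^{d+1}_+$ with distributional gradient in $L^2_\alpha(\mathbb R^{d+1}_+)$, let $\operatorname{tr}$ be the trace operator on $\mathcal B^1_\alpha$ (the continuous extension of $\varphi\mapsto\varphi(\cdot,0)$ from functions smooth up to the boundary), and let $a(\mathbf u,\mathbf v)=\int_{\mathbb R^{d+1}_+}x_{d+1}^{\alpha}\nabla\mathbf u\cdot\nabla\mathbf v\,dx$. Let $\mathcal T_h$ be a conforming simplicial mesh of $\overline\Omega$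 (for instance a quasiuniform one) with mesh width $h=\max_{K\in\mathcal T_h}\operatorname{diam}K$ that is $\gamma$-shape regular, i.e. $\operatorname{diam}K\le\gamma|K|^{1/d}$ for all $K\in\mathcal T_h$, and let $\mathcal S^1_0(\mathcal T_h)$ be the space of continuous functions on $\mathbb R^d$ with support in $\overline\Omega$ that are affine on every $K\in\mathcal T_h$. For open $D\subseteq\mathbb R^{d+1}_+$ let $\mathcal H_{h,0}(D)$ be the space of all $\mathbf u\in H^1_\alpha(D)$ for which there is $\widetilde{\mathbf u}\in\mathcal B^1_\alpha$ with $\operatorname{tr}\widetilde{\mathbf u}\in\mathcal S^1_0(\mathcal T_h)$, $\mathbf u=\widetilde{\mathbf u}|_D$, and $a(\widetilde{\mathbf u},\mathbf v)=0$ both for all $\mathbf v\in\mathcal B^1_\alpha$ with $\operatorname{tr}\mathbf v=0$ and for all $\mathbf v\in\mathcal B^1_\alpha$ with $\operatorname{tr}\mathbf v\in\mathcal S^1_0(\mathcal T_h)$ and $\operatorname{supp}(\operatorname{tr}\mathbf v)\times\{0\}\subseteq\overline D$. For $R>0$ let $B_R=B_R^0\times(0,R)$, where $B_R^0\subset\mathbb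 R^d$ is an open axis-parallel cube of side length $R$; two boxes are concentric if these cubes have the same barycenter. For $\mathbf u\in H^1_\alpha(B_R)$ let $$|||\mathbf u|||_{h,R}^2=\Big(\frac hR\Big)^2\|\nabla\mathbf u\|_{L^2_\alpha(B_R)}^2+\frac1{R^2}\|\mathbf u\|_{L^2_\alpha(B_R)}^2 .$$ Then for all $R\in(0,8\operatorname{diam}(\Omega))$ and $\delta\in(0,1)$ with $16h\le\delta R$, all concentric boxes $B_R$ and $B_{(1+\delta)R}$, and all $\mathbf u\in\mathcal H_{h,0}(B_{(1+\delta)R})$, $$\|\nabla\mathbf u\|_{L^2_\alpha(B_R)}\le C\,\frac{1+\delta}{\delta}\,|||\mathbf u|||_{h,(1+\delta)R}.$$ -/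

import Mathlib

open MeasureTheory Filter Topology Set
open scoped ContDiff ENNReal

noncomputable section

namespace FracCacc

/-- The space `ℝ^d` with its Euclidean structure. -/
abbrev Rd (d : ℕ) : Type := EuclideanSpace ℝ (Fin d)

/-- The space `ℝ^{d+1} = ℝ^d × ℝ`; a point is `z = (x, x_{d+1})`.  Only its topology, its smooth
structure and Lebesgue measure are used, lengths of vectors are measured in `Vec d`. -/
abbrev Rd1 (d : ℕ) : Type := Rd d × ℝ

/-- Vectors of `ℝ^{d+1}` (values of gradients) with the Euclidean inner product and norm. -/
abbrev Vec (d : ℕ) : Type := WithLp 2 (Rd d × ℝ)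

/-- The open upper half-space `ℝ^d × (0, ∞)`. -/
def halfSpace (d : ℕ) : Set (Rd1 d) := {z | 0 < z.2}

/-- The measure `x_{d+1}^α dx` on the upper half-space.  For a set `D` in the half-space,
`L²_α(D)` is the `L²` space of `(wvol d α).restrict D`. -/
def wvol (d : ℕ) (α : ℝ) : Measure (Rd1 d) :=
  ((volume : Measure (Rd1 d)).restrict (halfSpace d)).withDensity
    (fun z => ENNReal.ofReal (z.2 ^ α))

/-- On the open set `D`, `u` is locally integrable and `G` is its distributional gradient. -/
structure HasWeakGradOn {d : ℕ} (D : Set (Rd1 d)) (u : Rd1 d → ℝ) (G : Rd1 d → Vec d) : Prop where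
  locInt : LocallyIntegrableOn u D volume
  locInt_grad : LocallyIntegrableOn G D volume
  integral_eq : ∀ φ : Rd1 d → ℝ, ContDiff ℝ ∞ φ → HasCompactSupport φ → tsupport φ ⊆ D →
    ∀ e : Rd1 d, ∫ z, u z * fderiv ℝ φ z e = - ∫ z, inner ℝ (G z) (WithLp.toLp 2 e) * φ z

/-- The weighted Sobolev space `H¹_α(D)`: `u` and its distributional gradient are in `L²_α(D)`. -/
def MemH1 {d : ℕ} (α : ℝ) (D : Set (Rd1 d)) (u : Rd1 d → ℝ) : Prop :=
  MemLp u 2 ((wvol d α).restrict D) ∧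
    ∃ G : Rd1 d → Vec d, HasWeakGradOn D u G ∧ MemLp G 2 ((wvol d α).restrict D)

/-- An element of the Beppo-Levi space `B¹_α(ℝ^{d+1}_+)`: a function on the half-space together with
(a version of) its distributional gradient, which lies in `L²_α(ℝ^{d+1}_+)`. -/
structure BeppoLevi (d : ℕ) (α : ℝ) where
  toFun : Rd1 d → ℝ
  grad : Rd1 d → Vec d
  hasWeakGrad : HasWeakGradOn (halfSpace d) toFun grad
  memLp_grad : MemLp grad 2 (wvol d α)

/-- The bilinear form `a(u, v) = ∫ x_{d+1}^α ∇u · ∇v` over the half-space. -/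
def BeppoLevi.a {d : ℕ} {α : ℝ} (u v : BeppoLevi d α) : ℝ :=
  ∫ z, inner ℝ (u.grad z) (v.grad z) ∂(wvol d α)

/-- The classical gradient of a differentiable function on `ℝ^{d+1}`. -/
def classicalGrad {d : ℕ} (φ : Rd1 d → ℝ) (z : Rd1 d) : Vec d :=
  WithLp.toLp 2 (gradient (fun x : Rd d => φ (x, z.2)) z.1, deriv (fun t : ℝ => φ (z.1, t)) z.2)

/-- `g` is the trace of `u ∈ B¹_α(ℝ^{d+1}_+)` on `ℝ^d × {0}`: the trace operator is the closure of
`φ ↦ φ(·, 0)` on the functions of `B¹_α` that are smooth up to the boundary.  Convergence in `B¹_α` is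
convergence of the gradients in `L²_α(ℝ^{d+1}_+)` and of the functions in `L²_α(K)`, for bounded `K`
(every single box `K` gives an equivalent norm); traces converge in `L²` on bounded sets. -/
def HasTrace {d : ℕ} {α : ℝ} (u : BeppoLevi d α) (g : Rd d → ℝ) : Prop :=
  AEStronglyMeasurable g volume ∧
    ∃ φ : ℕ → Rd1 d → ℝ,
      (∀ n, ContDiff ℝ ∞ (φ n)) ∧
      (∀ n, MemLp (classicalGrad (φ n)) 2 (wvol d α)) ∧
      Tendsto (fun n => eLpNorm (fun z => classicalGrad (φ n) z - u.grad z) 2 (wvol d α))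
        atTop (𝓝 0) ∧
      (∀ K : Set (Rd1 d), Bornology.IsBounded K →
        Tendsto (fun n => eLpNorm (fun z => φ n z - u.toFun z) 2 ((wvol d α).restrict K))
          atTop (𝓝 0)) ∧
      (∀ K : Set (Rd d), Bornology.IsBounded K →
        Tendsto (fun n => eLpNorm (fun x => φ n (x, 0) - g x) 2 (volume.restrict K))
          atTop (𝓝 0))

/-- A conforming simplicial mesh of `Ω ⊆ ℝ^d`: a finite simplicial complex whose `d`-dimensional
simplices cover exactly the closure of `Ω`. -/
structure Mesh {d : ℕ} (Ω : Set (Rd d)) where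
  complex : Geometry.SimplicialComplex ℝ (Rd d)
  finite_faces : complex.faces.Finite
  cover : (⋃ K ∈ {K ∈ complex.faces | K.card = d + 1}, convexHull ℝ (K : Set (Rd d))) = closure Ω

namespace Mesh

variable {d : ℕ} {Ω : Set (Rd d)}

/-- The elements (closed `d`-simplices) of the mesh. -/
def elements (T : Mesh Ω) : Set (Set (Rd d)) :=
  (fun K : Finset (Rd d) => convexHull ℝ (K : Set (Rd d))) ''
    {K ∈ T.complex.faces | K.card = d + 1}

/-- The mesh width `h`, the largest diameter of an element. -/
def width (T : Mesh Ω) : ℝ := sSup (Metric.diam '' T.elements)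

/-- `γ`-shape regularity: `diam K ≤ γ |K|^{1/d}` for all elements `K`. -/
def ShapeRegular (T : Mesh Ω) (γ : ℝ) : Prop :=
  ∀ K ∈ T.elements, Metric.diam K ≤ γ * (volume.real K) ^ (1 / (d : ℝ))

/-- The space `S¹₀(T_h)` of continuous functions on `ℝ^d` with support in the closure of `Ω` that are
affine on every element. -/
def S10 (T : Mesh Ω) : Set (Rd d → ℝ) :=
  {g | Continuous g ∧ tsupport g ⊆ closure Ω ∧
    ∀ K ∈ T.elements, ∃ A : Rd d →ᵃ[ℝ] ℝ, EqOn g A K}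

end Mesh

/-- The space `H_{h,0}(D)`, for `s ∈ (0,1)` and `α = 1 - 2s`: the functions of `H¹_α(D)` that are on
`D` the restriction of some `w ∈ B¹_α` with trace in `S¹₀(T_h)` such that `a(w, v) = 0` for all `v`
with vanishing trace, and for all `v` with trace in `S¹₀(T_h)` supported in the closure of `D`. -/
def MemHh0 {d : ℕ} {Ω : Set (Rd d)} (s : ℝ) (T : Mesh Ω) (D : Set (Rd1 d)) (u : Rd1 d → ℝ) : Prop :=
  MemH1 (1 - 2 * s) D u ∧
    ∃ w : BeppoLevi d (1 - 2 * s),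
      (∃ g ∈ T.S10, HasTrace w g) ∧
      (∀ᵐ z ∂(volume.restrict D), u z = w.toFun z) ∧
      (∀ v : BeppoLevi d (1 - 2 * s), HasTrace v (fun _ => 0) → w.a v = 0) ∧
      (∀ v : BeppoLevi d (1 - 2 * s), ∀ g ∈ T.S10, HasTrace v g →
        tsupport g ⊆ {x : Rd d | (x, (0 : ℝ)) ∈ closure D} → w.a v = 0)

/-- The open cube `B_R^0` in `ℝ^d` with barycenter `c` and side length `R`. -/
def cube {d : ℕ} (c : Rd d) (R : ℝ) : Set (Rd d) := {x | ∀ i, |x i - c i| < R / 2}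

/-- The box `B_R = B_R^0 × (0, R)`. -/
def box {d : ℕ} (c : Rd d) (R : ℝ) : Set (Rd1 d) := cube c R ×ˢ Ioo 0 R

/-- The norm `|||u|||_{h,R}` with
`|||u|||_{h,R}² = (h/R)² ‖∇u‖²_{L²_α(B_R)} + (1/R²) ‖u‖²_{L²_α(B_R)}`;
here `G` is the gradient of `u` and `c` the barycenter of `B_R^0`. -/
def hNorm {d : ℕ} (α h : ℝ) (c : Rd d) (R : ℝ) (u : Rd1 d → ℝ) (G : Rd1 d → Vec d) : ℝ≥0∞ :=
  (ENNReal.ofReal ((h / R) ^ 2) * eLpNorm G 2 ((wvol d α).restrict (box c R)) ^ 2 +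
    ENNReal.ofReal (1 / R ^ 2) * eLpNorm u 2 ((wvol d α).restrict (box c R)) ^ 2) ^ (1 / 2 : ℝ)

end FracCacc

end

noncomputable section

namespace FracCacc

variable {d : ℕ}

/-! Let `w` be the Beppo-Levi extension of `u`, `g` its trace, `h` the mesh width, `τ = δ R` and `η`
a cutoff for the small box with `|∇η| ≲ 1/τ`. The classical Caccioppoli argument tests with `η² w`,
but the trace `η² g` is not piecewise affine. The admissible substitute is `v = η² w - e`, where `e`
lifts the interpolation error `e₀ = η² g - I(η² g)`. Its trace `I(η² g)` lies in `S10`, and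
interpolation enlarges the support by at most `h`, so `16 h ≤ τ` keeps it over the large box and
`a(w, v) = 0`. With `θ = (h/τ)²`, it suffices that `‖∇e‖² ≤ B θ (τ⁻² ‖w‖² + θ ‖∇w‖² + ‖η ∇w‖²)`.
Young's inequality for `∫ ∇w · ∇e` with weight `B θ` then produces the admissible term `θ ‖∇w‖²`,
and the remaining `‖η ∇w‖²` is absorbed (`energy_le`).

The lifting is `e = e₀(x) χ(t)`, so its energy splits into four one-factor integrals
(`lintegral_gradOf_tensor`). On an element `g` is an affine function `A`, and interpolation
reproduces the affine part of `η² A`, so `e₀` is of second order (`interp_error_le`). Its size is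
governed by `τ⁻² |A z|`, `τ⁻² H |∇A|` and `|∇(η²)| |∇A|` with `H` the element diameter. The factor
`η` in `∇(η²) = 2 η ∇η` is what later yields `‖η ∇w‖²`. `inverse_estimate_grad` and
`inverse_estimate_value` replace `|∇A|²` and `|A z|²` by energies of `w` on the prism over the
element. They rest on a weighted trace inequality (`trace_inequality_line`) and on its version for
tangential differences, in which only `∇w` occurs.

The constant is uniform in `s` because the same number `(1 - α) / (1 + α) * h ^ (1 + α)` is the
factor gained in the trace inequality and the price of the lifting profile (`exists_profile`); it
cancels. Quasiuniformity is not needed, since elements smaller than `h` only improve the estimates.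

Two facts make the test function legitimate. Compactly supported Lipschitz functions are Beppo-Levi
functions with the expected trace (`hasTrace_ofLipschitz`), which covers `e`. Nodal interpolants of
functions that vanish at the boundary vertices are continuous (`Mesh.continuous_hat`), which covers
`I(η² g)`. -/

/-! ### Gradients as vectors of `Vec d` -/

/-- The vector of `Vec d` that represents a linear functional on `Rd1 d`. -/
def gradOfLinear (d : ℕ) : (Rd1 d →L[ℝ] ℝ) →ₗ[ℝ] Vec d where
  toFun ℓ := WithLp.toLp 2
    ((InnerProductSpace.toDual ℝ (Rd d)).symm (ℓ.comp (ContinuousLinearMap.inl ℝ (Rd d) ℝ)), ℓ (0, 1))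
  map_add' a b := by
    simp [ContinuousLinearMap.add_comp, ← WithLp.toLp_add]
  map_smul' c a := by
    simp [ContinuousLinearMap.smul_comp, ← WithLp.toLp_smul]

theorem gradOfLinear_apply (ℓ : Rd1 d →L[ℝ] ℝ) : gradOfLinear d ℓ = WithLp.toLp 2
    ((InnerProductSpace.toDual ℝ (Rd d)).symm (ℓ.comp (ContinuousLinearMap.inl ℝ (Rd d) ℝ)), ℓ (0, 1)) :=
  rfl

theorem norm_gradOfLinear_sq (ℓ : Rd1 d →L[ℝ] ℝ) : ‖gradOfLinear d ℓ‖ ^ 2 =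
    ‖ℓ.comp (ContinuousLinearMap.inl ℝ (Rd d) ℝ)‖ ^ 2 + (ℓ (0, 1)) ^ 2 := by
  rw [gradOfLinear_apply, WithLp.prod_norm_sq_eq_of_L2]
  simp

/-- `Rd1 d` carries the supremum norm and `Vec d` the Euclidean one; the factor two covers the
mismatch. -/
theorem norm_gradOfLinear_le (ℓ : Rd1 d →L[ℝ] ℝ) : ‖gradOfLinear d ℓ‖ ≤ 2 * ‖ℓ‖ := by
  have h1 : ‖ℓ.comp (ContinuousLinearMap.inl ℝ (Rd d) ℝ)‖ ≤ ‖ℓ‖ := by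
    refine ContinuousLinearMap.opNorm_le_bound _ (norm_nonneg _) fun x => ?_
    refine (ℓ.le_opNorm _).trans (le_of_eq ?_)
    simp [Prod.norm_def]
  have h2 : |ℓ (0, 1)| ≤ ‖ℓ‖ := by
    refine (ℓ.le_opNorm _).trans (le_of_eq ?_)
    simp [Prod.norm_def]
  have h3 := norm_gradOfLinear_sq ℓ
  have h4 : (ℓ (0, 1)) ^ 2 ≤ ‖ℓ‖ ^ 2 := by rw [← sq_abs]; gcongr
  have h5 : ‖ℓ.comp (ContinuousLinearMap.inl ℝ (Rd d) ℝ)‖ ^ 2 ≤ ‖ℓ‖ ^ 2 := by gcongr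
  nlinarith [norm_nonneg (gradOfLinear d ℓ), norm_nonneg ℓ]

/-- `gradOfLinear` as a continuous linear map. -/
def gradOf : (Rd1 d →L[ℝ] ℝ) →L[ℝ] Vec d :=
  (gradOfLinear d).mkContinuous 2 norm_gradOfLinear_le

theorem gradOf_apply (ℓ : Rd1 d →L[ℝ] ℝ) : gradOf ℓ = WithLp.toLp 2
    ((InnerProductSpace.toDual ℝ (Rd d)).symm (ℓ.comp (ContinuousLinearMap.inl ℝ (Rd d) ℝ)), ℓ (0, 1)) :=
  rfl

theorem norm_gradOf_sq (ℓ : Rd1 d →L[ℝ] ℝ) :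
    ‖gradOf ℓ‖ ^ 2 = ‖ℓ.comp (ContinuousLinearMap.inl ℝ (Rd d) ℝ)‖ ^ 2 + (ℓ (0, 1)) ^ 2 :=
  norm_gradOfLinear_sq ℓ

theorem norm_gradOf_le (ℓ : Rd1 d →L[ℝ] ℝ) : ‖gradOf ℓ‖ ≤ 2 * ‖ℓ‖ := norm_gradOfLinear_le ℓ

theorem inner_gradOf (ℓ : Rd1 d →L[ℝ] ℝ) (e : Rd1 d) :
    inner ℝ (gradOf ℓ) (WithLp.toLp 2 e) = ℓ e := by
  rw [gradOf_apply, WithLp.prod_inner_apply]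
  have : ℓ e = ℓ (e.1, 0) + e.2 * ℓ (0, 1) := by
    rw [← smul_eq_mul, ← map_smul, ← map_add]; simp
  rw [this]
  simp

theorem classicalGrad_eq_gradOf {φ : Rd1 d → ℝ} {z : Rd1 d} (h : DifferentiableAt ℝ φ z) :
    classicalGrad φ z = gradOf (fderiv ℝ φ z) := by
  have h1 : HasFDerivAt (fun x : Rd d => φ (x, z.2))
      ((fderiv ℝ φ z).comp (ContinuousLinearMap.inl ℝ (Rd d) ℝ)) z.1 :=
    HasFDerivAt.comp (g := φ) z.1 (f := fun x : Rd d => (x, z.2)) h.hasFDerivAt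
      (hasFDerivAt_prodMk_left z.1 z.2)
  have h2 : HasFDerivAt (fun t : ℝ => φ (z.1, t))
      ((fderiv ℝ φ z).comp (ContinuousLinearMap.inr ℝ (Rd d) ℝ)) z.2 :=
    HasFDerivAt.comp (g := φ) z.2 (f := fun t : ℝ => (z.1, t)) h.hasFDerivAt
      (hasFDerivAt_prodMk_right z.1 z.2)
  rw [classicalGrad, gradOf_apply, gradient, h1.fderiv, h2.hasDerivAt.deriv]
  simp

theorem inner_classicalGrad {φ : Rd1 d → ℝ} {z : Rd1 d} (h : DifferentiableAt ℝ φ z) (e : Rd1 d) :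
    inner ℝ (classicalGrad φ z) (WithLp.toLp 2 e) = fderiv ℝ φ z e := by
  rw [classicalGrad_eq_gradOf h, inner_gradOf]

theorem continuous_classicalGrad {φ : Rd1 d → ℝ} (h : ContDiff ℝ 1 φ) :
    Continuous (classicalGrad φ) := by
  have : classicalGrad φ = fun z => gradOf (fderiv ℝ φ z) :=
    funext fun z => classicalGrad_eq_gradOf (h.differentiable one_ne_zero z)
  rw [this]
  exact gradOf.continuous.comp (h.continuous_fderiv one_ne_zero)

theorem classicalGrad_mul {f g : Rd1 d → ℝ} {z : Rd1 d} (hf : DifferentiableAt ℝ f z)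
    (hg : DifferentiableAt ℝ g z) :
    classicalGrad (fun z => f z * g z) z = f z • classicalGrad g z + g z • classicalGrad f z := by
  rw [classicalGrad_eq_gradOf (hf.fun_mul hg), classicalGrad_eq_gradOf hf, classicalGrad_eq_gradOf hg,
    fderiv_fun_mul hf hg, map_add, map_smul, map_smul]

theorem classicalGrad_sub {f g : Rd1 d → ℝ} {z : Rd1 d} (hf : DifferentiableAt ℝ f z)
    (hg : DifferentiableAt ℝ g z) :
    classicalGrad (fun z => f z - g z) z = classicalGrad f z - classicalGrad g z := by
  rw [classicalGrad_eq_gradOf (hf.fun_sub hg), classicalGrad_eq_gradOf hf, classicalGrad_eq_gradOf hg,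
    fderiv_fun_sub hf hg, map_sub]

/-! ### The weighted measure -/

theorem isOpen_halfSpace : IsOpen (halfSpace d) := isOpen_lt continuous_const continuous_snd

theorem halfSpace_eq : halfSpace d = univ ×ˢ Ioi 0 := by
  ext z; simp [halfSpace]

/-- The measure `t^α dt` on `(0, ∞)`. -/
def wline (α : ℝ) : Measure ℝ :=
  (volume.restrict (Ioi (0 : ℝ))).withDensity (fun t => ENNReal.ofReal (t ^ α))

theorem measurable_weight (α : ℝ) : Measurable (fun t : ℝ => ENNReal.ofReal (t ^ α)) := by
  fun_prop

instance sFinite_wline (α : ℝ) : SFinite (wline α) := by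
  unfold wline; infer_instance

/-- The weight depends on the last variable only. This gives Fubini, invariance under tangential
translations and the splitting of energies of product functions. -/
theorem wvol_eq_prod (α : ℝ) : wvol d α = (volume : Measure (Rd d)).prod (wline α) := by
  unfold wvol wline
  rw [prod_withDensity_right (measurable_weight α), halfSpace_eq, Measure.volume_eq_prod,
    ← Measure.prod_restrict, Measure.restrict_univ]

instance sFinite_wvol (α : ℝ) : SFinite (wvol d α) := by
  unfold wvol; infer_instance

theorem wvol_absolutelyContinuous (α : ℝ) : wvol d α ≪ volume :=
  (withDensity_absolutelyContinuous _ _).trans Measure.absolutelyContinuous_restrict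

/-- The condition `-1 < α` is integrability of `t ^ α` at zero; through it bounded sets touching the
boundary have finite weighted measure. -/
theorem wline_Ioo_lt_top {α : ℝ} (hα : -1 < α) (a b : ℝ) : wline α (Ioo a b) < ⊤ := by
  unfold wline
  rw [withDensity_apply _ measurableSet_Ioo, Measure.restrict_restrict measurableSet_Ioo]
  have h1 : IntervalIntegrable (fun t : ℝ => t ^ α) volume 0 (max 0 b) :=
    intervalIntegral.intervalIntegrable_rpow' hα
  rw [intervalIntegrable_iff_integrableOn_Ioc_of_le (le_max_left _ _)] at h1
  have h2 := h1.lintegral_lt_top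
  refine lt_of_le_of_lt (lintegral_mono_set ?_) h2
  intro t ht
  exact ⟨ht.2, ht.1.2.le.trans (le_max_right _ _)⟩

theorem wvol_lt_top_of_isBounded {α : ℝ} (hα : -1 < α) {K : Set (Rd1 d)}
    (hK : Bornology.IsBounded K) : wvol d α K < ⊤ := by
  obtain ⟨r, hr⟩ := hK.subset_ball 0
  refine lt_of_le_of_lt (measure_mono (t := Metric.ball (0 : Rd d) r ×ˢ Ioo (-r) r) ?_) ?_
  · intro z hz
    have := hr hz
    rw [← Prod.mk_zero_zero, ← ball_prod_same, Real.ball_eq_Ioo] at this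
    simpa using this
  · rw [wvol_eq_prod, Measure.prod_prod]
    exact ENNReal.mul_lt_top Metric.isBounded_ball.measure_lt_top (wline_Ioo_lt_top hα _ _)

theorem ae_wvol_of_ae_volume {α : ℝ} {P : Rd1 d → Prop} (h : ∀ᵐ z, P z) : ∀ᵐ z ∂(wvol d α), P z :=
  (wvol_absolutelyContinuous α).ae_le h

/-! ### Weak gradients -/

theorem integrable_mul_of_locallyIntegrableOn {D : Set (Rd1 d)} {u φ : Rd1 d → ℝ}
    (hu : LocallyIntegrableOn u D volume) (hφ : Continuous φ) (hc : HasCompactSupport φ)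
    (hs : tsupport φ ⊆ D) : Integrable (fun z => u z * φ z) := by
  have h1 : IntegrableOn u (tsupport φ) := hu.integrableOn_compact_subset hs hc
  have h2 : IntegrableOn (fun z => u z * φ z) (tsupport φ) :=
    h1.mul_continuousOn hφ.continuousOn hc
  refine (integrableOn_iff_integrable_of_support_subset ?_).1 h2
  intro z hz
  refine subset_tsupport _ ?_
  simp only [Function.mem_support] at hz ⊢
  exact right_ne_zero_of_mul hz

theorem locallyIntegrableOn_inner {D : Set (Rd1 d)} {G : Rd1 d → Vec d} (v : Vec d)
    (hG : LocallyIntegrableOn G D volume) :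
    LocallyIntegrableOn (fun z => inner ℝ (G z) v) D volume := by
  intro x hx
  obtain ⟨U, hU, h⟩ := hG x hx
  refine ⟨U, hU, ?_⟩
  have := h.const_inner (𝕜 := ℝ) v
  simpa only [IntegrableOn, real_inner_comm] using this

theorem locallyIntegrableOn_smul_continuous {E : Type*} [NormedAddCommGroup E] [NormedSpace ℝ E]
    {D : Set (Rd1 d)} (hD : IsOpen D) {G : Rd1 d → E} {m : Rd1 d → ℝ}
    (hG : LocallyIntegrableOn G D volume) (hm : Continuous m) :
    LocallyIntegrableOn (fun z => m z • G z) D volume := by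
  rw [locallyIntegrableOn_iff hD.isLocallyClosed] at hG ⊢
  intro K hK hc
  exact (hG K hK hc).continuousOn_smul hm.continuousOn hc

theorem locallyIntegrableOn_smul_continuous' {E : Type*} [NormedAddCommGroup E] [NormedSpace ℝ E]
    {D : Set (Rd1 d)} (hD : IsOpen D) {u : Rd1 d → ℝ} {G : Rd1 d → E}
    (hu : LocallyIntegrableOn u D volume) (hG : Continuous G) :
    LocallyIntegrableOn (fun z => u z • G z) D volume := by
  rw [locallyIntegrableOn_iff hD.isLocallyClosed] at hu ⊢
  intro K hK hc
  exact (hu K hK hc).smul_continuousOn hG.continuousOn hc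

theorem HasWeakGradOn.sub {D : Set (Rd1 d)} {u v : Rd1 d → ℝ} {G H : Rd1 d → Vec d}
    (hu : HasWeakGradOn D u G) (hv : HasWeakGradOn D v H) :
    HasWeakGradOn D (fun z => u z - v z) (fun z => G z - H z) where
  locInt := hu.locInt.sub hv.locInt
  locInt_grad := hu.locInt_grad.sub hv.locInt_grad
  integral_eq φ hφ hc hs e := by
    have hφ' : Continuous fun z => fderiv ℝ φ z e :=
      (hφ.continuous_fderiv (by simp)).clm_apply continuous_const
    have hc' : HasCompactSupport fun z => fderiv ℝ φ z e := hc.fderiv_apply ℝ e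
    have hs' : tsupport (fun z => fderiv ℝ φ z e) ⊆ D := (tsupport_fderiv_apply_subset ℝ e).trans hs
    simp only [sub_mul, inner_sub_left]
    rw [integral_sub (integrable_mul_of_locallyIntegrableOn hu.locInt hφ' hc' hs')
      (integrable_mul_of_locallyIntegrableOn hv.locInt hφ' hc' hs'),
      integral_sub (integrable_mul_of_locallyIntegrableOn
        (locallyIntegrableOn_inner _ hu.locInt_grad) hφ.continuous hc hs)
      (integrable_mul_of_locallyIntegrableOn
        (locallyIntegrableOn_inner _ hv.locInt_grad) hφ.continuous hc hs),
      hu.integral_eq φ hφ hc hs e, hv.integral_eq φ hφ hc hs e]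
    ring

/-- The identity for `u`, tested with `m φ` in place of `φ`, is the product rule after moving the
term with `∇m` to the other side. -/
theorem HasWeakGradOn.mul_smooth {D : Set (Rd1 d)} (hD : IsOpen D) {u m : Rd1 d → ℝ}
    {G : Rd1 d → Vec d} (hu : HasWeakGradOn D u G) (hm : ContDiff ℝ ∞ m) :
    HasWeakGradOn D (fun z => m z * u z) (fun z => m z • G z + u z • classicalGrad m z) where
  locInt := locallyIntegrableOn_smul_continuous hD hu.locInt hm.continuous
  locInt_grad := (locallyIntegrableOn_smul_continuous hD hu.locInt_grad hm.continuous).add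
    (locallyIntegrableOn_smul_continuous' hD hu.locInt
      (continuous_classicalGrad (hm.of_le (by simp))))
  integral_eq φ hφ hc hs e := by
    have hmd : Differentiable ℝ m := hm.differentiable (by simp)
    have hφd : Differentiable ℝ φ := hφ.differentiable (by simp)
    have hprod : ContDiff ℝ ∞ (fun z => m z * φ z) := hm.mul hφ
    have hpc : HasCompactSupport (fun z => m z * φ z) := hc.mul_left
    have hps : tsupport (fun z => m z * φ z) ⊆ D := (tsupport_mul_subset_right).trans hs
    have hm' : Continuous fun z => fderiv ℝ m z e :=
      (hm.continuous_fderiv (by simp)).clm_apply continuous_const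
    have key := hu.integral_eq _ hprod hpc hps e
    have h1 : ∀ z, fderiv ℝ (fun z => m z * φ z) z e =
        m z * fderiv ℝ φ z e + fderiv ℝ m z e * φ z := by
      intro z
      rw [fderiv_fun_mul (hmd z) (hφd z)]
      simp
      ring
    have hφ' : Continuous fun z => fderiv ℝ φ z e :=
      (hφ.continuous_fderiv (by simp)).clm_apply continuous_const
    have hc' : HasCompactSupport fun z => fderiv ℝ φ z e := hc.fderiv_apply ℝ e
    have hs' : tsupport (fun z => fderiv ℝ φ z e) ⊆ D := (tsupport_fderiv_apply_subset ℝ e).trans hs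
    have I1 : Integrable (fun z => u z * (m z * fderiv ℝ φ z e)) :=
      integrable_mul_of_locallyIntegrableOn hu.locInt (hm.continuous.mul hφ') hc'.mul_left
        (tsupport_mul_subset_right.trans hs')
    have I2 : Integrable (fun z => u z * (fderiv ℝ m z e * φ z)) :=
      integrable_mul_of_locallyIntegrableOn hu.locInt (hm'.mul hφ.continuous) hc.mul_left
        (tsupport_mul_subset_right.trans hs)
    have I3 : Integrable (fun z => inner ℝ (G z) (WithLp.toLp 2 e) * (m z * φ z)) :=
      integrable_mul_of_locallyIntegrableOn (locallyIntegrableOn_inner _ hu.locInt_grad)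
        hprod.continuous hpc hps
    simp only [h1, mul_add] at key
    rw [integral_add I1 I2] at key
    have e1 : ∫ z, inner ℝ (m z • G z + u z • classicalGrad m z) (WithLp.toLp 2 e) * φ z =
        (∫ z, inner ℝ (G z) (WithLp.toLp 2 e) * (m z * φ z)) +
          ∫ z, u z * (fderiv ℝ m z e * φ z) := by
      rw [← integral_add I3 I2]
      refine integral_congr_ae (Eventually.of_forall fun z => ?_)
      simp only [inner_add_left, real_inner_smul_left, inner_classicalGrad (hmd z)]
      ring
    have e2 : ∫ z, m z * u z * fderiv ℝ φ z e = ∫ z, u z * (m z * fderiv ℝ φ z e) := by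
      congr 1; ext z; ring
    rw [e1, e2]
    linarith

/-- Uniqueness by the fundamental lemma of the calculus of variations, direction by direction. It
identifies an arbitrary gradient `G` of `u` with the gradient of the Beppo-Levi extension on the
box. -/
theorem HasWeakGradOn.ae_eq {D : Set (Rd1 d)} (hD : IsOpen D) {u v : Rd1 d → ℝ}
    {G H : Rd1 d → Vec d} (hu : HasWeakGradOn D u G) (hv : HasWeakGradOn D v H)
    (huv : ∀ᵐ z ∂(volume.restrict D), u z = v z) :
    ∀ᵐ z ∂(volume.restrict D), G z = H z := by
  have hsub := hu.sub hv
  have hcomp : ∀ e : Rd1 d, ∀ᵐ z, z ∈ D → inner ℝ (G z - H z) (WithLp.toLp 2 e) = 0 := by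
    intro e
    refine hD.ae_eq_zero_of_integral_contDiff_smul_eq_zero
      (locallyIntegrableOn_inner _ hsub.locInt_grad) fun φ hφ hc hs => ?_
    have h := hsub.integral_eq φ hφ hc hs e
    have h0 : ∫ z, (u z - v z) * fderiv ℝ φ z e = 0 := by
      rw [ae_restrict_iff' hD.measurableSet] at huv
      refine integral_eq_zero_of_ae ?_
      filter_upwards [huv] with z hz
      by_cases hzD : z ∈ D
      · simp [hz hzD]
      · have : fderiv ℝ φ z e = 0 := by
          have h1 := (tsupport_fderiv_apply_subset ℝ (f := φ) e).trans hs
          by_contra hne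
          exact hzD (h1 (subset_tsupport _ hne))
        simp [this]
    rw [h0] at h
    rw [← neg_eq_zero, h]
    congr 2; ext z; rw [smul_eq_mul, mul_comm]
  -- The null set depends on the direction, so only finitely many directions are used and the others
  -- follow by linearity.
  let b := Module.finBasis ℝ (Rd1 d)
  have hall : ∀ᵐ z, ∀ i, z ∈ D → inner ℝ (G z - H z) (WithLp.toLp 2 (b i)) = 0 :=
    ae_all_iff.2 fun i => hcomp (b i)
  rw [ae_restrict_iff' hD.measurableSet]
  filter_upwards [hall] with z hz hzD
  rw [← sub_eq_zero, ← inner_self_eq_zero (𝕜 := ℝ)]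
  have key : ∀ e : Rd1 d, inner ℝ (G z - H z) (WithLp.toLp 2 e) = 0 := by
    intro e
    rw [← b.sum_repr e, WithLp.toLp_sum, inner_sum]
    refine Finset.sum_eq_zero fun i _ => ?_
    rw [WithLp.toLp_smul, real_inner_smul_right, hz i hzD, mul_zero]
  exact key (WithLp.ofLp (G z - H z))

/-! ### Operations on Beppo-Levi functions -/

theorem BeppoLevi.aestronglyMeasurable {α : ℝ} (w : BeppoLevi d α) :
    AEStronglyMeasurable w.toFun (wvol d α) :=
  w.hasWeakGrad.locInt.aestronglyMeasurable.mono_ac (withDensity_absolutelyContinuous _ _)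

theorem tendsto_eLpNorm_add {X E ι : Type*} [MeasurableSpace X] [NormedAddCommGroup E]
    {μ : Measure X} {l : Filter ι} {f g : ι → X → E} (hf : ∀ n, AEStronglyMeasurable (f n) μ)
    (hg : ∀ n, AEStronglyMeasurable (g n) μ)
    (h1 : Tendsto (fun n => eLpNorm (f n) 2 μ) l (𝓝 0))
    (h2 : Tendsto (fun n => eLpNorm (g n) 2 μ) l (𝓝 0)) :
    Tendsto (fun n => eLpNorm (fun x => f n x + g n x) 2 μ) l (𝓝 0) := by
  have h3 := h1.add h2
  rw [add_zero] at h3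
  exact tendsto_of_tendsto_of_tendsto_of_le_of_le tendsto_const_nhds h3 (fun _ => zero_le)
    fun n => eLpNorm_add_le (hf n) (hg n) (by norm_num)

theorem tendsto_eLpNorm_sub {X E ι : Type*} [MeasurableSpace X] [NormedAddCommGroup E]
    {μ : Measure X} {l : Filter ι} {f g : ι → X → E} (hf : ∀ n, AEStronglyMeasurable (f n) μ)
    (hg : ∀ n, AEStronglyMeasurable (g n) μ)
    (h1 : Tendsto (fun n => eLpNorm (f n) 2 μ) l (𝓝 0))
    (h2 : Tendsto (fun n => eLpNorm (g n) 2 μ) l (𝓝 0)) :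
    Tendsto (fun n => eLpNorm (fun x => f n x - g n x) 2 μ) l (𝓝 0) := by
  have h3 := h1.add h2
  rw [add_zero] at h3
  exact tendsto_of_tendsto_of_tendsto_of_le_of_le tendsto_const_nhds h3 (fun _ => zero_le)
    fun n => eLpNorm_sub_le (hf n) (hg n) (by norm_num)

theorem tendsto_eLpNorm_of_norm_le {X E F ι : Type*} [MeasurableSpace X] [NormedAddCommGroup E]
    [NormedAddCommGroup F] {μ : Measure X} {l : Filter ι} {f : ι → X → E} {g : ι → X → F} (c : ℝ)
    (hfg : ∀ n, ∀ᵐ x ∂μ, ‖f n x‖ ≤ c * ‖g n x‖)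
    (h : Tendsto (fun n => eLpNorm (g n) 2 μ) l (𝓝 0)) :
    Tendsto (fun n => eLpNorm (f n) 2 μ) l (𝓝 0) := by
  have h3 : Tendsto (fun n => ENNReal.ofReal c * eLpNorm (g n) 2 μ) l (𝓝 (ENNReal.ofReal c * 0)) :=
    ENNReal.Tendsto.const_mul h (Or.inr ENNReal.ofReal_ne_top)
  rw [mul_zero] at h3
  exact tendsto_of_tendsto_of_tendsto_of_le_of_le tendsto_const_nhds h3 (fun _ => zero_le)
    fun n => eLpNorm_le_mul_eLpNorm_of_ae_le_mul (hfg n) 2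

/-- A Beppo-Levi function is a priori only locally integrable inside the open half-space. Square
integrability up to the boundary comes from a smooth approximant: it is bounded on bounded sets, and
its distance to `w` in `L²_α(K)` is finite. -/
theorem HasTrace.memLp_restrict {α : ℝ} (hα : -1 < α) {w : BeppoLevi d α} {g : Rd d → ℝ}
    (h : HasTrace w g) {K : Set (Rd1 d)} (hK : Bornology.IsBounded K) :
    MemLp w.toFun 2 ((wvol d α).restrict K) := by
  obtain ⟨-, φ, hφ, -, -, hL, -⟩ := h
  obtain ⟨n, hn⟩ := ((hL K hK).eventually (gt_mem_nhds (show (0 : ℝ≥0∞) < 1 by simp))).exists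
  have hmeas : AEStronglyMeasurable (φ n) ((wvol d α).restrict K) :=
    (hφ n).continuous.aestronglyMeasurable
  have h1 : MemLp (fun z => φ n z - w.toFun z) 2 ((wvol d α).restrict K) :=
    ⟨hmeas.sub w.aestronglyMeasurable.restrict, hn.trans (by simp)⟩
  have h2 : MemLp (φ n) 2 ((wvol d α).restrict K) := by
    obtain ⟨C, hC⟩ := (hK.isCompact_closure).exists_bound_of_continuousOn (hφ n).continuous.continuousOn
    have : IsFiniteMeasure ((wvol d α).restrict K) :=
      ⟨by simpa using wvol_lt_top_of_isBounded hα hK⟩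
    have hcl : IsFiniteMeasure ((wvol d α).restrict (closure K)) :=
      ⟨by simpa using wvol_lt_top_of_isBounded hα hK.closure⟩
    refine MemLp.mono_measure (Measure.restrict_mono_set _ subset_closure)
      (MemLp.of_bound (hφ n).continuous.aestronglyMeasurable C ?_)
    filter_upwards [ae_restrict_mem isClosed_closure.measurableSet] with z hz using hC z hz
  have h3 := h2.sub h1
  refine h3.congr_norm w.aestronglyMeasurable.restrict (Eventually.of_forall fun z => ?_)
  simp

/-- The difference of two Beppo-Levi functions. -/
def BeppoLevi.sub {α : ℝ} (u v : BeppoLevi d α) : BeppoLevi d α where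
  toFun z := u.toFun z - v.toFun z
  grad z := u.grad z - v.grad z
  hasWeakGrad := u.hasWeakGrad.sub v.hasWeakGrad
  memLp_grad := u.memLp_grad.sub v.memLp_grad

theorem HasTrace.sub {α : ℝ} {u v : BeppoLevi d α} {f g : Rd d → ℝ} (hu : HasTrace u f)
    (hv : HasTrace v g) : HasTrace (u.sub v) (fun x => f x - g x) := by
  obtain ⟨mf, φ, hφ, hφL, hφG, hφK, hφT⟩ := hu
  obtain ⟨mg, ψ, hψ, hψL, hψG, hψK, hψT⟩ := hv
  have hgr : ∀ n z, classicalGrad (fun z => φ n z - ψ n z) z =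
      classicalGrad (φ n) z - classicalGrad (ψ n) z := fun n z =>
    classicalGrad_sub ((hφ n).differentiable (by simp) z) ((hψ n).differentiable (by simp) z)
  refine ⟨mf.sub mg, fun n z => φ n z - ψ n z, fun n => (hφ n).sub (hψ n), fun n => ?_, ?_,
    fun K hK => ?_, fun K hK => ?_⟩
  · have := (hφL n).sub (hψL n)
    rwa [show classicalGrad (fun z => φ n z - ψ n z) = classicalGrad (φ n) - classicalGrad (ψ n) from
      funext (hgr n)]
  · have := tendsto_eLpNorm_sub (fun n => ((hφL n).sub u.memLp_grad).1)
      (fun n => ((hψL n).sub v.memLp_grad).1) hφG hψG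
    refine this.congr fun n => ?_
    congr 1; ext1 z; simp only [hgr, Pi.sub_apply, BeppoLevi.sub]; abel
  · have := tendsto_eLpNorm_sub (μ := (wvol d α).restrict K)
      (fun n => (hφ n).continuous.aestronglyMeasurable.sub u.aestronglyMeasurable.restrict)
      (fun n => (hψ n).continuous.aestronglyMeasurable.sub v.aestronglyMeasurable.restrict)
      (hφK K hK) (hψK K hK)
    refine this.congr fun n => ?_
    congr 1; ext1 z; simp only [Pi.sub_apply, BeppoLevi.sub]; abel
  · have hc : Continuous fun x : Rd d => (x, (0 : ℝ)) := by fun_prop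
    have := tendsto_eLpNorm_sub (μ := volume.restrict K)
      (fun n => ((hφ n).continuous.comp hc).aestronglyMeasurable.sub mf.restrict)
      (fun n => ((hψ n).continuous.comp hc).aestronglyMeasurable.sub mg.restrict)
      (hφT K hK) (hψT K hK)
    refine this.congr fun n => ?_
    congr 1; ext1 z; simp only [Pi.sub_apply, Function.comp]; ring

theorem classicalGrad_eq_zero {m : Rd1 d → ℝ} (hm : Differentiable ℝ m) {z : Rd1 d}
    (hz : z ∉ tsupport m) : classicalGrad m z = 0 := by
  rw [classicalGrad_eq_gradOf (hm z)]
  have : fderiv ℝ m z = 0 := by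
    have h1 := tsupport_fderiv_subset ℝ (f := m)
    by_contra hne
    exact hz (h1 (subset_tsupport _ hne))
  rw [this, map_zero]

/-- Square integrability of `u` is needed only on `tsupport m`, since the gradient of `m` vanishes
elsewhere. -/
theorem memLp_mul_grad_add {α : ℝ} {m u : Rd1 d → ℝ} {G : Rd1 d → Vec d} (hm : ContDiff ℝ ∞ m)
    (hc : HasCompactSupport m) (hu : AEStronglyMeasurable u (wvol d α))
    (huL : MemLp u 2 ((wvol d α).restrict (tsupport m))) (hG : MemLp G 2 (wvol d α)) :
    MemLp (fun z => m z • G z + u z • classicalGrad m z) 2 (wvol d α) := by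
  have hgc : Continuous (classicalGrad m) := continuous_classicalGrad (hm.of_le (by simp))
  obtain ⟨C, hC⟩ := hm.continuous.bounded_above_of_compact_support hc
  have hgs : HasCompactSupport (classicalGrad m) := by
    refine HasCompactSupport.intro (K := tsupport m) hc fun z hz =>
      classicalGrad_eq_zero (hm.differentiable (by simp)) hz
  obtain ⟨C', hC'⟩ := hgc.bounded_above_of_compact_support hgs
  refine MemLp.add ?_ ?_
  · exact hG.of_le_mul (c := C) (hm.continuous.aestronglyMeasurable.smul hG.1)
      (Eventually.of_forall fun z => by rw [norm_smul]; gcongr; exact hC z)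
  · have h1 : MemLp (fun z => u z • classicalGrad m z) 2 ((wvol d α).restrict (tsupport m)) := by
      refine huL.of_le_mul (c := C') (huL.1.smul hgc.aestronglyMeasurable)
        (Eventually.of_forall fun z => ?_)
      rw [norm_smul, mul_comm]; gcongr; exact hC' z
    have h2 := (memLp_indicator_iff_restrict (isClosed_tsupport m).measurableSet).2 h1
    refine h2.congr_norm (hu.smul hgc.aestronglyMeasurable) (Eventually.of_forall fun z => ?_)
    by_cases hz : z ∈ tsupport m
    · simp [hz]
    · simp [hz, classicalGrad_eq_zero (hm.differentiable (by simp)) hz]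

/-- The product of a Beppo-Levi function with a smooth compactly supported function. -/
def BeppoLevi.mulSmooth {α : ℝ} (w : BeppoLevi d α) (m : Rd1 d → ℝ) (hm : ContDiff ℝ ∞ m)
    (hc : HasCompactSupport m) (hw : MemLp w.toFun 2 ((wvol d α).restrict (tsupport m))) :
    BeppoLevi d α where
  toFun z := m z * w.toFun z
  grad z := m z • w.grad z + w.toFun z • classicalGrad m z
  hasWeakGrad := w.hasWeakGrad.mul_smooth isOpen_halfSpace hm
  memLp_grad := memLp_mul_grad_add hm hc w.aestronglyMeasurable hw w.memLp_grad

/-- The approximants `φ n` of `w` are multiplied by `m`. The extra term `(φ n - w) ∇m` of the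
product rule lives on the compact support of `m`, where the functions themselves converge in `L²_α`.
-/
theorem HasTrace.mulSmooth {α : ℝ} (hα : -1 < α) {w : BeppoLevi d α} {g : Rd d → ℝ}
    (h : HasTrace w g) {m : Rd1 d → ℝ} (hm : ContDiff ℝ ∞ m) (hc : HasCompactSupport m) :
    HasTrace (w.mulSmooth m hm hc (h.memLp_restrict hα hc.isBounded)) (fun x => m (x, 0) * g x) := by
  have hL := h.memLp_restrict hα hc.isBounded
  obtain ⟨mg, φ, hφ, hφL, hφG, hφK, hφT⟩ := h
  have hgr : ∀ n z, classicalGrad (fun z => m z * φ n z) z =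
      m z • classicalGrad (φ n) z + φ n z • classicalGrad m z := fun n z =>
    classicalGrad_mul (hm.differentiable (by simp) z) ((hφ n).differentiable (by simp) z)
  have hgc : Continuous (classicalGrad m) := continuous_classicalGrad (hm.of_le (by simp))
  obtain ⟨C, hC⟩ := hm.continuous.bounded_above_of_compact_support hc
  have hgs : HasCompactSupport (classicalGrad m) := by
    refine HasCompactSupport.intro (K := tsupport m) hc fun z hz =>
      classicalGrad_eq_zero (hm.differentiable (by simp)) hz
  obtain ⟨C', hC'⟩ := hgc.bounded_above_of_compact_support hgs
  have hc0 : Continuous fun x : Rd d => (x, (0 : ℝ)) := by fun_prop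
  have hφLK : ∀ n, MemLp (φ n) 2 ((wvol d α).restrict (tsupport m)) := by
    intro n
    obtain ⟨B, hB⟩ := hc.exists_bound_of_continuousOn (hφ n).continuous.continuousOn
    have : IsFiniteMeasure ((wvol d α).restrict (tsupport m)) :=
      ⟨by simpa using wvol_lt_top_of_isBounded hα hc.isBounded⟩
    refine MemLp.of_bound (hφ n).continuous.aestronglyMeasurable B ?_
    filter_upwards [ae_restrict_mem (isClosed_tsupport m).measurableSet] with z hz using hB z hz
  refine ⟨(hm.continuous.comp hc0).aestronglyMeasurable.mul mg, fun n z => m z * φ n z,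
    fun n => hm.mul (hφ n), fun n => ?_, ?_, fun K hK => ?_, fun K hK => ?_⟩
  · rw [show classicalGrad (fun z => m z * φ n z) =
      fun z => m z • classicalGrad (φ n) z + φ n z • classicalGrad m z from funext (hgr n)]
    exact memLp_mul_grad_add hm hc (hφ n).continuous.aestronglyMeasurable (hφLK n) (hφL n)
  · have h1 : Tendsto (fun n => eLpNorm (fun z => m z • (classicalGrad (φ n) z - w.grad z)) 2
        (wvol d α)) atTop (𝓝 0) := by
      refine tendsto_eLpNorm_of_norm_le C (fun n => Eventually.of_forall fun z => ?_) hφG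
      rw [norm_smul]; gcongr; exact hC z
    have h2 : Tendsto (fun n => eLpNorm (fun z => (φ n z - w.toFun z) • classicalGrad m z) 2
        (wvol d α)) atTop (𝓝 0) := by
      have h3 : Tendsto (fun n => eLpNorm (fun z => (φ n z - w.toFun z) • classicalGrad m z) 2
          ((wvol d α).restrict (tsupport m))) atTop (𝓝 0) := by
        refine tendsto_eLpNorm_of_norm_le C' (fun n => Eventually.of_forall fun z => ?_)
          (hφK _ hc.isBounded)
        rw [norm_smul, mul_comm]; gcongr; exact hC' z
      refine h3.congr fun n => ?_
      rw [← eLpNorm_indicator_eq_eLpNorm_restrict (isClosed_tsupport m).measurableSet]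
      congr 1
      refine indicator_eq_self.2 fun z hz => ?_
      by_contra hne
      simp [classicalGrad_eq_zero (hm.differentiable (by simp)) hne] at hz
    have := tendsto_eLpNorm_add
      (fun n => hm.continuous.aestronglyMeasurable.smul ((hφL n).sub w.memLp_grad).1)
      (fun n => ((hφ n).continuous.aestronglyMeasurable.sub w.aestronglyMeasurable).smul
        hgc.aestronglyMeasurable) h1 h2
    refine this.congr fun n => ?_
    congr 1; ext1 z
    simp only [hgr, Pi.sub_apply, Pi.smul_apply', BeppoLevi.mulSmooth, smul_sub, sub_smul]; abel
  · refine tendsto_eLpNorm_of_norm_le C (fun n => Eventually.of_forall fun z => ?_) (hφK K hK)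
    simp only [BeppoLevi.mulSmooth, ← mul_sub]
    rw [norm_mul]; gcongr; exact hC z
  · refine tendsto_eLpNorm_of_norm_le C (fun n => Eventually.of_forall fun x => ?_) (hφT K hK)
    rw [← mul_sub, norm_mul]; gcongr; exact hC _

/-! ### Lipschitz functions with compact support are Beppo-Levi functions with a trace -/

instance isAddHaarMeasure_volume : (volume : Measure (Rd1 d)).IsAddHaarMeasure := by
  rw [Measure.volume_eq_prod]; infer_instance

/-- Integration by parts for line derivatives of Lipschitz functions, combined with Rademacher's
theorem, by which these agree almost everywhere with the Fréchet derivative. -/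
theorem LipschitzWith.integral_mul_fderiv {C : NNReal} {f : Rd1 d → ℝ} (hf : LipschitzWith C f)
    {φ : Rd1 d → ℝ} (hφ : ContDiff ℝ 1 φ) (hc : HasCompactSupport φ) (e : Rd1 d) :
    ∫ z, f z * fderiv ℝ φ z e = - ∫ z, fderiv ℝ f z e * φ z := by
  obtain ⟨D, hD⟩ := hφ.lipschitzWith_of_hasCompactSupport hc one_ne_zero
  have h := hf.integral_lineDeriv_mul_eq (μ := volume) hD hc e
  have h1 : ∀ z, lineDeriv ℝ φ z (-e) = - fderiv ℝ φ z e := fun z => by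
    rw [(hφ.differentiable one_ne_zero z).lineDeriv_eq_fderiv, map_neg]
  have h2 : ∫ z, lineDeriv ℝ f z e * φ z = ∫ z, fderiv ℝ f z e * φ z := by
    refine integral_congr_ae ?_
    filter_upwards [hf.ae_differentiableAt (μ := volume)] with z hz
    rw [hz.lineDeriv_eq_fderiv]
  rw [← h2, h, ← integral_neg]
  refine integral_congr_ae (Eventually.of_forall fun z => ?_)
  simp only [h1]; ring

theorem locallyIntegrable_fderiv {C : NNReal} {f : Rd1 d → ℝ} (hf : LipschitzWith C f) :
    LocallyIntegrable (fderiv ℝ f) volume := by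
  have : MemLp (fderiv ℝ f) ⊤ (volume : Measure (Rd1 d)) :=
    memLp_top_of_bound (measurable_fderiv ℝ f).aestronglyMeasurable C
      (Eventually.of_forall fun z => norm_fderiv_le_of_lipschitz ℝ hf)
  exact this.locallyIntegrable le_top

theorem isFiniteMeasureOnCompacts_wvol {α : ℝ} (hα : -1 < α) :
    IsFiniteMeasureOnCompacts (wvol d α) :=
  ⟨fun _ hK => wvol_lt_top_of_isBounded hα hK.isBounded⟩

theorem fderiv_eq_zero_of_notMem_tsupport {f : Rd1 d → ℝ} {z : Rd1 d}
    (hz : z ∉ tsupport f) : fderiv ℝ f z = 0 := by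
  by_contra hne
  exact hz (tsupport_fderiv_subset ℝ (f := f) (subset_tsupport _ hne))

/-- A Lipschitz function with compact support as a Beppo-Levi function. -/
def BeppoLevi.ofLipschitz {α : ℝ} (hα : -1 < α) {C : NNReal} (f : Rd1 d → ℝ)
    (hf : LipschitzWith C f) (hc : HasCompactSupport f) : BeppoLevi d α where
  toFun := f
  grad z := gradOf (fderiv ℝ f z)
  hasWeakGrad :=
    { locInt := hf.continuous.locallyIntegrable.locallyIntegrableOn _
      locInt_grad := by
        refine LocallyIntegrable.locallyIntegrableOn (fun z => ?_) _
        obtain ⟨U, hU, h⟩ := locallyIntegrable_fderiv hf z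
        exact ⟨U, hU, gradOf.integrable_comp h⟩
      integral_eq := fun φ hφ hcφ _ e => by
        simp only [inner_gradOf]
        exact LipschitzWith.integral_mul_fderiv hf (hφ.of_le (by simp)) hcφ e }
  memLp_grad := by
    have hm : AEStronglyMeasurable (fun z => gradOf (fderiv ℝ f z)) (wvol d α) :=
      gradOf.continuous.comp_aestronglyMeasurable (measurable_fderiv ℝ f).aestronglyMeasurable
    have : IsFiniteMeasure ((wvol d α).restrict (tsupport f)) :=
      ⟨by simpa using wvol_lt_top_of_isBounded hα hc.isBounded⟩
    have h1 : MemLp (fun z => gradOf (fderiv ℝ f z)) 2 ((wvol d α).restrict (tsupport f)) := by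
      refine MemLp.of_bound hm.restrict (2 * C) (Eventually.of_forall fun z => ?_)
      refine (norm_gradOf_le _).trans ?_
      gcongr
      exact norm_fderiv_le_of_lipschitz ℝ hf
    refine ((memLp_indicator_iff_restrict (isClosed_tsupport f).measurableSet).2 h1).congr_norm hm
      (Eventually.of_forall fun z => ?_)
    by_cases hz : z ∈ tsupport f
    · simp [hz]
    · simp [hz, fderiv_eq_zero_of_notMem_tsupport hz]

/-! ### Mollification of Lipschitz functions -/

/-- A sequence of mollifiers. -/
def bumpSeq (d : ℕ) (n : ℕ) : ContDiffBump (0 : Rd1 d) where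
  -- The ratio of the radii is always two; a bounded ratio is what Lebesgue differentiation along
  -- these bumps requires.
  rIn := 1 / ((n : ℝ) + 1)
  rOut := 2 / ((n : ℝ) + 1)
  rIn_pos := by positivity
  rIn_lt_rOut := by gcongr; norm_num

theorem tendsto_bumpSeq_rOut : Tendsto (fun n => (bumpSeq d n).rOut) atTop (𝓝 0) := by
  have := (tendsto_one_div_add_atTop_nhds_zero_nat (𝕜 := ℝ)).const_mul 2
  simpa [bumpSeq, div_eq_mul_inv] using this

theorem bumpSeq_rOut_le (n : ℕ) : (bumpSeq d n).rOut ≤ 2 := by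
  change 2 / ((n : ℝ) + 1) ≤ 2
  rw [div_le_iff₀ (by positivity)]
  nlinarith [(Nat.cast_nonneg n : (0 : ℝ) ≤ n)]

open scoped Convolution

/-- The mollifications of a function. -/
def mollify {E : Type*} [NormedAddCommGroup E] [NormedSpace ℝ E] (f : Rd1 d → E) (n : ℕ) :
    Rd1 d → E :=
  (bumpSeq d n).normed volume ⋆[ContinuousLinearMap.lsmul ℝ ℝ, volume] f

theorem contDiff_mollify {f : Rd1 d → ℝ} (hf : Continuous f) (n : ℕ) :
    ContDiff ℝ ∞ (mollify f n) :=
  (bumpSeq d n).hasCompactSupport_normed.contDiff_convolution_left _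
    (bumpSeq d n).contDiff_normed hf.locallyIntegrable

/-- The derivative first falls on the smooth kernel; integration by parts against the Lipschitz
function moves it to `f`. Hence gradients of mollifications are mollifications of gradients. -/
theorem hasFDerivAt_mollify {C : NNReal} {f : Rd1 d → ℝ} (hf : LipschitzWith C f) (n : ℕ)
    (z : Rd1 d) : HasFDerivAt (mollify f n) (mollify (fderiv ℝ f) n z) z := by
  set ρ := (bumpSeq d n).normed (volume : Measure (Rd1 d)) with hρ
  have hρc : HasCompactSupport ρ := (bumpSeq d n).hasCompactSupport_normed
  have hρd : ContDiff ℝ 1 ρ := (bumpSeq d n).contDiff_normed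
  have h1 := hρc.hasFDerivAt_convolution_left (ContinuousLinearMap.lsmul ℝ ℝ) hρd
    (hf.continuous.locallyIntegrable (μ := volume)) z
  refine h1.congr_fderiv ?_
  refine ContinuousLinearMap.ext fun e => ?_
  have hg : ContDiff ℝ 1 fun y => ρ (z - y) := hρd.comp (contDiff_const.sub contDiff_id)
  have hgc : HasCompactSupport fun y => ρ (z - y) :=
    hρc.comp_homeomorph (Homeomorph.subLeft z)
  have hgd : ∀ y, fderiv ℝ (fun y => ρ (z - y)) y e = - fderiv ℝ ρ (z - y) e := by
    intro y
    have := ((hρd.differentiable one_ne_zero (z - y)).hasFDerivAt).comp y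
      ((hasFDerivAt_id y).const_sub z)
    have h2 : HasFDerivAt (fun y => ρ (z - y))
      ((fderiv ℝ ρ (z - y)).comp (-ContinuousLinearMap.id ℝ (Rd1 d))) y := this
    rw [h2.fderiv]
    simp
  have key := LipschitzWith.integral_mul_fderiv hf hg hgc e
  simp only [hgd, mul_neg, integral_neg, neg_inj] at key
  rw [mollify, convolution_eq_swap, convolution_eq_swap]
  have i2 : Integrable fun t => (ContinuousLinearMap.lsmul ℝ ℝ) (ρ (z - t)) (fderiv ℝ f t) := by
    have := (locallyIntegrable_fderiv hf).integrable_smul_left_of_hasCompactSupport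
      hg.continuous hgc
    exact this
  have i1 : Integrable fun t => ((ContinuousLinearMap.lsmul ℝ ℝ).precompL (Rd1 d))
      (fderiv ℝ ρ (z - t)) (f t) := by
    have hcc : HasCompactSupport fun t => fderiv ℝ ρ (z - t) :=
      (hρc.fderiv ℝ).comp_homeomorph (Homeomorph.subLeft z)
    have hct : Continuous fun t => fderiv ℝ ρ (z - t) :=
      (hρd.continuous_fderiv one_ne_zero).comp (continuous_const.sub continuous_id)
    refine Continuous.integrable_of_hasCompactSupport ?_ ?_
    · exact ((ContinuousLinearMap.precompL (Rd1 d)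
        (ContinuousLinearMap.lsmul ℝ ℝ)).continuous₂).comp (hct.prodMk hf.continuous)
    · refine hcc.mono fun t ht => ?_
      simp only [Function.mem_support] at ht ⊢
      contrapose! ht
      simp [ht]
  rw [ContinuousLinearMap.integral_apply i1, ContinuousLinearMap.integral_apply i2]
  simp only [ContinuousLinearMap.precompL_apply, ContinuousLinearMap.lsmul_apply, smul_eq_mul,
    smul_apply]
  simp only [mul_comm] at key ⊢
  exact key

theorem tendsto_eLpNorm_of_dominated {X E : Type*} [MeasurableSpace X] [NormedAddCommGroup E]
    {μ : Measure X} {f : ℕ → X → E} {B : Set X} (hB : MeasurableSet B) (hμB : μ B < ⊤) (C : ℝ)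
    (hm : ∀ n, AEStronglyMeasurable (f n) μ) (hC : ∀ n x, ‖f n x‖ ≤ C)
    (h0 : ∀ n, ∀ x ∉ B, f n x = 0) (hlim : ∀ᵐ x ∂μ, Tendsto (fun n => f n x) atTop (𝓝 0)) :
    Tendsto (fun n => eLpNorm (f n) 2 μ) atTop (𝓝 0) := by
  have h1 : Tendsto (fun n => ∫⁻ x, ‖f n x‖ₑ ^ (2 : ℝ) ∂μ) atTop (𝓝 (∫⁻ _, 0 ∂μ)) := by
    refine tendsto_lintegral_of_dominated_convergence' (B.indicator fun _ => ENNReal.ofReal C ^ (2 : ℝ))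
      (fun n => (hm n).enorm.pow_const _) (fun n => Eventually.of_forall fun x => ?_) ?_ ?_
    · by_cases hx : x ∈ B
      · rw [indicator_of_mem hx]
        refine ENNReal.rpow_le_rpow ?_ (by norm_num)
        rw [← ofReal_norm]
        exact ENNReal.ofReal_le_ofReal (hC n x)
      · simp [h0 n x hx]
    · rw [lintegral_indicator hB, setLIntegral_const]
      exact ENNReal.mul_ne_top (by simp) hμB.ne
    · filter_upwards [hlim] with x hx
      have := (continuous_enorm.tendsto (0 : E)).comp hx
      have h2 := (ENNReal.continuous_rpow_const (y := 2)).tendsto ‖(0 : E)‖ₑ |>.comp this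
      simpa [Function.comp_def] using h2
  rw [lintegral_zero] at h1
  have h2 := ((ENNReal.continuous_rpow_const (y := 1 / 2)).tendsto 0).comp h1
  simp only [ENNReal.zero_rpow_of_pos (show (0 : ℝ) < 1 / 2 by norm_num)] at h2
  refine h2.congr fun n => ?_
  rw [eLpNorm_eq_lintegral_rpow_enorm_toReal (by simp) (by simp)]
  simp

/-- Mollifications converge uniformly at the rate `C * rOut`, which settles the functions and the
traces on bounded sets at once. Their gradients converge almost everywhere by Lebesgue
differentiation and are dominated on a fixed compact neighbourhood of the support. -/
theorem hasTrace_ofLipschitz {α : ℝ} (hα : -1 < α) {C : NNReal} (f : Rd1 d → ℝ)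
    (hf : LipschitzWith C f) (hc : HasCompactSupport f) :
    HasTrace (BeppoLevi.ofLipschitz hα f hf hc) (fun x => f (x, 0)) := by
  have hc0 : Continuous fun x : Rd d => (x, (0 : ℝ)) := by fun_prop
  have hsm := fun n => contDiff_mollify hf.continuous n
  have hcg : ∀ n z, classicalGrad (mollify f n) z = gradOf (mollify (fderiv ℝ f) n z) := by
    intro n z
    rw [classicalGrad_eq_gradOf ((hasFDerivAt_mollify hf n z).differentiableAt),
      (hasFDerivAt_mollify hf n z).fderiv]
  have hcpt : ∀ n, HasCompactSupport (mollify f n) := fun n =>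
    HasCompactSupport.convolution _ (bumpSeq d n).hasCompactSupport_normed hc
  have hcc : ∀ n, Continuous (classicalGrad (mollify f n)) := fun n =>
    continuous_classicalGrad ((hsm n).of_le (by simp))
  have hfm : AEStronglyMeasurable (fderiv ℝ f) (volume : Measure (Rd1 d)) :=
    (measurable_fderiv ℝ f).aestronglyMeasurable
  have hbd : ∀ z, ‖fderiv ℝ f z‖ ≤ C := fun z => norm_fderiv_le_of_lipschitz ℝ hf
  have hunif : ∀ n z, ‖mollify f n z - f z‖ ≤ C * (bumpSeq d n).rOut := by
    intro n z
    rw [← dist_eq_norm]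
    refine (bumpSeq d n).dist_normed_convolution_le hf.continuous.aestronglyMeasurable
      fun x hx => (hf.dist_le_mul x z).trans ?_
    gcongr
    exact (Metric.mem_ball.1 hx).le
  refine ⟨(hf.continuous.comp hc0).aestronglyMeasurable, mollify f, hsm, fun n => ?_, ?_,
    fun K hK => ?_, fun K hK => ?_⟩
  · have := isFiniteMeasureOnCompacts_wvol (d := d) hα
    refine (hcc n).memLp_of_hasCompactSupport ?_
    exact HasCompactSupport.intro (K := tsupport (mollify f n)) (hcpt n) fun z hz =>
      classicalGrad_eq_zero ((hsm n).differentiable (by simp)) hz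
  · simp only [hcg, BeppoLevi.ofLipschitz, ← map_sub]
    have hB : IsCompact (Metric.cthickening 2 (tsupport f)) :=
      IsCompact.cthickening hc
    refine tendsto_eLpNorm_of_dominated hB.measurableSet (wvol_lt_top_of_isBounded hα hB.isBounded)
      (2 * (2 * C)) (fun n => ?_) (fun n z => ?_) (fun n z hz => ?_) ?_
    · simp only [map_sub, ← hcg]
      exact (hcc n).aestronglyMeasurable.sub
        (gradOf.continuous.comp_aestronglyMeasurable (measurable_fderiv ℝ f).aestronglyMeasurable)
    · refine (norm_gradOf_le _).trans ?_
      gcongr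
      rw [← dist_eq_norm]
      refine (bumpSeq d n).dist_normed_convolution_le hfm fun x _ => ?_
      rw [dist_eq_norm]
      refine (norm_sub_le _ _).trans ?_
      linarith [hbd x, hbd z]
    · have h0 : ∀ x ∈ Metric.ball z (bumpSeq d n).rOut, fderiv ℝ f x = 0 := by
        intro x hx
        refine fderiv_eq_zero_of_notMem_tsupport fun hxs => hz ?_
        refine Metric.mem_cthickening_of_dist_le z x 2 _ hxs ?_
        rw [dist_comm]
        exact (Metric.mem_ball.1 hx).le.trans (bumpSeq_rOut_le n)
      have hz0 := h0 z (Metric.mem_ball_self (bumpSeq d n).rOut_pos)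
      have : mollify (fderiv ℝ f) n z = fderiv ℝ f z :=
        (bumpSeq d n).normed_convolution_eq_right fun x hx => by rw [h0 x hx, hz0]
      rw [this, sub_self, map_zero]
    · refine ae_wvol_of_ae_volume ?_
      filter_upwards [ContDiffBump.ae_convolution_tendsto_right_of_locallyIntegrable
        (μ := (volume : Measure (Rd1 d))) (φ := bumpSeq d) (l := atTop) (K := 2) tendsto_bumpSeq_rOut
        (Eventually.of_forall fun n => le_of_eq (by simp [bumpSeq]; ring))
        (locallyIntegrable_fderiv hf)] with z hz
      have h1 : Tendsto (fun n => mollify (fderiv ℝ f) n z - fderiv ℝ f z) atTop (𝓝 0) := by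
        simpa [mollify] using hz.sub_const (fderiv ℝ f z)
      simpa [Function.comp_def] using (gradOf.continuous.tendsto 0).comp h1
  · have hfin : wvol d α K < ⊤ := wvol_lt_top_of_isBounded hα hK
    have hlim : Tendsto (fun n => (wvol d α K) ^ ((2 : ℝ)⁻¹) *
        ENNReal.ofReal (C * (bumpSeq d n).rOut)) atTop (𝓝 0) := by
      have h1 := (tendsto_bumpSeq_rOut (d := d)).const_mul (C : ℝ)
      have h2 := (ENNReal.continuous_ofReal.tendsto _).comp h1
      have h3 := ENNReal.Tendsto.const_mul (a := (wvol d α K) ^ ((2 : ℝ)⁻¹)) h2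
        (Or.inr (ENNReal.rpow_ne_top_of_nonneg (by norm_num) hfin.ne))
      simpa using h3
    refine tendsto_of_tendsto_of_tendsto_of_le_of_le tendsto_const_nhds hlim (fun _ => zero_le)
      fun n => ?_
    have := eLpNorm_le_of_ae_bound (p := 2) (μ := (wvol d α).restrict K)
      (Eventually.of_forall (hunif n))
    simpa [BeppoLevi.ofLipschitz] using this
  · have hfin : volume K < ⊤ := hK.measure_lt_top
    have hlim : Tendsto (fun n => (volume K) ^ ((2 : ℝ)⁻¹) *
        ENNReal.ofReal (C * (bumpSeq d n).rOut)) atTop (𝓝 0) := by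
      have h1 := (tendsto_bumpSeq_rOut (d := d)).const_mul (C : ℝ)
      have h2 := (ENNReal.continuous_ofReal.tendsto _).comp h1
      have h3 := ENNReal.Tendsto.const_mul (a := (volume K) ^ ((2 : ℝ)⁻¹)) h2
        (Or.inr (ENNReal.rpow_ne_top_of_nonneg (by norm_num) hfin.ne))
      simpa using h3
    refine tendsto_of_tendsto_of_tendsto_of_le_of_le tendsto_const_nhds hlim (fun _ => zero_le)
      fun n => ?_
    have := eLpNorm_le_of_ae_bound (p := 2) (μ := volume.restrict K)
      (Eventually.of_forall fun x => hunif n (x, 0))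
    simpa using this

/-! ### Squared `L²` norms as lower integrals -/

theorem eLpNorm_two_sq {X E : Type*} [MeasurableSpace X] [NormedAddCommGroup E] (f : X → E)
    (μ : Measure X) : eLpNorm f 2 μ ^ 2 = ∫⁻ x, ‖f x‖ₑ ^ 2 ∂μ := by
  have := eLpNorm_nnreal_pow_eq_lintegral (f := f) (μ := μ) (p := 2) (by norm_num)
  simpa using this

theorem lintegral_mul_sq_le {X : Type*} [MeasurableSpace X] {μ : Measure X} {f g : X → ℝ≥0∞}
    (hf : AEMeasurable f μ) (hg : AEMeasurable g μ) :
    (∫⁻ x, f x * g x ∂μ) ^ 2 ≤ (∫⁻ x, f x ^ 2 ∂μ) * ∫⁻ x, g x ^ 2 ∂μ := by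
  have h := ENNReal.lintegral_mul_le_Lp_mul_Lq μ Real.HolderConjugate.two_two hf hg
  have h2 := pow_le_pow_left₀ (by simp) h 2
  rw [mul_pow, ← ENNReal.rpow_natCast, ← ENNReal.rpow_natCast (_ ^ _), ← ENNReal.rpow_natCast (_ ^ _),
    ← ENNReal.rpow_mul, ← ENNReal.rpow_mul] at h2
  simpa using h2

theorem enorm_add_sq_le {E : Type*} [NormedAddCommGroup E] (a b : E) :
    ‖a + b‖ₑ ^ 2 ≤ 2 * (‖a‖ₑ ^ 2 + ‖b‖ₑ ^ 2) := by
  have h : ‖a + b‖ ^ 2 ≤ 2 * (‖a‖ ^ 2 + ‖b‖ ^ 2) := by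
    have := norm_add_le a b
    nlinarith [norm_nonneg (a + b), norm_nonneg a, norm_nonneg b, sq_nonneg (‖a‖ - ‖b‖)]
  simp only [← ofReal_norm]
  rw [← ENNReal.ofReal_pow (norm_nonneg _), ← ENNReal.ofReal_pow (norm_nonneg _),
    ← ENNReal.ofReal_pow (norm_nonneg _), ← ENNReal.ofReal_add (by positivity) (by positivity),
    ← ENNReal.ofReal_ofNat 2, ← ENNReal.ofReal_mul (by norm_num)]
  exact ENNReal.ofReal_le_ofReal h

theorem enorm_sub_sq_le {E : Type*} [NormedAddCommGroup E] (a b : E) :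
    ‖a - b‖ₑ ^ 2 ≤ 2 * (‖a‖ₑ ^ 2 + ‖b‖ₑ ^ 2) := by
  simpa [sub_eq_add_neg] using enorm_add_sq_le a (-b)

/-! ### The weight on the line -/

theorem setLIntegral_wline {α h : ℝ} {F : ℝ → ℝ≥0∞} (hF : Measurable F) :
    ∫⁻ t in Ioo 0 h, F t ∂(wline α) = ∫⁻ t in Ioo 0 h, ENNReal.ofReal (t ^ α) * F t := by
  unfold wline
  rw [restrict_withDensity measurableSet_Ioo, Measure.restrict_restrict measurableSet_Ioo,
    lintegral_withDensity_eq_lintegral_mul _ (measurable_weight α) hF,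
    inter_eq_left.2 Ioo_subset_Ioi_self]
  rfl

theorem setLIntegral_Ioo_rpow {p h : ℝ} (hp : -1 < p) (hh : 0 < h) :
    ∫⁻ t in Ioo 0 h, ENNReal.ofReal (t ^ p) = ENNReal.ofReal (h ^ (p + 1) / (p + 1)) := by
  have hi : IntegrableOn (fun t : ℝ => t ^ p) (Ioo 0 h) := by
    have h1 : IntervalIntegrable (fun t : ℝ => t ^ p) volume 0 h :=
      intervalIntegral.intervalIntegrable_rpow' hp
    rw [intervalIntegrable_iff_integrableOn_Ioc_of_le hh.le] at h1
    exact h1.mono_set Ioo_subset_Ioc_self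
  rw [← ofReal_integral_eq_lintegral_ofReal hi]
  · rw [← integral_Ioc_eq_integral_Ioo, ← intervalIntegral.integral_of_le hh.le,
      integral_rpow (Or.inl hp), Real.zero_rpow (by linarith), sub_zero]
  · filter_upwards [ae_restrict_mem measurableSet_Ioo] with t ht
    exact Real.rpow_nonneg ht.1.le _

theorem setLIntegral_Ioo_rpow_sub {p q c h : ℝ} (hp : -1 < p) (hq : -1 < q) (hh : 0 < h)
    (hpos : ∀ t ∈ Ioo 0 h, 0 ≤ t ^ p - c * t ^ q) :
    ∫⁻ t in Ioo 0 h, ENNReal.ofReal (t ^ p - c * t ^ q) =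
      ENNReal.ofReal (h ^ (p + 1) / (p + 1) - c * (h ^ (q + 1) / (q + 1))) := by
  have h1 : ∀ r : ℝ, -1 < r → IntervalIntegrable (fun t : ℝ => t ^ r) volume 0 h :=
    fun r hr => intervalIntegral.intervalIntegrable_rpow' hr
  have h2 : IntervalIntegrable (fun t : ℝ => t ^ p - c * t ^ q) volume 0 h :=
    (h1 p hp).sub ((h1 q hq).const_mul c)
  have h3 := h2
  rw [intervalIntegrable_iff_integrableOn_Ioc_of_le hh.le] at h3
  rw [← ofReal_integral_eq_lintegral_ofReal (h3.mono_set Ioo_subset_Ioc_self)]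
  · rw [← integral_Ioc_eq_integral_Ioo, ← intervalIntegral.integral_of_le hh.le,
      intervalIntegral.integral_sub (h1 p hp) ((h1 q hq).const_mul c),
      intervalIntegral.integral_const_mul,
      integral_rpow (Or.inl hp), integral_rpow (Or.inl hq), Real.zero_rpow (by linarith),
      Real.zero_rpow (by linarith), sub_zero, sub_zero]
  · filter_upwards [ae_restrict_mem measurableSet_Ioo] with t ht using hpos t ht

/-! ### The trace inequality -/

/-- Integration by parts of `(1 - (t/h)^β) φ`, whose first factor is one at zero and vanishes at
`h`. For `β < 1` this factor is not differentiable at zero, so derivatives are taken in the open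
interval only. -/
theorem eval_zero_eq_integral {β h : ℝ} (hβ : 0 < β) (hh : 0 < h) {φ : ℝ → ℝ}
    (hφ : ContDiff ℝ 1 φ) :
    φ 0 = (∫ t in (0 : ℝ)..h, (β * h ^ (-β) * t ^ (β - 1)) * φ t) -
      ∫ t in (0 : ℝ)..h, (1 - h ^ (-β) * t ^ β) * deriv φ t := by
  have hφd := hφ.differentiable one_ne_zero
  have hφc : Continuous (deriv φ) := hφ.continuous_deriv le_rfl
  have hi1 : IntervalIntegrable (fun t : ℝ => (β * h ^ (-β) * t ^ (β - 1)) * φ t) volume 0 h :=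
    ((intervalIntegral.intervalIntegrable_rpow' (by linarith)).const_mul _).mul_continuousOn
      hφ.continuous.continuousOn
  have hQc : Continuous fun t : ℝ => 1 - h ^ (-β) * t ^ β :=
    continuous_const.sub (continuous_const.mul (Real.continuous_rpow_const hβ.le))
  have hi2 : IntervalIntegrable (fun t : ℝ => (1 - h ^ (-β) * t ^ β) * deriv φ t) volume 0 h :=
    (hQc.mul hφc).intervalIntegrable _ _
  have key : ∫ t in (0 : ℝ)..h, ((1 - h ^ (-β) * t ^ β) * deriv φ t -
      (β * h ^ (-β) * t ^ (β - 1)) * φ t) =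
      (1 - h ^ (-β) * h ^ β) * φ h - (1 - h ^ (-β) * 0 ^ β) * φ 0 := by
    refine intervalIntegral.integral_eq_sub_of_hasDerivAt_of_le (f := fun t => (1 - h ^ (-β) * t ^ β) * φ t) hh.le
      (hQc.mul hφ.continuous).continuousOn (fun t ht => ?_) (hi2.sub hi1)
    have hd : HasDerivAt (fun t : ℝ => t ^ β) (β * t ^ (β - 1)) t :=
      Real.hasDerivAt_rpow_const (Or.inl ht.1.ne')
    have := (((hd.const_mul (h ^ (-β))).const_sub 1).mul (hφd t).hasDerivAt)
    exact this.congr_deriv (by ring)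
  have hz : h ^ (-β) * h ^ β = 1 := by
    rw [← Real.rpow_add hh]; simp
  rw [intervalIntegral.integral_sub hi2 hi1, hz, Real.zero_rpow hβ.ne'] at key
  linarith

theorem enorm_intervalIntegral_le {h : ℝ} (hh : 0 < h) (F : ℝ → ℝ) :
    ‖∫ t in (0 : ℝ)..h, F t‖ₑ ≤ ∫⁻ t in Ioo 0 h, ‖F t‖ₑ := by
  rw [intervalIntegral.integral_of_le hh.le, integral_Ioc_eq_integral_Ioo]
  exact enorm_integral_le_lintegral_enorm _

/-- Cauchy-Schwarz with the weight distributed as `1 = t ^ (-α/2) * t ^ (α/2)`. -/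
theorem enorm_intervalIntegral_sq_le {α h : ℝ} (hh : 0 < h) {q ψ : ℝ → ℝ} (hq : Measurable q)
    (hψ : Measurable ψ) :
    ‖∫ t in (0 : ℝ)..h, q t * ψ t‖ₑ ^ 2 ≤
      (∫⁻ t in Ioo 0 h, ENNReal.ofReal (t ^ (-α) * q t ^ 2)) *
        ∫⁻ t in Ioo 0 h, ‖ψ t‖ₑ ^ 2 ∂(wline α) := by
  have h1 : ∫⁻ t in Ioo 0 h, ‖q t * ψ t‖ₑ = ∫⁻ t in Ioo 0 h,
      ENNReal.ofReal (t ^ (-α / 2) * |q t|) * (ENNReal.ofReal (t ^ (α / 2)) * ‖ψ t‖ₑ) := by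
    refine setLIntegral_congr_fun measurableSet_Ioo fun t ht => ?_
    have hp : t ^ (-α / 2) * t ^ (α / 2) = 1 := by
      rw [← Real.rpow_add ht.1]; ring_nf; simp
    rw [← ofReal_norm, ← ofReal_norm, ← ENNReal.ofReal_mul (Real.rpow_nonneg ht.1.le _),
      ← ENNReal.ofReal_mul (mul_nonneg (Real.rpow_nonneg ht.1.le _) (abs_nonneg _)), norm_mul]
    congr 1
    rw [Real.norm_eq_abs]
    linear_combination (-(|q t| * ‖ψ t‖)) * hp
  calc ‖∫ t in (0 : ℝ)..h, q t * ψ t‖ₑ ^ 2 ≤ (∫⁻ t in Ioo 0 h, ‖q t * ψ t‖ₑ) ^ 2 :=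
        pow_le_pow_left₀ (by simp) (enorm_intervalIntegral_le hh _) 2
    _ ≤ _ := by
        rw [h1]
        refine (lintegral_mul_sq_le (by fun_prop) (by fun_prop)).trans (le_of_eq ?_)
        congr 1
        · refine setLIntegral_congr_fun measurableSet_Ioo fun t ht => ?_
          have hp : t ^ (-α / 2) * t ^ (-α / 2) = t ^ (-α) := by
            rw [← Real.rpow_add ht.1]; ring_nf
          rw [← ENNReal.ofReal_pow (mul_nonneg (Real.rpow_nonneg ht.1.le _) (abs_nonneg _)),
            mul_pow, sq_abs, sq, hp]
        · rw [setLIntegral_wline (by fun_prop)]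
          refine setLIntegral_congr_fun measurableSet_Ioo fun t ht => ?_
          have hp : t ^ (α / 2) * t ^ (α / 2) = t ^ α := by
            rw [← Real.rpow_add ht.1]; ring_nf
          rw [mul_pow, ← ENNReal.ofReal_pow (Real.rpow_nonneg ht.1.le _), sq, hp]

/-- The representation of `φ 0` is used with `β = 1 + α`, so that the first kernel is a multiple of
the weight itself. Both squared kernels can then be integrated or estimated explicitly, and the
factor on the left makes the constants on the right independent of `α`. -/
theorem trace_inequality_line {α h : ℝ} (hα : α ∈ Ioo (-1 : ℝ) 1) (hh : 0 < h) {φ : ℝ → ℝ}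
    (hφ : ContDiff ℝ 1 φ) :
    ENNReal.ofReal ((1 - α) / (1 + α) * h ^ (1 + α)) * ‖φ 0‖ₑ ^ 2 ≤
      4 * (∫⁻ t in Ioo 0 h, ‖φ t‖ₑ ^ 2 ∂(wline α)) +
        ENNReal.ofReal (h ^ 2) * ∫⁻ t in Ioo 0 h, ‖deriv φ t‖ₑ ^ 2 ∂(wline α) := by
  obtain ⟨hα1, hα2⟩ := hα
  set β := 1 + α with hβ
  have hβ0 : 0 < β := by linarith
  have h1α : 0 < 1 - α := by linarith
  set k := (1 - α) / β * h ^ β with hk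
  have hk0 : 0 ≤ k := by positivity
  have e0 := eval_zero_eq_integral hβ0 hh hφ
  set I1 := ∫ t in (0 : ℝ)..h, (β * h ^ (-β) * t ^ (β - 1)) * φ t
  set I2 := ∫ t in (0 : ℝ)..h, (1 - h ^ (-β) * t ^ β) * deriv φ t
  have b1 : ‖I1‖ₑ ^ 2 ≤ ENNReal.ofReal (β * h ^ (-β)) *
      ∫⁻ t in Ioo 0 h, ‖φ t‖ₑ ^ 2 ∂(wline α) := by
    refine (enorm_intervalIntegral_sq_le (α := α) hh (by fun_prop)
      hφ.continuous.measurable).trans (le_of_eq ?_)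
    congr 1
    have : ∫⁻ t in Ioo 0 h, ENNReal.ofReal (t ^ (-α) * (β * h ^ (-β) * t ^ (β - 1)) ^ 2) =
        ∫⁻ t in Ioo 0 h, ENNReal.ofReal ((β * h ^ (-β)) ^ 2) * ENNReal.ofReal (t ^ α) := by
      refine setLIntegral_congr_fun measurableSet_Ioo fun t ht => ?_
      rw [← ENNReal.ofReal_mul (by positivity)]
      congr 1
      have hp : t ^ (-α) * (t ^ (β - 1) * t ^ (β - 1)) = t ^ α := by
        rw [← Real.rpow_add ht.1, ← Real.rpow_add ht.1]; congr 1; rw [hβ]; ring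
      rw [← hp]; ring
    rw [this, lintegral_const_mul _ (by fun_prop), setLIntegral_Ioo_rpow hα1 hh,
      ← ENNReal.ofReal_mul (by positivity)]
    congr 1
    have hz : h ^ (-β) * h ^ β = 1 := by
      rw [← Real.rpow_add hh]; simp
    rw [show α + 1 = β by rw [hβ]; ring]
    field_simp
    linear_combination hz
  have b2 : ‖I2‖ₑ ^ 2 ≤ ENNReal.ofReal (h ^ (1 - α) * β / (2 * (1 - α))) *
      ∫⁻ t in Ioo 0 h, ‖deriv φ t‖ₑ ^ 2 ∂(wline α) := by
    refine (enorm_intervalIntegral_sq_le (α := α) hh (by fun_prop)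
      (hφ.continuous_deriv le_rfl).measurable).trans ?_
    gcongr
    have hQ : ∀ t ∈ Ioo 0 h, 0 ≤ 1 - h ^ (-β) * t ^ β ∧ 1 - h ^ (-β) * t ^ β ≤ 1 := by
      intro t ht
      have hz : h ^ (-β) * h ^ β = 1 := by
        rw [← Real.rpow_add hh]; simp
      have h2 : t ^ β ≤ h ^ β := Real.rpow_le_rpow ht.1.le ht.2.le hβ0.le
      have h3 : 0 ≤ h ^ (-β) := by positivity
      have h4 : 0 ≤ t ^ β := Real.rpow_nonneg ht.1.le _
      constructor <;> nlinarith
    have hq : ∀ t ∈ Ioo 0 h, t ^ (-α) * (1 - h ^ (-β) * t ^ β) = t ^ (-α) - h ^ (-β) * t ^ (1 : ℝ) := by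
      intro t ht
      have hp : t ^ (-α) * t ^ β = t ^ (1 : ℝ) := by
        rw [← Real.rpow_add ht.1]; congr 1; rw [hβ]; ring
      rw [← hp]; ring
    -- The kernel lies in `[0, 1]`, so its square may be replaced by the kernel. The difference of
    -- two powers then integrates to `h ^ (1 - α) * (1 + α) / (2 * (1 - α))`, which `2 * k` turns
    -- into exactly `h ^ 2`.
    calc ∫⁻ t in Ioo 0 h, ENNReal.ofReal (t ^ (-α) * (1 - h ^ (-β) * t ^ β) ^ 2)
        ≤ ∫⁻ t in Ioo 0 h, ENNReal.ofReal (t ^ (-α) - h ^ (-β) * t ^ (1 : ℝ)) := by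
          refine setLIntegral_mono' measurableSet_Ioo fun t ht => ?_
          refine ENNReal.ofReal_le_ofReal ?_
          rw [← hq t ht]
          have := hQ t ht
          refine mul_le_mul_of_nonneg_left ?_ (Real.rpow_nonneg ht.1.le _)
          nlinarith
      _ = _ := by
          rw [setLIntegral_Ioo_rpow_sub (by linarith) (by norm_num) hh]
          · congr 1
            have hz : h ^ (-β) * h ^ ((1 : ℝ) + 1) = h ^ (1 - α) := by
              rw [← Real.rpow_add hh]; congr 1; rw [hβ]; ring
            rw [show -α + 1 = 1 - α by ring, ← mul_div_assoc, hz, hβ]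
            field_simp
            ring
          · intro t ht
            rw [← hq t ht]
            exact mul_nonneg (Real.rpow_nonneg ht.1.le _) (hQ t ht).1
  calc ENNReal.ofReal k * ‖φ 0‖ₑ ^ 2 ≤ ENNReal.ofReal k * (2 * (‖I1‖ₑ ^ 2 + ‖I2‖ₑ ^ 2)) := by
        rw [e0]; gcongr; exact enorm_sub_sq_le _ _
    _ ≤ ENNReal.ofReal k * (2 * (ENNReal.ofReal (β * h ^ (-β)) *
          (∫⁻ t in Ioo 0 h, ‖φ t‖ₑ ^ 2 ∂(wline α)) +
          ENNReal.ofReal (h ^ (1 - α) * β / (2 * (1 - α))) *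
            ∫⁻ t in Ioo 0 h, ‖deriv φ t‖ₑ ^ 2 ∂(wline α))) := by gcongr
    _ = (ENNReal.ofReal k * (2 * ENNReal.ofReal (β * h ^ (-β)))) *
          (∫⁻ t in Ioo 0 h, ‖φ t‖ₑ ^ 2 ∂(wline α)) +
        (ENNReal.ofReal k * (2 * ENNReal.ofReal (h ^ (1 - α) * β / (2 * (1 - α))))) *
          ∫⁻ t in Ioo 0 h, ‖deriv φ t‖ₑ ^ 2 ∂(wline α) := by
        have e : ∀ k a b c e : ℝ≥0∞, k * (2 * (a * b + c * e)) =
          (k * (2 * a)) * b + (k * (2 * c)) * e := by intros; ring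
        exact e _ _ _ _ _
    _ ≤ _ := by
        have hz : h ^ (-β) * h ^ β = 1 := by
          rw [← Real.rpow_add hh]; simp
        have hz2 : h ^ β * h ^ (1 - α) = h ^ 2 := by
          rw [← Real.rpow_add hh, hβ, ← Real.rpow_natCast]; congr 1; push_cast; ring
        gcongr
        · rw [← ENNReal.ofReal_ofNat 2, ← ENNReal.ofReal_mul (by norm_num),
            ← ENNReal.ofReal_mul hk0, ← ENNReal.ofReal_ofNat 4]
          refine ENNReal.ofReal_le_ofReal ?_
          have : k * (2 * (β * h ^ (-β))) = 2 * (1 - α) := by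
            rw [hk]; field_simp; linear_combination hz
          rw [this]; linarith
        · rw [← ENNReal.ofReal_ofNat 2, ← ENNReal.ofReal_mul (by norm_num),
            ← ENNReal.ofReal_mul hk0]
          refine ENNReal.ofReal_le_ofReal ?_
          rw [hk, ← hz2]
          apply le_of_eq
          field_simp

theorem norm_deriv_le_norm_classicalGrad (φ : Rd1 d → ℝ) (x : Rd d)
    (t : ℝ) : ‖deriv (fun t => φ (x, t)) t‖ ≤ ‖classicalGrad φ (x, t)‖ := by
  have h : ‖classicalGrad φ (x, t)‖ ^ 2 = ‖gradient (fun y : Rd d => φ (y, t)) x‖ ^ 2 +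
      ‖deriv (fun t => φ (x, t)) t‖ ^ 2 := by
    rw [classicalGrad, WithLp.prod_norm_sq_eq_of_L2]
    rfl
  refine le_of_sq_le_sq ?_ (norm_nonneg _)
  rw [h]; nlinarith [sq_nonneg ‖gradient (fun y : Rd d => φ (y, t)) x‖]

theorem wvol_restrict_prod (α : ℝ) (S : Set (Rd d)) (I : Set ℝ) :
    (wvol d α).restrict (S ×ˢ I) = (volume.restrict S).prod ((wline α).restrict I) := by
  rw [wvol_eq_prod, Measure.prod_restrict]

theorem trace_inequality_smooth {α h : ℝ} (hα : α ∈ Ioo (-1 : ℝ) 1) (hh : 0 < h) {φ : Rd1 d → ℝ}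
    (hφ : ContDiff ℝ 1 φ) (S : Set (Rd d)) :
    ENNReal.ofReal ((1 - α) / (1 + α) * h ^ (1 + α)) * (∫⁻ x in S, ‖φ (x, 0)‖ₑ ^ 2) ≤
      4 * (∫⁻ z in S ×ˢ Ioo 0 h, ‖φ z‖ₑ ^ 2 ∂(wvol d α)) +
        ENNReal.ofReal (h ^ 2) * ∫⁻ z in S ×ˢ Ioo 0 h, ‖classicalGrad φ z‖ₑ ^ 2 ∂(wvol d α) := by
  have hc : Continuous (classicalGrad φ) := continuous_classicalGrad hφ
  have hφc := hφ.continuous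
  rw [wvol_restrict_prod, lintegral_prod _ (by fun_prop), lintegral_prod _ (by fun_prop),
    ← lintegral_const_mul' _ _ ENNReal.ofReal_ne_top, ← lintegral_const_mul' _ _ (by norm_num),
    ← lintegral_const_mul' _ _ ENNReal.ofReal_ne_top, ← lintegral_add_left]
  · refine lintegral_mono fun x => ?_
    have h1 : ContDiff ℝ 1 (fun t : ℝ => φ (x, t)) := hφ.comp (by fun_prop)
    refine (trace_inequality_line hα hh h1).trans ?_
    gcongr with t
    exact enorm_le_iff_norm_le.2 (norm_deriv_le_norm_classicalGrad φ x t)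
  · have : Measurable fun z : Rd1 d => ‖φ z‖ₑ ^ 2 := by fun_prop
    exact (this.lintegral_prod_right').const_mul _

/-! ### Tangential translations and differences of traces -/

theorem measurePreserving_add_wvol (α : ℝ) (v : Rd d) :
    MeasurePreserving (fun z : Rd1 d => z + (v, 0)) (wvol d α) (wvol d α) := by
  rw [wvol_eq_prod]
  have := (measurePreserving_add_right (volume : Measure (Rd d)) v).prod
    (MeasurePreserving.id (wline α))
  convert this using 1
  ext z <;> simp

theorem setLIntegral_comp_add_le {α : ℝ} {v : Rd d} {S S' : Set (Rd d)} {I : Set ℝ}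
    (hS : MeasurableSet S) (hI : MeasurableSet I) (h : ∀ x ∈ S', x + v ∈ S) {F : Rd1 d → ℝ≥0∞}
    (hF : Measurable F) :
    ∫⁻ z in S' ×ˢ I, F (z + (v, 0)) ∂(wvol d α) ≤ ∫⁻ z in S ×ˢ I, F z ∂(wvol d α) := by
  have h2 := (measurePreserving_add_wvol (d := d) α v).setLIntegral_comp_preimage (hS.prod hI) hF
  rw [← h2]
  refine lintegral_mono_set fun z hz => ?_
  simp only [mem_preimage, mem_prod, Prod.fst_add, Prod.snd_add, add_zero]
  exact ⟨h _ hz.1, hz.2⟩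

/-- The fundamental theorem of calculus on the segment from `z` to `z + (y, 0)`, then Cauchy-Schwarz
in its parameter. -/
theorem enorm_sub_sq_le_lintegral {φ : Rd1 d → ℝ} (hφ : ContDiff ℝ 1 φ) (y : Rd d) (z : Rd1 d) :
    ‖φ (z + (y, 0)) - φ z‖ₑ ^ 2 ≤ ENNReal.ofReal (‖y‖ ^ 2) *
      ∫⁻ θ in Ioo (0 : ℝ) 1, ‖classicalGrad φ (z + (θ • y, 0))‖ₑ ^ 2 := by
  have hφd := hφ.differentiable one_ne_zero
  have hgc := continuous_classicalGrad hφ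
  have hd : ∀ θ : ℝ, HasDerivAt (fun θ : ℝ => φ (z + (θ • y, 0)))
      (fderiv ℝ φ (z + (θ • y, 0)) (y, 0)) θ := by
    intro θ
    have h1 : HasDerivAt (fun θ : ℝ => z + (θ • y, (0 : ℝ))) (y, 0) θ := by
      have h2 : HasDerivAt (fun θ : ℝ => θ • y) ((1 : ℝ) • y) θ := (hasDerivAt_id θ).smul_const y
      rw [one_smul] at h2
      exact (h2.prodMk (hasDerivAt_const θ (0 : ℝ))).const_add z
    exact (hφd _).hasFDerivAt.comp_hasDerivAt θ h1
  have hcd : Continuous fun θ : ℝ => fderiv ℝ φ (z + (θ • y, 0)) (y, 0) := by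
    have := hφ.continuous_fderiv one_ne_zero
    exact (this.comp (by fun_prop)).clm_apply continuous_const
  have e : φ (z + (y, 0)) - φ z = ∫ θ in (0 : ℝ)..1, fderiv ℝ φ (z + (θ • y, 0)) (y, 0) := by
    rw [intervalIntegral.integral_eq_sub_of_hasDerivAt (fun θ _ => hd θ)
      (hcd.intervalIntegrable _ _), one_smul, zero_smul, Prod.mk_zero_zero, add_zero]
  have hb : ∀ θ : ℝ, ‖fderiv ℝ φ (z + (θ • y, 0)) (y, 0)‖ₑ ≤
      ‖y‖ₑ * ‖classicalGrad φ (z + (θ • y, 0))‖ₑ := by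
    intro θ
    rw [← inner_classicalGrad (hφd _), mul_comm, ← ofReal_norm, ← ofReal_norm, ← ofReal_norm,
      ← ENNReal.ofReal_mul (norm_nonneg _)]
    refine ENNReal.ofReal_le_ofReal ((norm_inner_le_norm _ _).trans (le_of_eq ?_))
    congr 1
    rw [WithLp.prod_norm_eq_of_L2]
    simp
  calc ‖φ (z + (y, 0)) - φ z‖ₑ ^ 2
      ≤ (∫⁻ θ in Ioo (0 : ℝ) 1, ‖y‖ₑ * ‖classicalGrad φ (z + (θ • y, 0))‖ₑ) ^ 2 := by
        refine pow_le_pow_left₀ (by simp) ?_ 2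
        rw [e]
        exact (enorm_intervalIntegral_le one_pos _).trans (lintegral_mono fun θ => hb θ)
    _ ≤ (∫⁻ _ in Ioo (0 : ℝ) 1, ‖y‖ₑ ^ 2) *
        ∫⁻ θ in Ioo (0 : ℝ) 1, ‖classicalGrad φ (z + (θ • y, 0))‖ₑ ^ 2 :=
        lintegral_mul_sq_le (by fun_prop) (by fun_prop)
    _ = _ := by
        congr 1
        rw [setLIntegral_const, Real.volume_Ioo, ← ofReal_norm, ENNReal.ofReal_pow (norm_nonneg _)]
        simp

theorem lintegral_difference_le {α : ℝ} {φ : Rd1 d → ℝ} (hφ : ContDiff ℝ 1 φ) {S S' : Set (Rd d)}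
    {I : Set ℝ} (hS : MeasurableSet S) (hI : MeasurableSet I) {y : Rd d}
    (h : ∀ x ∈ S', ∀ θ ∈ Icc (0 : ℝ) 1, x + θ • y ∈ S) :
    ∫⁻ z in S' ×ˢ I, ‖φ (z + (y, 0)) - φ z‖ₑ ^ 2 ∂(wvol d α) ≤
      ENNReal.ofReal (‖y‖ ^ 2) * ∫⁻ z in S ×ˢ I, ‖classicalGrad φ z‖ₑ ^ 2 ∂(wvol d α) := by
  have hgc := continuous_classicalGrad hφ
  calc ∫⁻ z in S' ×ˢ I, ‖φ (z + (y, 0)) - φ z‖ₑ ^ 2 ∂(wvol d α)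
      ≤ ∫⁻ z in S' ×ˢ I, (ENNReal.ofReal (‖y‖ ^ 2) *
          ∫⁻ θ in Ioo (0 : ℝ) 1, ‖classicalGrad φ (z + (θ • y, 0))‖ₑ ^ 2) ∂(wvol d α) :=
        lintegral_mono fun z => enorm_sub_sq_le_lintegral hφ y z
    _ = ENNReal.ofReal (‖y‖ ^ 2) * ∫⁻ θ in Ioo (0 : ℝ) 1, ∫⁻ z in S' ×ˢ I,
          ‖classicalGrad φ (z + (θ • y, 0))‖ₑ ^ 2 ∂(wvol d α) := by
        rw [lintegral_const_mul' _ _ ENNReal.ofReal_ne_top, lintegral_lintegral_swap]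
        have hcc : Continuous fun p : Rd1 d × ℝ => classicalGrad φ (p.1 + (p.2 • y, 0)) :=
          hgc.comp (by fun_prop)
        exact (hcc.enorm.measurable.pow_const 2).aemeasurable
    _ ≤ ENNReal.ofReal (‖y‖ ^ 2) * ∫⁻ θ in Ioo (0 : ℝ) 1,
          ∫⁻ z in S ×ˢ I, ‖classicalGrad φ z‖ₑ ^ 2 ∂(wvol d α) := by
        refine mul_le_mul_right (setLIntegral_mono' measurableSet_Ioo fun θ hθ => ?_) _
        exact setLIntegral_comp_add_le hS hI (fun x hx => h x hx θ ⟨hθ.1.le, hθ.2.le⟩)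
          (F := fun z => ‖classicalGrad φ z‖ₑ ^ 2) (by fun_prop)
    _ = _ := by simp

/-- The trace inequality is applied to `φ(· + y) - φ`. Its zero order term is itself controlled by
`‖y‖` times the gradient, so no norm of `φ` remains; this allows slopes of an affine trace to be
estimated by the energy alone. -/
theorem trace_difference_smooth {α h : ℝ} (hα : α ∈ Ioo (-1 : ℝ) 1) (hh : 0 < h) {φ : Rd1 d → ℝ}
    (hφ : ContDiff ℝ 1 φ) {S S' : Set (Rd d)} (hS : MeasurableSet S) {y : Rd d}
    (hy : ∀ x ∈ S', ∀ θ ∈ Icc (0 : ℝ) 1, x + θ • y ∈ S) :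
    ENNReal.ofReal ((1 - α) / (1 + α) * h ^ (1 + α)) *
        (∫⁻ x in S', ‖φ (x + y, 0) - φ (x, 0)‖ₑ ^ 2) ≤
      ENNReal.ofReal (4 * ‖y‖ ^ 2 + 4 * h ^ 2) *
        ∫⁻ z in S ×ˢ Ioo 0 h, ‖classicalGrad φ z‖ₑ ^ 2 ∂(wvol d α) := by
  have hφd := hφ.differentiable one_ne_zero
  have hsh : ContDiff ℝ 1 fun z : Rd1 d => φ (z + (y, 0)) :=
    hφ.comp (contDiff_id.add contDiff_const)
  have h1 := trace_inequality_smooth hα hh (hsh.sub hφ) S'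
  simp only [Prod.mk_add_mk, add_zero] at h1
  have hgc := continuous_classicalGrad hφ
  have hg : ∀ z, classicalGrad (fun z => φ (z + (y, 0)) - φ z) z =
      classicalGrad φ (z + (y, 0)) - classicalGrad φ z := by
    intro z
    rw [classicalGrad_sub (hsh.differentiable one_ne_zero z) (hφd z)]
    congr 1
    rw [classicalGrad_eq_gradOf (hsh.differentiable one_ne_zero z), classicalGrad_eq_gradOf (hφd _),
      fderiv_comp_add_right]
  set A := ∫⁻ z in S ×ˢ Ioo 0 h, ‖classicalGrad φ z‖ₑ ^ 2 ∂(wvol d α)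
  have hA : ∫⁻ z in S' ×ˢ Ioo 0 h, ‖classicalGrad (fun z => φ (z + (y, 0)) - φ z) z‖ₑ ^ 2
      ∂(wvol d α) ≤ 4 * A := by
    calc _ ≤ ∫⁻ z in S' ×ˢ Ioo 0 h, 2 * (‖classicalGrad φ (z + (y, 0))‖ₑ ^ 2 +
          ‖classicalGrad φ z‖ₑ ^ 2) ∂(wvol d α) :=
          lintegral_mono fun z => by rw [hg]; exact enorm_sub_sq_le _ _
      _ = 2 * ((∫⁻ z in S' ×ˢ Ioo 0 h, ‖classicalGrad φ (z + (y, 0))‖ₑ ^ 2 ∂(wvol d α)) +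
          ∫⁻ z in S' ×ˢ Ioo 0 h, ‖classicalGrad φ z‖ₑ ^ 2 ∂(wvol d α)) := by
          rw [lintegral_const_mul' _ _ (by norm_num), lintegral_add_left]
          have hcc : Continuous fun z : Rd1 d => classicalGrad φ (z + (y, 0)) :=
            hgc.comp (by fun_prop)
          exact hcc.enorm.measurable.pow_const 2
      _ ≤ 2 * (A + A) := by
          gcongr
          · exact setLIntegral_comp_add_le hS measurableSet_Ioo
              (fun x hx => by simpa using hy x hx 1 (by simp))
              (F := fun z => ‖classicalGrad φ z‖ₑ ^ 2) (by fun_prop)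
          · refine lintegral_mono_set (prod_mono (fun x hx => ?_) subset_rfl)
            simpa using hy x hx 0 (by simp)
      _ = 4 * A := by ring
  have hD := lintegral_difference_le (α := α) hφ hS (measurableSet_Ioo (a := (0 : ℝ)) (b := h)) hy
  refine h1.trans ?_
  calc _ ≤ 4 * (ENNReal.ofReal (‖y‖ ^ 2) * A) + ENNReal.ofReal (h ^ 2) * (4 * A) := by gcongr
    _ = _ := by
      rw [ENNReal.ofReal_add (by positivity) (by positivity), ENNReal.ofReal_mul (by norm_num),
        ENNReal.ofReal_mul (p := 4) (q := h ^ 2) (by norm_num), ENNReal.ofReal_ofNat]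
      ring

/-! ### Passage from smooth functions to Beppo-Levi functions with a trace -/

theorem tendsto_eLpNorm_of_sub {X E : Type*} [MeasurableSpace X] [NormedAddCommGroup E]
    {μ : Measure X} {f : ℕ → X → E} {g : X → E} (hf : ∀ n, AEStronglyMeasurable (f n) μ)
    (hg : MemLp g 2 μ) (h : Tendsto (fun n => eLpNorm (fun x => f n x - g x) 2 μ) atTop (𝓝 0)) :
    Tendsto (fun n => eLpNorm (f n) 2 μ) atTop (𝓝 (eLpNorm g 2 μ)) := by
  have h1 : Tendsto (fun n => eLpNorm g 2 μ - eLpNorm (fun x => f n x - g x) 2 μ) atTop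
      (𝓝 (eLpNorm g 2 μ)) := by
    have := ENNReal.Tendsto.sub (tendsto_const_nhds (x := eLpNorm g 2 μ)) h (Or.inl hg.eLpNorm_ne_top)
    simpa using this
  have h2 : Tendsto (fun n => eLpNorm g 2 μ + eLpNorm (fun x => f n x - g x) 2 μ) atTop
      (𝓝 (eLpNorm g 2 μ)) := by
    simpa using tendsto_const_nhds.add h
  refine tendsto_of_tendsto_of_tendsto_of_le_of_le h1 h2 (fun n => ?_) fun n => ?_
  · refine tsub_le_iff_right.2 ?_
    have := eLpNorm_sub_le (hf n) ((hf n).sub hg.1) (p := 2) (by norm_num)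
    rwa [sub_sub_cancel] at this
  · have := eLpNorm_add_le hg.1 ((hf n).sub hg.1) (p := 2) (by norm_num)
    rwa [add_sub_cancel] at this

theorem tendsto_lintegral_sq_of_sub {X E : Type*} [MeasurableSpace X] [NormedAddCommGroup E]
    {μ : Measure X} {f : ℕ → X → E} {g : X → E} (hf : ∀ n, AEStronglyMeasurable (f n) μ)
    (hg : MemLp g 2 μ) (h : Tendsto (fun n => eLpNorm (fun x => f n x - g x) 2 μ) atTop (𝓝 0)) :
    Tendsto (fun n => ∫⁻ x, ‖f n x‖ₑ ^ 2 ∂μ) atTop (𝓝 (∫⁻ x, ‖g x‖ₑ ^ 2 ∂μ)) := by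
  simp only [← eLpNorm_two_sq]
  exact ((ENNReal.continuous_pow 2).tendsto _).comp (tendsto_eLpNorm_of_sub hf hg h)

theorem memLp_of_continuous {X : Type*} [PseudoMetricSpace X] [ProperSpace X] [MeasurableSpace X]
    [OpensMeasurableSpace X] {μ : Measure X} {g : X → ℝ} (hg : Continuous g)
    {K : Set X} (hK : Bornology.IsBounded K) (hμ : μ K < ⊤) :
    MemLp g 2 (μ.restrict K) := by
  obtain ⟨C, hC⟩ := hK.isCompact_closure.exists_bound_of_continuousOn hg.continuousOn
  have : IsFiniteMeasure (μ.restrict K) := ⟨by simpa using hμ⟩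
  have hm : AEStronglyMeasurable g (μ.restrict K) :=
    hg.measurable.aestronglyMeasurable
  refine MemLp.of_bound hm C ?_
  refine (ae_restrict_iff (measurableSet_le (by fun_prop) (by fun_prop))).2
    (Eventually.of_forall fun x hx => hC x (subset_closure hx))

theorem HasTrace.tendsto_grad {α : ℝ} {w : BeppoLevi d α} {φ : ℕ → Rd1 d → ℝ}
    (hL : ∀ n, MemLp (classicalGrad (φ n)) 2 (wvol d α))
    (h : Tendsto (fun n => eLpNorm (fun z => classicalGrad (φ n) z - w.grad z) 2 (wvol d α))
      atTop (𝓝 0)) (K : Set (Rd1 d)) :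
    Tendsto (fun n => ∫⁻ z in K, ‖classicalGrad (φ n) z‖ₑ ^ 2 ∂(wvol d α)) atTop
      (𝓝 (∫⁻ z in K, ‖w.grad z‖ₑ ^ 2 ∂(wvol d α))) := by
  refine tendsto_lintegral_sq_of_sub (fun n => (hL n).1.restrict) (w.memLp_grad.restrict _) ?_
  exact tendsto_of_tendsto_of_tendsto_of_le_of_le tendsto_const_nhds h (fun _ => zero_le)
    fun n => eLpNorm_mono_measure _ Measure.restrict_le_self

theorem HasTrace.trace_inequality {α h : ℝ} (hα : α ∈ Ioo (-1 : ℝ) 1) (hh : 0 < h)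
    {w : BeppoLevi d α} {g : Rd d → ℝ} (hg : Continuous g) (ht : HasTrace w g) {S : Set (Rd d)}
    (hS : Bornology.IsBounded S) :
    ENNReal.ofReal ((1 - α) / (1 + α) * h ^ (1 + α)) * (∫⁻ x in S, ‖g x‖ₑ ^ 2) ≤
      4 * (∫⁻ z in S ×ˢ Ioo 0 h, ‖w.toFun z‖ₑ ^ 2 ∂(wvol d α)) +
        ENNReal.ofReal (h ^ 2) * ∫⁻ z in S ×ˢ Ioo 0 h, ‖w.grad z‖ₑ ^ 2 ∂(wvol d α) := by
  have hb : Bornology.IsBounded (S ×ˢ Ioo 0 h) := hS.prod (Metric.isBounded_Ioo 0 h)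
  have hwL := ht.memLp_restrict hα.1 hb
  have hc0 : Continuous fun x : Rd d => (x, (0 : ℝ)) := by fun_prop
  obtain ⟨mg, φ, hφ, hφL, hφG, hφK, hφT⟩ := ht
  have t1 := tendsto_lintegral_sq_of_sub (f := fun n x => φ n (x, 0))
    (fun n => ((hφ n).continuous.comp hc0).aestronglyMeasurable)
    (memLp_of_continuous hg hS hS.measure_lt_top) (hφT S hS)
  have t2 := tendsto_lintegral_sq_of_sub
    (fun n => (hφ n).continuous.aestronglyMeasurable) hwL (hφK _ hb)
  have t3 := HasTrace.tendsto_grad hφL hφG (S ×ˢ Ioo 0 h)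
  refine le_of_tendsto_of_tendsto' (ENNReal.Tendsto.const_mul t1 (Or.inr ENNReal.ofReal_ne_top))
    ((ENNReal.Tendsto.const_mul t2 (Or.inr (by norm_num))).add
      (ENNReal.Tendsto.const_mul t3 (Or.inr ENNReal.ofReal_ne_top))) fun n => ?_
  exact trace_inequality_smooth hα hh ((hφ n).of_le (by simp)) S

theorem HasTrace.trace_difference {α h : ℝ} (hα : α ∈ Ioo (-1 : ℝ) 1) (hh : 0 < h)
    {w : BeppoLevi d α} {g : Rd d → ℝ} (hg : Continuous g) (ht : HasTrace w g) {S S' : Set (Rd d)}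
    (hS : Bornology.IsBounded S) (hSm : MeasurableSet S) {y : Rd d}
    (hy : ∀ x ∈ S', ∀ θ ∈ Icc (0 : ℝ) 1, x + θ • y ∈ S) :
    ENNReal.ofReal ((1 - α) / (1 + α) * h ^ (1 + α)) * (∫⁻ x in S', ‖g (x + y) - g x‖ₑ ^ 2) ≤
      ENNReal.ofReal (4 * ‖y‖ ^ 2 + 4 * h ^ 2) *
        ∫⁻ z in S ×ˢ Ioo 0 h, ‖w.grad z‖ₑ ^ 2 ∂(wvol d α) := by
  have hc0 : Continuous fun x : Rd d => (x, (0 : ℝ)) := by fun_prop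
  have hS' : Bornology.IsBounded S' := hS.subset fun x hx => by simpa using hy x hx 0 (by simp)
  obtain ⟨mg, φ, hφ, hφL, hφG, hφK, hφT⟩ := ht
  have t3 := HasTrace.tendsto_grad hφL hφG (S ×ˢ Ioo 0 h)
  have hct : Continuous fun x : Rd d => x + y := by fun_prop
  -- Convergence of the shifted traces on `S'` is convergence of the traces on the translate of `S'`
  -- by `y`, which is contained in `S`.
  have c1 : Tendsto (fun n => eLpNorm (fun x => φ n (x + y, 0) - g (x + y)) 2 (volume.restrict S'))
      atTop (𝓝 0) := by
    refine tendsto_of_tendsto_of_tendsto_of_le_of_le tendsto_const_nhds (hφT S hS)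
      (fun _ => zero_le) fun n => ?_
    have hmp := (measurePreserving_add_right (volume : Measure (Rd d)) y).restrict_preimage hSm
    have hm : AEStronglyMeasurable (fun x => φ n (x, 0) - g x) (volume.restrict S) :=
      (((hφ n).continuous.comp hc0).sub hg).aestronglyMeasurable
    have := eLpNorm_comp_measurePreserving (p := 2) hm hmp
    simp only
    rw [← this]
    refine eLpNorm_mono_measure _ (Measure.restrict_mono_set _ fun x hx => ?_)
    simpa using hy x hx 1 (by simp)
  have c2 : Tendsto (fun n => eLpNorm (fun x => φ n (x, 0) - g x) 2 (volume.restrict S'))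
      atTop (𝓝 0) := hφT S' hS'
  have c3 := tendsto_eLpNorm_sub
    (fun n => ((((hφ n).continuous.comp hc0).comp hct).sub (hg.comp hct)).aestronglyMeasurable)
    (fun n => (((hφ n).continuous.comp hc0).sub hg).aestronglyMeasurable) c1 c2
  have t1 := tendsto_lintegral_sq_of_sub (f := fun n x => φ n (x + y, 0) - φ n (x, 0))
    (g := fun x => g (x + y) - g x) (μ := volume.restrict S')
    (fun n => ((((hφ n).continuous.comp hc0).comp hct).sub
      ((hφ n).continuous.comp hc0)).aestronglyMeasurable)
    (memLp_of_continuous ((hg.comp hct).sub hg) hS' hS'.measure_lt_top)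
    (c3.congr fun n => by congr 1; ext1 x; simp; ring)
  refine le_of_tendsto_of_tendsto' (ENNReal.Tendsto.const_mul t1 (Or.inr ENNReal.ofReal_ne_top))
    (ENNReal.Tendsto.const_mul t3 (Or.inr ENNReal.ofReal_ne_top)) fun n => ?_
  exact trace_difference_smooth hα hh ((hφ n).of_le (by simp)) hSm hy

/-! ### Lipschitz continuity of piecewise Lipschitz functions -/

/-- A comparison argument with one-sided slopes along the segment from `x` to `y`. At every point of
the segment slopes are only needed for arbitrarily close later points, so one piece that is visited
frequently suffices and nothing has to be known about how the segment crosses the pieces. -/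
theorem le_add_of_piecewise {E : Type*} [NormedAddCommGroup E] [NormedSpace ℝ E] {f : E → ℝ}
    (hf : Continuous f) {F : Set (Set E)} (hF : F.Finite) (hcl : ∀ K ∈ F, IsClosed K) {L : ℝ}
    (hL : 0 ≤ L) (hlip : ∀ K ∈ F, ∀ x ∈ K, ∀ y ∈ K, |f x - f y| ≤ L * ‖x - y‖)
    (h0 : ∀ x, (∀ K ∈ F, x ∉ K) → f x = 0) (x y : E) : f y ≤ f x + L * ‖y - x‖ := by
  set p : ℝ → E := fun t => x + t • (y - x) with hp
  have hpc : Continuous p := by fun_prop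
  have hpd : ∀ a b, ‖p a - p b‖ = |a - b| * ‖y - x‖ := by
    intro a b
    have : p a - p b = (a - b) • (y - x) := by simp only [hp]; module
    rw [this, norm_smul, Real.norm_eq_abs]
  have key := image_le_of_liminf_slope_right_le_deriv_boundary (f := fun t => f (p t)) (a := 0)
    (b := 1) (hf.comp hpc).continuousOn (B := fun t => f x + t * (L * ‖y - x‖))
    (B' := fun _ => L * ‖y - x‖) (by simp [hp]) (by fun_prop)
    (fun t _ => by
      have := ((hasDerivAt_id t).mul_const (L * ‖y - x‖)).const_add (f x)
      simpa using this.hasDerivWithinAt) ?_ (show (1 : ℝ) ∈ Icc 0 1 by simp)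
  · simpa [hp] using key
  intro t _ r hr
  have hslope : ∀ z, t < z → f (p z) - f (p t) ≤ L * ‖p z - p t‖ →
      slope (fun t => f (p t)) t z < r := by
    intro z hz hb
    rw [hpd, abs_of_pos (sub_pos.2 hz)] at hb
    rw [slope_def_field, div_lt_iff₀ (sub_pos.2 hz)]
    nlinarith [sub_pos.2 hz]
  -- If some piece is met arbitrarily soon after `t`, closedness puts `p t` into it. Otherwise, by
  -- finiteness, all pieces are left at once, and `f` vanishes just after `t` and, by continuity, at
  -- `t`.
  by_cases hfr : ∃ K ∈ F, ∃ᶠ z in 𝓝[>] t, p z ∈ K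
  · obtain ⟨K, hK, hfK⟩ := hfr
    have htK : p t ∈ K := by
      refine (hcl K hK).mem_of_frequently_of_tendsto hfK ?_
      exact (hpc.tendsto t).mono_left nhdsWithin_le_nhds
    refine (hfK.and_eventually self_mem_nhdsWithin).mono fun z hz => hslope z hz.2 ?_
    exact (le_abs_self _).trans (hlip K hK _ hz.1 _ htK)
  · have hev : ∀ᶠ z in 𝓝[>] t, ∀ K ∈ F, p z ∉ K := by
      rw [hF.eventually_all]
      intro K hK
      by_contra hc
      exact hfr ⟨K, hK, hc⟩
    have hev0 : ∀ᶠ z in 𝓝[>] t, f (p z) = 0 := hev.mono fun z hz => h0 _ hz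
    have ht0 : f (p t) = 0 := by
      have h1 : Tendsto (fun z => f (p z)) (𝓝[>] t) (𝓝 (f (p t))) :=
        ((hf.comp hpc).tendsto t).mono_left nhdsWithin_le_nhds
      have h2 : Tendsto (fun z => f (p z)) (𝓝[>] t) (𝓝 0) :=
        tendsto_const_nhds.congr' (hev0.mono fun z hz => hz.symm)
      exact tendsto_nhds_unique h1 h2
    refine ((hev0.and self_mem_nhdsWithin).mono fun z hz => hslope z hz.2 ?_).frequently
    rw [hz.1, ht0, sub_zero]; positivity

theorem lipschitzWith_of_piecewise {E : Type*} [NormedAddCommGroup E] [NormedSpace ℝ E] {f : E → ℝ}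
    (hf : Continuous f) {F : Set (Set E)} (hF : F.Finite) (hcl : ∀ K ∈ F, IsClosed K) {L : ℝ}
    (hL : 0 ≤ L) (hlip : ∀ K ∈ F, ∀ x ∈ K, ∀ y ∈ K, |f x - f y| ≤ L * ‖x - y‖)
    (h0 : ∀ x, (∀ K ∈ F, x ∉ K) → f x = 0) : LipschitzWith L.toNNReal f := by
  refine LipschitzWith.of_dist_le_mul fun x y => ?_
  rw [Real.coe_toNNReal L hL, Real.dist_eq, dist_eq_norm, abs_le]
  have h1 := le_add_of_piecewise hf hF hcl hL hlip h0 x y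
  have h2 := le_add_of_piecewise hf hF hcl hL hlip h0 y x
  rw [norm_sub_rev] at h1
  constructor <;> linarith

/-! ### Simplices -/

theorem affine_sum {ι : Type*} (A : Rd d →ᵃ[ℝ] ℝ) (t : Finset ι) (w : ι → ℝ) (p : ι → Rd d)
    (hw : ∑ i ∈ t, w i = 1) : A (∑ i ∈ t, w i • p i) = ∑ i ∈ t, w i * A (p i) := by
  have h : ∀ x, A x = A.linear x + A 0 := fun x => by
    simpa using A.map_vadd 0 x
  rw [h, map_sum]
  simp_rw [h (p _), mul_add, Finset.sum_add_distrib, map_smul, smul_eq_mul]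
  rw [← Finset.sum_mul, hw, one_mul]

/-- The vertices of a nondegenerate `d`-simplex in `ℝ^d`. -/
structure IsSimplex (s : Finset (Rd d)) : Prop where
  indep : AffineIndependent ℝ ((↑) : s → Rd d)
  card_eq : s.card = d + 1

/-- The affine basis formed by the vertices of a nondegenerate simplex. -/
def IsSimplex.basis {s : Finset (Rd d)} (hs : IsSimplex s) : AffineBasis s ℝ (Rd d) where
  toFun := (↑)
  ind' := hs.indep
  tot' := by
    rw [hs.indep.affineSpan_eq_top_iff_card_eq_finrank_add_one]
    simp [hs.card_eq]

open Classical in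
/-- The barycentric coordinate of the simplex with vertices `s` that belongs to `v`; it is zero if
`v` is not a vertex. -/
def bary (s : Finset (Rd d)) (v : Rd d) : Rd d →ᵃ[ℝ] ℝ :=
  if h : IsSimplex s ∧ v ∈ s then h.1.basis.coord ⟨v, h.2⟩ else AffineMap.const ℝ _ 0

theorem bary_of_mem {s : Finset (Rd d)} (hs : IsSimplex s) {v : Rd d} (hv : v ∈ s) :
    bary s v = hs.basis.coord ⟨v, hv⟩ := by
  rw [bary, dif_pos ⟨hs, hv⟩]

theorem bary_of_notMem {s : Finset (Rd d)} {v : Rd d} (hv : v ∉ s) (x : Rd d) : bary s v x = 0 := by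
  rw [bary, dif_neg (fun h => hv h.2)]; simp

theorem bary_self {s : Finset (Rd d)} (hs : IsSimplex s) {v : Rd d} (hv : v ∈ s) :
    bary s v v = 1 := by
  rw [bary_of_mem hs hv]
  exact hs.basis.coord_apply_eq ⟨v, hv⟩

theorem bary_of_ne {s : Finset (Rd d)} {v u : Rd d} (hu : u ∈ s) (h : v ≠ u) :
    bary s v u = 0 := by
  by_cases hv : IsSimplex s ∧ v ∈ s
  · rw [bary_of_mem hv.1 hv.2]
    exact hv.1.basis.coord_apply_ne (i := ⟨v, hv.2⟩) (j := ⟨u, hu⟩) (by simpa using h)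
  · rw [bary, dif_neg hv]; simp

theorem sum_bary {s : Finset (Rd d)} (hs : IsSimplex s) (x : Rd d) : ∑ v ∈ s, bary s v x = 1 := by
  rw [← Finset.sum_coe_sort, ← hs.basis.sum_coord_apply_eq_one x]
  exact Finset.sum_congr rfl fun v _ => by rw [bary_of_mem hs v.2]

theorem sum_bary_smul {s : Finset (Rd d)} (hs : IsSimplex s) (x : Rd d) :
    ∑ v ∈ s, bary s v x • v = x := by
  have h := hs.basis.linear_combination_coord_eq_self x
  rw [← Finset.sum_coe_sort]
  refine Eq.trans (Finset.sum_congr rfl fun v _ => ?_) h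
  rw [bary_of_mem hs v.2]; rfl

theorem affine_eq_sum_bary {s : Finset (Rd d)} (hs : IsSimplex s) (A : Rd d →ᵃ[ℝ] ℝ) (x : Rd d) :
    A x = ∑ v ∈ s, bary s v x * A v := by
  conv_lhs => rw [← sum_bary_smul hs x]
  exact affine_sum A s _ _ (sum_bary hs x)

theorem mem_convexHull_iff_bary {s : Finset (Rd d)} (hs : IsSimplex s) {x : Rd d} :
    x ∈ convexHull ℝ (s : Set (Rd d)) ↔ ∀ v ∈ s, 0 ≤ bary s v x := by
  have h := hs.basis.convexHull_eq_nonneg_coord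
  have hr : range hs.basis = (s : Set (Rd d)) := by
    ext y; simp only [mem_range]
    exact ⟨fun ⟨i, hi⟩ => hi ▸ i.2, fun hy => ⟨⟨y, hy⟩, rfl⟩⟩
  rw [hr] at h
  rw [h]
  simp only [mem_ofPred_eq, Subtype.forall]
  exact forall₂_congr fun v hv => by rw [bary_of_mem hs hv]

theorem bary_nonneg {s : Finset (Rd d)} (hs : IsSimplex s) {x : Rd d}
    (hx : x ∈ convexHull ℝ (s : Set (Rd d))) (v : Rd d) : 0 ≤ bary s v x := by
  by_cases hv : v ∈ s
  · exact (mem_convexHull_iff_bary hs).1 hx v hv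
  · rw [bary_of_notMem hv]

theorem bary_le_one {s : Finset (Rd d)} (hs : IsSimplex s) {x : Rd d}
    (hx : x ∈ convexHull ℝ (s : Set (Rd d))) (v : Rd d) : bary s v x ≤ 1 := by
  by_cases hv : v ∈ s
  · rw [← sum_bary hs x]
    exact Finset.single_le_sum (f := fun v => bary s v x) (fun u _ => bary_nonneg hs hx u) hv
  · rw [bary_of_notMem hv]; exact zero_le_one

/-- On a face the barycentric coordinates are the weights of the convex combination, whichever
simplex the face belongs to. -/
theorem bary_of_mem_convexHull_subset {s t : Finset (Rd d)} (hs : IsSimplex s) (hts : t ⊆ s)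
    {x : Rd d} {w : Rd d → ℝ} (hw1 : ∑ v ∈ t, w v = 1) (hwx : ∑ v ∈ t, w v • v = x) (v : Rd d) :
    (v ∈ t → bary s v x = w v) ∧ (v ∉ t → bary s v x = 0) := by
  have h : bary s v x = ∑ u ∈ t, w u * bary s v u := by
    rw [← hwx]; exact affine_sum _ t w _ hw1
  constructor
  · intro hv
    rw [h, Finset.sum_eq_single v]
    · rw [bary_self hs (hts hv), mul_one]
    · intro u hu hne
      rw [bary_of_ne (hts hu) hne.symm, mul_zero]
    · exact fun h => absurd hv h
  · intro hv
    rw [h]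
    refine Finset.sum_eq_zero fun u hu => ?_
    rw [bary_of_ne (v := v) (hts hu) (fun h => hv (by rw [h]; exact hu)), mul_zero]

/-- Both sides are determined by the common face. This consistency makes the nodal basis functions
well defined. -/
theorem bary_eq_of_mem_inter {s t : Finset (Rd d)} (hs : IsSimplex s) (ht : IsSimplex t)
    {x : Rd d} (hx : x ∈ convexHull ℝ ((s : Set (Rd d)) ∩ t)) (v : Rd d) :
    bary s v x = bary t v x := by
  classical
  rw [← Finset.coe_inter, Finset.mem_convexHull'] at hx
  obtain ⟨w, -, hw1, hwx⟩ := hx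
  have h1 := bary_of_mem_convexHull_subset hs Finset.inter_subset_left hw1 hwx v
  have h2 := bary_of_mem_convexHull_subset ht Finset.inter_subset_right hw1 hwx v
  by_cases hv : v ∈ s ∩ t
  · rw [h1.1 hv, h2.1 hv]
  · rw [h1.2 hv, h2.2 hv]

/-- Some vertex `v` of `s` is missing in `t`. The coordinate of `v` vanishes on the common face but
not at `v`, so the affine span of that face is a proper subspace. -/
theorem volume_convexHull_inter_eq_zero {s t : Finset (Rd d)} (hs : IsSimplex s) (ht : IsSimplex t)
    (hne : s ≠ t) : volume (convexHull ℝ ((s : Set (Rd d)) ∩ t)) = 0 := by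
  have hex : ∃ v ∈ s, v ∉ t := by
    by_contra hc
    push Not at hc
    exact hne (Finset.eq_of_subset_of_card_le hc (by rw [hs.card_eq, ht.card_eq]))
  obtain ⟨v, hvs, hvt⟩ := hex
  have hsub : convexHull ℝ ((s : Set (Rd d)) ∩ t) ⊆ affineSpan ℝ ((s : Set (Rd d)) ∩ t) :=
    convexHull_subset_affineSpan _
  refine measure_mono_null hsub (Measure.addHaar_affineSubspace volume _ fun htop => ?_)
  have hle : affineSpan ℝ ((s : Set (Rd d)) ∩ t) ≤ (AffineSubspace.comap (bary s v)
      (affineSpan ℝ {(0 : ℝ)})) := by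
    rw [affineSpan_le]
    intro u hu
    simp only [AffineSubspace.coe_comap, mem_preimage, AffineSubspace.coe_affineSpan_singleton,
      mem_singleton_iff]
    exact bary_of_ne hu.1 (fun h => hvt (h ▸ hu.2))
  have hv : v ∈ affineSpan ℝ ((s : Set (Rd d)) ∩ t) := htop ▸ AffineSubspace.mem_top ℝ _ v
  have := hle hv
  simp [bary_self hs hvs] at this

/-! ### Gradients of barycentric coordinates and shape regularity -/

/-- The linear part of an affine function as a vector. -/
def affGrad (A : Rd d →ᵃ[ℝ] ℝ) : Rd d :=
  (InnerProductSpace.toDual ℝ (Rd d)).symm (LinearMap.toContinuousLinearMap A.linear)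

theorem inner_affGrad (A : Rd d →ᵃ[ℝ] ℝ) (x y : Rd d) : inner ℝ (affGrad A) (x - y) = A x - A y := by
  rw [affGrad, InnerProductSpace.toDual_symm_apply]
  simpa using A.linearMap_vsub x y

theorem abs_affine_sub_le (A : Rd d →ᵃ[ℝ] ℝ) (x y : Rd d) : |A x - A y| ≤ ‖affGrad A‖ * ‖x - y‖ := by
  rw [← inner_affGrad]
  exact abs_real_inner_le_norm _ _

/-- In an orthonormal basis starting with `n / ‖n‖` the set lies in a box with half-width `1 / ‖n‖`
in the first direction and `h` in the others. -/
theorem norm_mul_volume_le {K : Set (Rd d)} {n x₀ : Rd d} {h : ℝ} (hd : 0 < d) (hh : 0 ≤ h)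
    (hK : ∀ x ∈ K, ‖x - x₀‖ ≤ h) (hn : ∀ x ∈ K, |inner ℝ n (x - x₀)| ≤ 1) :
    ‖n‖ * volume.real K ≤ 2 ^ d * h ^ (d - 1) := by
  by_cases hn0 : n = 0
  · subst hn0; simp; positivity
  have hnpos : 0 < ‖n‖ := norm_pos_iff.2 hn0
  let i₀ : Fin d := ⟨0, hd⟩
  obtain ⟨B, hB⟩ := Orthonormal.exists_orthonormalBasis_extension_of_card_eq (𝕜 := ℝ) (E := Rd d)
    (ι := Fin d) (by simp) (v := fun _ => ‖n‖⁻¹ • n) (s := {i₀}) (by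
      constructor
      · intro i; simp [norm_smul, hnpos.ne']
      · intro i j hij; exact absurd (Subsingleton.elim i j) hij)
  have hB0 : B i₀ = ‖n‖⁻¹ • n := hB i₀ rfl
  let c : Fin d → ℝ := fun i => if i = i₀ then ‖n‖⁻¹ else h
  have hc0 : ∀ i, 0 ≤ c i := fun i => by simp only [c]; split_ifs <;> positivity
  let a : Fin d → ℝ := fun i => B.repr x₀ i - c i
  let b : Fin d → ℝ := fun i => B.repr x₀ i + c i
  have hmp : MeasurePreserving (fun x => WithLp.ofLp (B.repr x)) (volume : Measure (Rd d)) volume :=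
    (EuclideanSpace.volume_preserving_symm_measurableEquiv_toLp (Fin d)).comp
      B.measurePreserving_repr
  have hsub : K ⊆ (fun x => WithLp.ofLp (B.repr x)) ⁻¹' (Icc a b) := by
    intro x hx
    have hcoord : ∀ i, |B.repr x i - B.repr x₀ i| ≤ c i := by
      intro i
      have e : B.repr x i - B.repr x₀ i = inner ℝ (B i) (x - x₀) := by
        rw [inner_sub_right, B.repr_apply_apply, B.repr_apply_apply]
      rw [e]
      simp only [c]
      split_ifs with hi
      · rw [hi, hB0, real_inner_smul_left, abs_mul, abs_of_pos (inv_pos.2 hnpos)]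
        have := hn x hx
        have h2 := inv_pos.2 hnpos
        nlinarith
      · refine (abs_real_inner_le_norm _ _).trans ?_
        rw [B.norm_eq_one, one_mul]
        exact hK x hx
    simp only [mem_preimage, mem_Icc, Pi.le_def, a, b]
    exact ⟨fun i => by linarith [(abs_le.1 (hcoord i)).1], fun i => by
      linarith [(abs_le.1 (hcoord i)).2]⟩
  have hvol : volume.real K ≤ ∏ i, (2 * c i) := by
    have h1 : volume K ≤ volume (Icc a b) := by
      rw [← hmp.measure_preimage measurableSet_Icc.nullMeasurableSet]
      exact measure_mono hsub
    rw [Real.volume_Icc_pi, ← ENNReal.ofReal_prod_of_nonneg] at h1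
    · have h2 := ENNReal.toReal_mono ENNReal.ofReal_ne_top h1
      rw [ENNReal.toReal_ofReal] at h2
      · refine h2.trans (le_of_eq (Finset.prod_congr rfl fun i _ => ?_))
        simp only [a, b]; ring
      · exact Finset.prod_nonneg fun i _ => by simp only [a, b]; linarith [hc0 i]
    · exact fun i _ => by simp only [a, b]; linarith [hc0 i]
  have hprod : ∏ i, (2 * c i) = 2 ^ d * (‖n‖⁻¹ * h ^ (d - 1)) := by
    rw [Finset.prod_mul_distrib, Finset.prod_const, Finset.card_univ, Fintype.card_fin]
    congr 1
    rw [← Finset.mul_prod_erase _ _ (Finset.mem_univ i₀), show c i₀ = ‖n‖⁻¹ from if_pos rfl]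
    congr 1
    · rw [Finset.prod_congr rfl (g := fun _ => h) (fun i hi => by
        simp [c, Finset.ne_of_mem_erase hi])]
      rw [Finset.prod_const, Finset.card_erase_of_mem (Finset.mem_univ _), Finset.card_univ,
        Fintype.card_fin]
  rw [hprod] at hvol
  calc ‖n‖ * volume.real K ≤ ‖n‖ * (2 ^ d * (‖n‖⁻¹ * h ^ (d - 1))) := by gcongr
    _ = _ := by field_simp

theorem exists_vertex_ne {s : Finset (Rd d)} (hs : IsSimplex s) (hd : 0 < d) :
    ∃ u ∈ s, ∃ v ∈ s, u ≠ v :=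
  Finset.one_lt_card.1 (by rw [hs.card_eq]; omega)

theorem isCompact_hull (s : Finset (Rd d)) : IsCompact (convexHull ℝ (s : Set (Rd d))) :=
  s.finite_toSet.isCompact_convexHull ℝ

theorem diam_hull_pos {s : Finset (Rd d)} (hs : IsSimplex s) (hd : 0 < d) :
    0 < Metric.diam (convexHull ℝ (s : Set (Rd d))) := by
  obtain ⟨u, hu, v, hv, hne⟩ := exists_vertex_ne hs hd
  refine (dist_pos.2 hne).trans_le (Metric.dist_le_diam_of_mem (isCompact_hull s).isBounded
    (subset_convexHull ℝ _ hu) (subset_convexHull ℝ _ hv))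

theorem norm_sub_le_diam {s : Finset (Rd d)} {x y : Rd d}
    (hx : x ∈ convexHull ℝ (s : Set (Rd d))) (hy : y ∈ convexHull ℝ (s : Set (Rd d))) :
    ‖x - y‖ ≤ Metric.diam (convexHull ℝ (s : Set (Rd d))) := by
  rw [← dist_eq_norm]
  exact Metric.dist_le_diam_of_mem (isCompact_hull s).isBounded hx hy

/-- A barycentric coordinate varies by at most one on the simplex, so a large gradient would force a
thin slab and hence a small volume. Shape regularity, in the form `h ^ d ≤ |γ| ^ d * |K|`, excludes
this; `|γ|` appears since no sign of `γ` is assumed. -/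
theorem norm_affGrad_bary_le {s : Finset (Rd d)} (hs : IsSimplex s) (hd : 0 < d) {γ : ℝ}
    (hγ : Metric.diam (convexHull ℝ (s : Set (Rd d))) ≤
      γ * (volume.real (convexHull ℝ (s : Set (Rd d)))) ^ (1 / (d : ℝ))) (v : Rd d) :
    ‖affGrad (bary s v)‖ * Metric.diam (convexHull ℝ (s : Set (Rd d))) ≤ (2 * |γ|) ^ d := by
  set K := convexHull ℝ (s : Set (Rd d))
  set h := Metric.diam K
  have hh : 0 < h := diam_hull_pos hs hd
  obtain ⟨x₀, hx₀, -⟩ := exists_vertex_ne hs hd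
  have hx₀K : x₀ ∈ K := subset_convexHull ℝ _ hx₀
  have h1 := norm_mul_volume_le (K := K) (n := affGrad (bary s v)) (x₀ := x₀) hd hh.le
    (fun x hx => norm_sub_le_diam hx hx₀K) (fun x hx => by
      rw [inner_affGrad, abs_le]
      constructor <;> linarith [bary_nonneg hs hx v, bary_le_one hs hx v, bary_nonneg hs hx₀K v,
        bary_le_one hs hx₀K v])
  have h2 : h ^ d ≤ |γ| ^ d * volume.real K := by
    have h3 : h ≤ |γ| * (volume.real K) ^ (1 / (d : ℝ)) :=
      hγ.trans (mul_le_mul_of_nonneg_right (le_abs_self γ) (by positivity))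
    calc h ^ d ≤ (|γ| * (volume.real K) ^ (1 / (d : ℝ))) ^ d := by gcongr
      _ = _ := by
        rw [mul_pow, ← Real.rpow_natCast (_ ^ (1 / (d : ℝ))), ← Real.rpow_mul (by positivity)]
        have : (1 / (d : ℝ)) * d = 1 := by
          have : (d : ℝ) ≠ 0 := by positivity
          field_simp
        rw [this, Real.rpow_one]
  set N := ‖affGrad (bary s v)‖
  have hN : 0 ≤ N := norm_nonneg _
  have h4 : N * h * h ^ (d - 1) ≤ (2 * |γ|) ^ d * h ^ (d - 1) := by
    calc N * h * h ^ (d - 1) = N * h ^ d := by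
          rw [mul_assoc, ← pow_succ']; congr 2; omega
      _ ≤ N * (|γ| ^ d * volume.real K) := by gcongr
      _ = |γ| ^ d * (N * volume.real K) := by ring
      _ ≤ |γ| ^ d * (2 ^ d * h ^ (d - 1)) := by gcongr
      _ = _ := by rw [mul_pow]; ring
  exact le_of_mul_le_mul_right h4 (by positivity)

/-- The barycenter of a simplex. -/
def centroid (s : Finset (Rd d)) : Rd d := ∑ v ∈ s, ((d : ℝ) + 1)⁻¹ • v

theorem bary_centroid {s : Finset (Rd d)} (hs : IsSimplex s) {v : Rd d} (hv : v ∈ s) :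
    bary s v (centroid s) = ((d : ℝ) + 1)⁻¹ := by
  refine (bary_of_mem_convexHull_subset hs subset_rfl (w := fun _ => ((d : ℝ) + 1)⁻¹) ?_ rfl v).1 hv
  rw [Finset.sum_const, hs.card_eq, nsmul_eq_mul]
  push_cast
  have : (d : ℝ) + 1 ≠ 0 := by positivity
  field_simp

/-- All coordinates of the barycenter are `1 / (d + 1)`, and a shift by `y` lowers each of them by
at most `N * ‖y‖`. -/
theorem centroid_add_mem {s : Finset (Rd d)} (hs : IsSimplex s) {N : ℝ}
    (hN : ∀ v, ‖affGrad (bary s v)‖ ≤ N) {y : Rd d} (hy : N * ‖y‖ ≤ ((d : ℝ) + 1)⁻¹) :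
    centroid s + y ∈ convexHull ℝ (s : Set (Rd d)) := by
  rw [mem_convexHull_iff_bary hs]
  intro v hv
  have h1 := abs_affine_sub_le (bary s v) (centroid s + y) (centroid s)
  rw [bary_centroid hs hv, add_sub_cancel_left] at h1
  have h2 : ‖affGrad (bary s v)‖ * ‖y‖ ≤ N * ‖y‖ := by gcongr; exact hN v
  linarith [(abs_le.1 h1).1]

/-- A simplex shrunk towards its barycenter by the factor two. -/
def halfHull (s : Finset (Rd d)) : Set (Rd d) :=
  AffineMap.homothety (centroid s) (1 / 2 : ℝ) '' convexHull ℝ (s : Set (Rd d))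

theorem volume_halfHull (s : Finset (Rd d)) :
    volume (halfHull s) = ENNReal.ofReal ((1 / 2) ^ d) * volume (convexHull ℝ (s : Set (Rd d))) := by
  rw [halfHull, Measure.addHaar_image_homothety, abs_of_pos (by positivity)]
  simp

/-- A point of the shrunken simplex is the midpoint of some `k` and the barycenter, so after the
shift it is the midpoint of `k` and the barycenter moved by `2 θ y`; convexity concludes. -/
theorem halfHull_add_mem {s : Finset (Rd d)} (hs : IsSimplex s) {N : ℝ} (hN0 : 0 ≤ N)
    (hN : ∀ v, ‖affGrad (bary s v)‖ ≤ N) {y : Rd d} (hy : N * (2 * ‖y‖) ≤ ((d : ℝ) + 1)⁻¹) :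
    ∀ x ∈ halfHull s, ∀ θ ∈ Icc (0 : ℝ) 1, x + θ • y ∈ convexHull ℝ (s : Set (Rd d)) := by
  rintro x ⟨k, hk, rfl⟩ θ hθ
  have h1 : centroid s + (2 * θ) • y ∈ convexHull ℝ (s : Set (Rd d)) := by
    refine centroid_add_mem hs hN (le_trans ?_ hy)
    rw [norm_smul, Real.norm_eq_abs, abs_of_nonneg (by linarith [hθ.1])]
    gcongr
    linarith [hθ.2]
  have h2 := (convex_convexHull ℝ (s : Set (Rd d))) hk h1 (a := 1 / 2) (b := 1 / 2) (by norm_num)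
    (by norm_num) (by norm_num)
  convert h2 using 1
  rw [AffineMap.homothety_apply, vsub_eq_sub, vadd_eq_add]
  module

variable {Ω : Set (Rd d)}

/-! ### Hat functions and nodal interpolation on a mesh -/

/-- The vertex sets of the elements of the mesh. -/
def Mesh.tops (T : Mesh Ω) : Set (Finset (Rd d)) := {K ∈ T.complex.faces | K.card = d + 1}

theorem Mesh.tops_finite (T : Mesh Ω) : T.tops.Finite := T.finite_faces.subset fun _ h => h.1

theorem Mesh.isSimplex (T : Mesh Ω) {s : Finset (Rd d)} (hs : s ∈ T.tops) : IsSimplex s :=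
  ⟨T.complex.indep hs.1, hs.2⟩

theorem Mesh.hull_mem_elements (T : Mesh Ω) {s : Finset (Rd d)} (hs : s ∈ T.tops) :
    convexHull ℝ (s : Set (Rd d)) ∈ T.elements := ⟨s, hs, rfl⟩

theorem Mesh.elements_finite (T : Mesh Ω) : T.elements.Finite := T.tops_finite.image _

theorem Mesh.mem_closure_iff (T : Mesh Ω) {x : Rd d} :
    x ∈ closure Ω ↔ ∃ s ∈ T.tops, x ∈ convexHull ℝ (s : Set (Rd d)) := by
  rw [← T.cover]
  simp only [mem_iUnion, exists_prop]
  rfl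

theorem Mesh.hull_subset (T : Mesh Ω) {s : Finset (Rd d)} (hs : s ∈ T.tops) :
    convexHull ℝ (s : Set (Rd d)) ⊆ closure Ω := fun _ hx => T.mem_closure_iff.2 ⟨s, hs, hx⟩

theorem Mesh.bary_eq (T : Mesh Ω) {s t : Finset (Rd d)} (hs : s ∈ T.tops) (ht : t ∈ T.tops)
    {x : Rd d} (hxs : x ∈ convexHull ℝ (s : Set (Rd d))) (hxt : x ∈ convexHull ℝ (t : Set (Rd d)))
    (v : Rd d) : bary s v x = bary t v x :=
  bary_eq_of_mem_inter (T.isSimplex hs) (T.isSimplex ht)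
    (T.complex.inter_subset_convexHull hs.1 ht.1 ⟨hxs, hxt⟩) v

theorem Mesh.volume_inter_eq_zero (T : Mesh Ω) {s t : Finset (Rd d)} (hs : s ∈ T.tops)
    (ht : t ∈ T.tops) (hne : s ≠ t) :
    volume (convexHull ℝ (s : Set (Rd d)) ∩ convexHull ℝ (t : Set (Rd d))) = 0 :=
  measure_mono_null (T.complex.inter_subset_convexHull hs.1 ht.1)
    (volume_convexHull_inter_eq_zero (T.isSimplex hs) (T.isSimplex ht) hne)

open Classical in
/-- The nodal basis function of the mesh that belongs to the vertex `v`. -/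
def Mesh.hat (T : Mesh Ω) (v x : Rd d) : ℝ :=
  if h : ∃ s ∈ T.tops, x ∈ convexHull ℝ (s : Set (Rd d)) then bary h.choose v x else 0

theorem Mesh.hat_eq (T : Mesh Ω) {s : Finset (Rd d)} (hs : s ∈ T.tops) {x : Rd d}
    (hx : x ∈ convexHull ℝ (s : Set (Rd d))) (v : Rd d) : T.hat v x = bary s v x := by
  have h : ∃ s ∈ T.tops, x ∈ convexHull ℝ (s : Set (Rd d)) := ⟨s, hs, hx⟩
  rw [Mesh.hat, dif_pos h]
  exact T.bary_eq h.choose_spec.1 hs h.choose_spec.2 hx v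

theorem Mesh.hat_of_notMem (T : Mesh Ω) {x : Rd d} (hx : x ∉ closure Ω) (v : Rd d) :
    T.hat v x = 0 := by
  rw [Mesh.hat, dif_neg (fun h => hx (T.mem_closure_iff.2 h))]

theorem Mesh.hat_nonneg (T : Mesh Ω) (v x : Rd d) : 0 ≤ T.hat v x := by
  by_cases hx : x ∈ closure Ω
  · obtain ⟨s, hs, hxs⟩ := T.mem_closure_iff.1 hx
    rw [T.hat_eq hs hxs]
    exact bary_nonneg (T.isSimplex hs) hxs v
  · rw [T.hat_of_notMem hx]

theorem continuous_affine (A : Rd d →ᵃ[ℝ] ℝ) : Continuous A := A.continuous_of_finiteDimensional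

theorem affine_lineMap (A : Rd d →ᵃ[ℝ] ℝ) (v x : Rd d) (ε : ℝ) :
    A (v + ε • (x - v)) = (1 - ε) * A v + ε * A x := by
  have := A.apply_lineMap v x ε
  rw [AffineMap.lineMap_apply, AffineMap.lineMap_apply, vsub_eq_sub, vadd_eq_add, vsub_eq_sub,
    vadd_eq_add, smul_eq_mul, add_comm] at this
  rw [this]; ring

/-- The star of an interior vertex has no boundary point of `closure Ω` at which the basis function
is positive. Points near `x` are contracted towards `v` into the neighbourhood of `v` filled by
elements; the element found there contains `v`, and undoing the contraction stays inside it as long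
as the coordinate of `v` is positive. -/
theorem Mesh.mem_nhds_of_hat_pos (T : Mesh Ω) {v : Rd d} (hv : v ∈ interior (closure Ω))
    {x : Rd d} (hx : 0 < T.hat v x) : closure Ω ∈ 𝓝 x := by
  by_contra hcon
  have hfr : ∃ᶠ x' in 𝓝 x, x' ∉ closure Ω := by
    rw [Filter.Frequently]
    simp only [not_not]
    exact hcon
  have hxcl : x ∈ closure Ω := by
    by_contra h
    rw [T.hat_of_notMem h] at hx
    exact lt_irrefl _ hx
  obtain ⟨s, hs, hxs⟩ := T.mem_closure_iff.1 hxcl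
  rw [T.hat_eq hs hxs] at hx
  have hss := T.isSimplex hs
  have hvs : v ∈ s := by
    by_contra h
    rw [bary_of_notMem h] at hx
    exact lt_irrefl _ hx
  -- dilate towards the vertex `v`
  obtain ⟨ε, hε0, hε1, hεi⟩ : ∃ ε : ℝ, 0 < ε ∧ ε ≤ 1 ∧ v + ε • (x - v) ∈ interior (closure Ω) := by
    have hc : Tendsto (fun ε : ℝ => v + ε • (x - v)) (𝓝[>] 0) (𝓝 v) := by
      have : Continuous fun ε : ℝ => v + ε • (x - v) := by fun_prop
      have h2 := (this.tendsto 0).mono_left (nhdsWithin_le_nhds (s := Ioi 0))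
      simpa using h2
    have h1 := hc (isOpen_interior.mem_nhds hv)
    have h2 : ∀ᶠ ε : ℝ in 𝓝[>] 0, ε ∈ Ioc (0 : ℝ) 1 := Ioc_mem_nhdsGT one_pos
    obtain ⟨ε, he1, he2⟩ := (h2.and h1).exists
    exact ⟨ε, he1.1, he1.2, he2⟩
  have hyc : Continuous fun x' : Rd d => v + ε • (x' - v) := by fun_prop
  have hev : ∀ᶠ x' in 𝓝 x, v + ε • (x' - v) ∈ closure Ω :=
    ((hyc.tendsto x).eventually (isOpen_interior.mem_nhds hεi)).mono fun _ h => interior_subset h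
  -- Among finitely many elements, one must contain the contracted images of exterior points
  -- arbitrarily close to `x`.
  obtain ⟨t, ht, hft⟩ : ∃ t ∈ T.tops, ∃ᶠ x' in 𝓝 x, x' ∉ closure Ω ∧
      v + ε • (x' - v) ∈ convexHull ℝ (t : Set (Rd d)) := by
    by_contra hc
    push Not at hc
    have hall : ∀ᶠ x' in 𝓝 x, ∀ t ∈ T.tops, ¬ (x' ∉ closure Ω ∧
        v + ε • (x' - v) ∈ convexHull ℝ (t : Set (Rd d))) := by
      rw [T.tops_finite.eventually_all]
      intro t ht
      filter_upwards [hc t ht] with x' hx' h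
      exact hx' h.1 h.2
    obtain ⟨x', hx', h1, h2⟩ := (hfr.and_eventually (hall.and hev)).exists
    obtain ⟨t, ht, hxt⟩ := T.mem_closure_iff.1 h2
    exact h1 t ht ⟨hx', hxt⟩
  have hts := T.isSimplex ht
  have hyt : v + ε • (x - v) ∈ convexHull ℝ (t : Set (Rd d)) :=
    (isCompact_hull t).isClosed.mem_of_frequently_of_tendsto (hft.mono fun _ h => h.2)
      (hyc.tendsto x)
  have hys : v + ε • (x - v) ∈ convexHull ℝ (s : Set (Rd d)) :=
    (convex_convexHull ℝ _).add_smul_sub_mem (subset_convexHull ℝ _ hvs) hxs ⟨hε0.le, hε1⟩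
  have heq := T.bary_eq hs ht hys hyt v
  rw [affine_lineMap, bary_self hss hvs] at heq
  -- If `v` were not a vertex of `t`, the right side of `heq` would be zero, while the left side is
  -- `(1 - ε) + ε * bary s v x > 0`.
  have hvt : v ∈ t := by
    by_contra h
    rw [bary_of_notMem h] at heq
    nlinarith [mul_pos hε0 hx]
  rw [affine_lineMap, bary_self hts hvt] at heq
  have hxt : 0 < bary t v x := by
    have : bary s v x = bary t v x := by
      have := mul_left_cancel₀ hε0.ne' (add_left_cancel heq)
      exact this
    rwa [← this]
  have hpos : ∀ᶠ x' in 𝓝 x, 0 < bary t v x' :=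
    ((continuous_affine (bary t v)).tendsto x).eventually (lt_mem_nhds hxt)
  obtain ⟨x', ⟨hx'1, hx'2⟩, hx'3⟩ := (hft.and_eventually hpos).exists
  -- The exterior point `x'` lies in `t` after all: its coordinate at `v` is positive by continuity,
  -- and the contraction scales every other coordinate by `ε > 0`, which preserves its sign.
  refine hx'1 (T.hull_subset ht ((mem_convexHull_iff_bary hts).2 fun u hu => ?_))
  by_cases huv : u = v
  · rw [huv]; exact hx'3.le
  · have := (mem_convexHull_iff_bary hts).1 hx'2 u hu
    rw [affine_lineMap, bary_of_ne hvt huv, mul_zero, zero_add] at this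
    exact nonneg_of_mul_nonneg_right this hε0

theorem Mesh.continuousWithinAt_hat (T : Mesh Ω) (v x : Rd d) :
    ContinuousWithinAt (T.hat v) (closure Ω) x := by
  rw [ContinuousWithinAt, Metric.tendsto_nhds]
  intro ε hε
  have h : ∀ s ∈ T.tops, ∀ᶠ y in 𝓝 x, y ∈ convexHull ℝ (s : Set (Rd d)) →
      dist (T.hat v y) (T.hat v x) < ε := by
    intro s hs
    by_cases hxs : x ∈ convexHull ℝ (s : Set (Rd d))
    · have := Metric.tendsto_nhds.1 ((continuous_affine (bary s v)).tendsto x) ε hε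
      filter_upwards [this] with y hy hys
      rwa [T.hat_eq hs hxs, T.hat_eq hs hys]
    · filter_upwards [(isCompact_hull s).isClosed.isOpen_compl.mem_nhds hxs] with y hy hys
      exact absurd hys hy
  rw [← T.tops_finite.eventually_all] at h
  rw [eventually_nhdsWithin_iff]
  filter_upwards [h] with y hy hyc
  obtain ⟨s, hs, hys⟩ := T.mem_closure_iff.1 hyc
  exact hy s hs hys

/-- The basis function is continuous relative to `closure Ω` and zero outside. At a zero the two
sides match; at a positive value there is no outside nearby. -/
theorem Mesh.continuous_hat (T : Mesh Ω) {v : Rd d} (hv : v ∈ interior (closure Ω)) :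
    Continuous (T.hat v) := by
  rw [continuous_iff_continuousAt]
  intro x
  rcases (T.hat_nonneg v x).eq_or_lt with h0 | hpos
  · rw [← continuousWithinAt_univ, ← union_compl_self (closure Ω), continuousWithinAt_union]
    constructor
    · exact T.continuousWithinAt_hat v x
    · exact continuousWithinAt_const.congr (f := fun _ => (0 : ℝ))
        (fun y hy => T.hat_of_notMem hy v) h0.symm
  · have hnh := T.mem_nhds_of_hat_pos hv hpos
    exact (T.continuousWithinAt_hat v x).continuousAt hnh

open Classical in
/-- The vertices of the elements of the mesh. -/
def Mesh.verts (T : Mesh Ω) : Finset (Rd d) := T.tops_finite.toFinset.biUnion id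

/-- Nodal interpolation. -/
def Mesh.interp (T : Mesh Ω) (f : Rd d → ℝ) (x : Rd d) : ℝ := ∑ v ∈ T.verts, f v * T.hat v x

theorem Mesh.interp_eq (T : Mesh Ω) (f : Rd d → ℝ) {s : Finset (Rd d)} (hs : s ∈ T.tops) {x : Rd d}
    (hx : x ∈ convexHull ℝ (s : Set (Rd d))) :
    T.interp f x = ∑ v ∈ s, bary s v x * f v := by
  have hsub : s ⊆ T.verts := fun v hv =>
    Finset.mem_biUnion.2 ⟨s, T.tops_finite.mem_toFinset.2 hs, hv⟩
  rw [Mesh.interp, ← Finset.sum_subset hsub]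
  · exact Finset.sum_congr rfl fun v _ => by rw [T.hat_eq hs hx, mul_comm]
  · intro v _ hv
    rw [T.hat_eq hs hx, bary_of_notMem hv, mul_zero]

theorem Mesh.interp_of_notMem (T : Mesh Ω) (f : Rd d → ℝ) {x : Rd d} (hx : x ∉ closure Ω) :
    T.interp f x = 0 :=
  Finset.sum_eq_zero fun v _ => by rw [T.hat_of_notMem hx, mul_zero]

/-- The hypothesis discards the basis functions of boundary vertices, whose extension by zero need
not be continuous. -/
theorem Mesh.interp_mem_S10 (T : Mesh Ω) {f : Rd d → ℝ}
    (hf : ∀ v, f v ≠ 0 → v ∈ interior (closure Ω)) : T.interp f ∈ T.S10 := by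
  refine ⟨?_, ?_, ?_⟩
  · refine continuous_finsetSum _ fun v _ => ?_
    by_cases hv : f v = 0
    · simp only [hv, zero_mul]; exact continuous_const
    · exact continuous_const.mul (T.continuous_hat (hf v hv))
  · refine closure_minimal (fun x hx => ?_) isClosed_closure
    by_contra hc
    exact hx (T.interp_of_notMem f hc)
  · rintro _ ⟨s, hs, rfl⟩
    refine ⟨∑ v ∈ s, f v • bary s v, fun x hx => ?_⟩
    rw [T.interp_eq f hs hx]
    have : ∀ t : Finset (Rd d), (∑ v ∈ t, f v • bary s v : Rd d →ᵃ[ℝ] ℝ) x =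
        ∑ v ∈ t, bary s v x * f v := by
      intro t
      classical
      induction t using Finset.induction_on with
      | empty => simp
      | insert a t ha ih =>
        rw [Finset.sum_insert ha, Finset.sum_insert ha, AffineMap.coe_add, Pi.add_apply, ih]
        simp [mul_comm]
    exact (this s).symm

theorem mem_interior_of_ne_zero {g : Rd d → ℝ} (hg : Continuous g) (hs : tsupport g ⊆ closure Ω)
    {v : Rd d} (hv : g v ≠ 0) : v ∈ interior (closure Ω) :=
  interior_maximal ((subset_tsupport g).trans hs) hg.isOpen_support hv

theorem exists_nonneg_bound {ι : Type*} {F : Set ι} (hF : F.Finite) (L : ι → ℝ) :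
    ∃ M : ℝ, 0 ≤ M ∧ ∀ i ∈ F, L i ≤ M := by
  obtain ⟨M, hM⟩ := (hF.image L).bddAbove
  exact ⟨max M 0, le_max_right _ _, fun i hi => (hM (mem_image_of_mem L hi)).trans (le_max_left _ _)⟩

/-- This makes the interpolation error globally Lipschitz, so that its product lifting is a
Beppo-Levi function. -/
theorem Mesh.lipschitzWith_of_elements (T : Mesh Ω) {f : Rd d → ℝ} (hf : Continuous f)
    (h0 : ∀ x ∉ closure Ω, f x = 0)
    (hl : ∀ s ∈ T.tops, ∃ L : ℝ, ∀ x ∈ convexHull ℝ (s : Set (Rd d)),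
      ∀ y ∈ convexHull ℝ (s : Set (Rd d)), |f x - f y| ≤ L * ‖x - y‖) :
    ∃ C, LipschitzWith C f := by
  choose! L hL using hl
  obtain ⟨M, hM0, hM⟩ := exists_nonneg_bound T.tops_finite L
  refine ⟨M.toNNReal, lipschitzWith_of_piecewise hf T.elements_finite ?_ hM0 ?_ fun x hx => h0 x ?_⟩
  · rintro _ ⟨s, hs, rfl⟩
    exact (isCompact_hull s).isClosed
  · rintro _ ⟨s, hs, rfl⟩ x hx y hy
    refine (hL s hs x hx y hy).trans ?_
    gcongr
    exact hM s hs
  · intro hc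
    obtain ⟨s, hs, hxs⟩ := T.mem_closure_iff.1 hc
    exact hx _ (T.hull_mem_elements hs) hxs

theorem Mesh.diam_le_width (T : Mesh Ω) {s : Finset (Rd d)} (hs : s ∈ T.tops) :
    Metric.diam (convexHull ℝ (s : Set (Rd d))) ≤ T.width :=
  le_csSup (T.elements_finite.image _).bddAbove (mem_image_of_mem _ (T.hull_mem_elements hs))

/-! ### Cut-off functions -/

/-- Bounds for the first derivative and its Lipschitz constant are all that the Taylor expansion of
the cutoff requires. -/
theorem exists_smoothTransition_bound : ∃ D : ℝ, 1 ≤ D ∧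
    (∀ x, |deriv Real.smoothTransition x| ≤ D) ∧
    ∀ x y, |deriv Real.smoothTransition x - deriv Real.smoothTransition y| ≤ D * |x - y| := by
  have hsm : ContDiff ℝ 2 Real.smoothTransition := Real.smoothTransition.contDiff
  have hd : ContDiff ℝ 1 (deriv Real.smoothTransition) :=
    ContDiff.deriv' (n := 1) hsm
  have hc : HasCompactSupport (deriv Real.smoothTransition) := by
    refine HasCompactSupport.intro (K := Icc 0 1) isCompact_Icc fun x hx => ?_
    rw [mem_Icc, not_and_or, not_le, not_le] at hx
    rcases hx with hx | hx
    · have : Real.smoothTransition =ᶠ[𝓝 x] fun _ => 0 := by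
        filter_upwards [gt_mem_nhds hx] with y hy using Real.smoothTransition.zero_of_nonpos hy.le
      rw [this.deriv_eq]; simp
    · have : Real.smoothTransition =ᶠ[𝓝 x] fun _ => 1 := by
        filter_upwards [lt_mem_nhds hx] with y hy using Real.smoothTransition.one_of_one_le hy.le
      rw [this.deriv_eq]; simp
  obtain ⟨D₁, hD₁⟩ := hd.continuous.bounded_above_of_compact_support hc
  obtain ⟨D₂, hD₂⟩ := hd.lipschitzWith_of_hasCompactSupport hc one_ne_zero
  refine ⟨max 1 (max D₁ D₂), le_max_left _ _, fun x => ?_, fun x y => ?_⟩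
  · exact (hD₁ x).trans ((le_max_left _ _).trans (le_max_right _ _))
  · have := hD₂.dist_le_mul x y
    rw [Real.dist_eq, Real.dist_eq] at this
    refine this.trans ?_
    gcongr
    exact (le_max_right _ _).trans (le_max_right _ _)

theorem hasDerivAt_smoothTransition (x : ℝ) :
    HasDerivAt Real.smoothTransition (deriv Real.smoothTransition x) x :=
  ((Real.smoothTransition.contDiff (n := 1)).differentiable one_ne_zero x).hasDerivAt

section Cutoff

variable {E : Type*} [NormedAddCommGroup E] [NormedSpace ℝ E] {ι : Type*} [Fintype ι]

/-- The sum of transition functions along finitely many affine functions. -/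
def cutSum (L : ι → E →L[ℝ] ℝ) (b : ι → ℝ) (z : E) : ℝ :=
  ∑ j, Real.smoothTransition (L j z + b j)

/-- A smooth function that is one where all of the affine functions `L j + b j` are nonpositive and
zero where one of them is at least one. -/
def cutoff (L : ι → E →L[ℝ] ℝ) (b : ι → ℝ) (z : E) : ℝ :=
  Real.smoothTransition (1 - cutSum L b z)

/-- The derivative of `cutSum`. -/
def cutSumDeriv (L : ι → E →L[ℝ] ℝ) (b : ι → ℝ) (z : E) : E →L[ℝ] ℝ :=
  ∑ j, deriv Real.smoothTransition (L j z + b j) • L j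

theorem hasFDerivAt_cutSum (L : ι → E →L[ℝ] ℝ) (b : ι → ℝ) (z : E) :
    HasFDerivAt (cutSum L b) (cutSumDeriv L b z) z := by
  unfold cutSum cutSumDeriv
  refine HasFDerivAt.fun_sum fun j _ => ?_
  exact (hasDerivAt_smoothTransition _).comp_hasFDerivAt z ((L j).hasFDerivAt.add_const (b j))

theorem fderiv_cutoff (L : ι → E →L[ℝ] ℝ) (b : ι → ℝ) (z : E) :
    fderiv ℝ (cutoff L b) z =
      -(deriv Real.smoothTransition (1 - cutSum L b z) • cutSumDeriv L b z) := by
  have h : HasFDerivAt (cutoff L b) (deriv Real.smoothTransition (1 - cutSum L b z) •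
      (-cutSumDeriv L b z)) z :=
    (hasDerivAt_smoothTransition _).comp_hasFDerivAt z ((hasFDerivAt_cutSum L b z).const_sub 1)
  rw [h.fderiv, smul_neg]

theorem contDiff_cutoff (L : ι → E →L[ℝ] ℝ) (b : ι → ℝ) : ContDiff ℝ ∞ (cutoff L b) := by
  unfold cutoff cutSum
  refine Real.smoothTransition.contDiff.comp (contDiff_const.sub (ContDiff.sum fun j _ => ?_))
  exact Real.smoothTransition.contDiff.comp ((L j).contDiff.add contDiff_const)

theorem cutoff_eq_one {L : ι → E →L[ℝ] ℝ} {b : ι → ℝ} {z : E} (h : ∀ j, L j z + b j ≤ 0) :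
    cutoff L b z = 1 := by
  have : cutSum L b z = 0 :=
    Finset.sum_eq_zero fun j _ => Real.smoothTransition.zero_of_nonpos (h j)
  rw [cutoff, this, sub_zero, Real.smoothTransition.one]

theorem lt_one_of_cutoff_ne_zero {L : ι → E →L[ℝ] ℝ} {b : ι → ℝ} {z : E} (h : cutoff L b z ≠ 0)
    (j : ι) : L j z + b j < 1 := by
  by_contra hc
  push Not at hc
  refine h (Real.smoothTransition.zero_of_nonpos ?_)
  have h1 : Real.smoothTransition (L j z + b j) ≤ cutSum L b z :=
    Finset.single_le_sum (f := fun j => Real.smoothTransition (L j z + b j))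
      (fun _ _ => Real.smoothTransition.nonneg _) (Finset.mem_univ j)
  rw [Real.smoothTransition.one_of_one_le hc] at h1
  linarith

theorem norm_cutSumDeriv_le {D lam : ℝ} (hD : ∀ x, |deriv Real.smoothTransition x| ≤ D)
    {L : ι → E →L[ℝ] ℝ} {b : ι → ℝ} (hL : ∀ j, ‖L j‖ ≤ lam) (z : E) :
    ‖cutSumDeriv L b z‖ ≤ Fintype.card ι * (D * lam) := by
  have hD0 : 0 ≤ D := (abs_nonneg _).trans (hD 0)
  refine (norm_sum_le _ _).trans ?_
  rw [← nsmul_eq_mul, ← Finset.card_univ]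
  refine Finset.sum_le_card_nsmul _ _ _ fun j _ => ?_
  rw [norm_smul, Real.norm_eq_abs]
  exact mul_le_mul (hD _) (hL j) (norm_nonneg _) hD0

theorem norm_cutSumDeriv_sub_le {D lam : ℝ} (hD0 : 0 ≤ D)
    (hD : ∀ x y, |deriv Real.smoothTransition x - deriv Real.smoothTransition y| ≤ D * |x - y|)
    {L : ι → E →L[ℝ] ℝ} {b : ι → ℝ} (hL : ∀ j, ‖L j‖ ≤ lam) (x z : E) :
    ‖cutSumDeriv L b x - cutSumDeriv L b z‖ ≤ Fintype.card ι * (D * lam ^ 2 * ‖x - z‖) := by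
  rw [cutSumDeriv, cutSumDeriv, ← Finset.sum_sub_distrib]
  refine (norm_sum_le _ _).trans ?_
  rw [← nsmul_eq_mul, ← Finset.card_univ]
  refine Finset.sum_le_card_nsmul _ _ _ fun j _ => ?_
  have hlam : 0 ≤ lam := (norm_nonneg _).trans (hL j)
  have e : ∀ a c : ℝ, a • L j - c • L j = (a - c) • L j := fun a c => by module
  rw [e, norm_smul, Real.norm_eq_abs]
  have h1 : |L j x + b j - (L j z + b j)| ≤ lam * ‖x - z‖ := by
    rw [add_sub_add_right_eq_sub, ← map_sub]
    exact ((L j).le_opNorm _).trans (by gcongr; exact hL j)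
  calc _ ≤ (D * |L j x + b j - (L j z + b j)|) * lam := by
        gcongr
        · exact hD _ _
        · exact hL j
    _ ≤ (D * (lam * ‖x - z‖)) * lam := by gcongr
    _ = _ := by ring

theorem norm_fderiv_cutoff_le {D lam : ℝ} (hD : ∀ x, |deriv Real.smoothTransition x| ≤ D)
    {L : ι → E →L[ℝ] ℝ} {b : ι → ℝ} (hL : ∀ j, ‖L j‖ ≤ lam) (z : E) :
    ‖fderiv ℝ (cutoff L b) z‖ ≤ Fintype.card ι * D ^ 2 * lam := by
  have hD0 : 0 ≤ D := (abs_nonneg _).trans (hD 0)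
  rw [fderiv_cutoff, norm_neg, norm_smul, Real.norm_eq_abs]
  calc _ ≤ D * (Fintype.card ι * (D * lam)) := by
        gcongr
        · exact hD _
        · exact norm_cutSumDeriv_le hD hL z
    _ = _ := by ring

theorem norm_fderiv_cutoff_sub_le {D lam : ℝ} (hD1 : ∀ x, |deriv Real.smoothTransition x| ≤ D)
    (hD2 : ∀ x y, |deriv Real.smoothTransition x - deriv Real.smoothTransition y| ≤ D * |x - y|)
    {L : ι → E →L[ℝ] ℝ} {b : ι → ℝ} (hlam : 0 ≤ lam) (hL : ∀ j, ‖L j‖ ≤ lam) (x z : E) :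
    ‖fderiv ℝ (cutoff L b) x - fderiv ℝ (cutoff L b) z‖ ≤
      (Fintype.card ι ^ 2 * D ^ 3 + Fintype.card ι * D ^ 2) * lam ^ 2 * ‖x - z‖ := by
  have hD0 : 0 ≤ D := (abs_nonneg _).trans (hD1 0)
  set N : ℝ := (Fintype.card ι : ℝ)
  have hσ : |cutSum L b x - cutSum L b z| ≤ N * (D * lam) * ‖x - z‖ := by
    have := Convex.norm_image_sub_le_of_norm_hasFDerivWithin_le (f := cutSum L b)
      (f' := cutSumDeriv L b) (s := univ) (C := N * (D * lam)) (x := z) (y := x)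
      (fun y _ => (hasFDerivAt_cutSum L b y).hasFDerivWithinAt)
      (fun y _ => norm_cutSumDeriv_le hD1 hL y) convex_univ (mem_univ _) (mem_univ _)
    exact this
  set a := deriv Real.smoothTransition (1 - cutSum L b x)
  set a' := deriv Real.smoothTransition (1 - cutSum L b z)
  have ha : |a - a'| ≤ D * (N * (D * lam) * ‖x - z‖) := by
    refine (hD2 _ _).trans ?_
    gcongr
    rw [sub_sub_sub_cancel_left, abs_sub_comm]
    exact hσ
  have e : fderiv ℝ (cutoff L b) x - fderiv ℝ (cutoff L b) z =
      -((a - a') • cutSumDeriv L b x + a' • (cutSumDeriv L b x - cutSumDeriv L b z)) := by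
    rw [fderiv_cutoff, fderiv_cutoff]; module
  rw [e, norm_neg]
  refine (norm_add_le _ _).trans ?_
  rw [norm_smul, norm_smul, Real.norm_eq_abs, Real.norm_eq_abs]
  calc _ ≤ (D * (N * (D * lam) * ‖x - z‖)) * (N * (D * lam)) +
        D * (N * (D * lam ^ 2 * ‖x - z‖)) := by
        gcongr
        · exact norm_cutSumDeriv_le hD1 hL x
        · exact hD1 _
        · exact norm_cutSumDeriv_sub_le hD0 hD2 hL x z
    _ = _ := by ring

end Cutoff

/-- The coordinate functionals of `ℝ^d × ℝ`. -/
def coordFun (i : Option (Fin d)) : Rd1 d →L[ℝ] ℝ :=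
  match i with
  | none => ContinuousLinearMap.snd ℝ (Rd d) ℝ
  | some i => (EuclideanSpace.proj i).comp (ContinuousLinearMap.fst ℝ (Rd d) ℝ)

theorem norm_coordFun_le (i : Option (Fin d)) : ‖coordFun i‖ ≤ 1 := by
  refine ContinuousLinearMap.opNorm_le_bound _ zero_le_one fun z => ?_
  rw [one_mul]
  match i with
  | none => exact norm_snd_le z
  | some i => exact (PiLp.norm_apply_le z.1 i).trans (norm_fst_le z) 

/-- Only the slopes and offsets of the affine functions in `cutoff` depend on the box, so the
constant depends on `d` alone. The vertical transitions are still zero for `|t| ≤ R`, which makes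
the cutoff independent of the height there; on prisms over small elements it thus equals its trace.
-/
theorem exists_cutoff (d : ℕ) : ∃ C : ℝ, 1 ≤ C ∧ ∀ (c : Rd d) (R τ : ℝ), 0 < R → 0 < τ →
    ∃ η : Rd1 d → ℝ, ContDiff ℝ ∞ η ∧ HasCompactSupport η ∧ (∀ z, 0 ≤ η z) ∧ (∀ z, η z ≤ 1) ∧
      (∀ z ∈ box c R, η z = 1) ∧
      (∀ z, η z ≠ 0 → (∀ i, |z.1 i - c i| < R / 2 + τ / 4) ∧ |z.2| < R + τ / 4) ∧
      (∀ x t, |t| ≤ R → η (x, t) = η (x, 0)) ∧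
      (∀ z, ‖fderiv ℝ η z‖ ≤ C / τ) ∧
      ∀ x y, ‖fderiv ℝ η x - fderiv ℝ η y‖ ≤ C / τ ^ 2 * ‖x - y‖ := by
  obtain ⟨D, hD1, hDb, hDl⟩ := exists_smoothTransition_bound
  set N : ℝ := (Fintype.card (Bool × Option (Fin d)) : ℝ) with hN
  have hN1 : 1 ≤ N := by
    rw [hN]; exact_mod_cast Fintype.card_pos
  refine ⟨16 * (N ^ 2 * D ^ 3 + N * D ^ 2), ?_, fun c R τ hR hτ => ?_⟩
  · have h1 : 1 ≤ N ^ 2 * D ^ 3 := by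
      have := one_le_pow₀ (n := 2) hN1
      have := one_le_pow₀ (n := 3) hD1
      nlinarith
    have h2 : 0 ≤ N * D ^ 2 := by positivity
    linarith
  let sg : Bool → ℝ := fun b => if b then 1 else -1
  let ctr : Option (Fin d) → ℝ := fun i => i.elim 0 (fun i => c i)
  let rad : Option (Fin d) → ℝ := fun i => i.elim R (fun _ => R / 2)
  -- The index runs over both signs of every coordinate: `L j + b j` is the signed excess over the
  -- box, scaled so that the transition layer has width `τ / 4`.
  let L : Bool × Option (Fin d) → Rd1 d →L[ℝ] ℝ := fun j => (sg j.1 * (4 / τ)) • coordFun j.2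
  let b : Bool × Option (Fin d) → ℝ := fun j => (-sg j.1 * ctr j.2 - rad j.2) * (4 / τ)
  have hsg : ∀ q, |sg q| = 1 := fun q => by cases q <;> simp [sg]
  have hL : ∀ j, ‖L j‖ ≤ 4 / τ := by
    intro j
    simp only [L]
    rw [norm_smul, Real.norm_eq_abs, abs_mul, hsg, one_mul, abs_of_pos (by positivity)]
    exact mul_le_of_le_one_right (by positivity) (norm_coordFun_le _)
  have hLb : ∀ j z, L j z + b j = (sg j.1 * (coordFun j.2 z - ctr j.2) - rad j.2) * (4 / τ) := by
    intro j z
    simp only [L, b, smul_apply, smul_eq_mul]; ring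
  have hle : ∀ z, (∀ i, |coordFun i z - ctr i| ≤ rad i) → ∀ j, L j z + b j ≤ 0 := by
    intro z hz j
    rw [hLb]
    refine mul_nonpos_of_nonpos_of_nonneg ?_ (by positivity)
    have h1 := hz j.2
    have h2 : sg j.1 * (coordFun j.2 z - ctr j.2) ≤ |coordFun j.2 z - ctr j.2| := by
      refine (le_abs_self _).trans ?_
      rw [abs_mul, hsg, one_mul]
    linarith
  have hlt : ∀ z, cutoff L b z ≠ 0 → ∀ i, |coordFun i z - ctr i| < rad i + τ / 4 := by
    intro z hz i
    have h1 := lt_one_of_cutoff_ne_zero hz (true, i)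
    have h2 := lt_one_of_cutoff_ne_zero hz (false, i)
    rw [hLb, ← lt_div_iff₀ (by positivity)] at h1 h2
    simp only [sg, Bool.false_eq_true, if_true, if_false, one_div_div] at h1 h2
    rw [abs_lt]
    constructor <;> linarith
  have hsupp : ∀ z, cutoff L b z ≠ 0 →
      (∀ i, |z.1 i - c i| < R / 2 + τ / 4) ∧ |z.2| < R + τ / 4 := by
    intro z hz
    refine ⟨fun i => ?_, ?_⟩
    · simpa [coordFun, ctr, rad] using hlt z hz (some i)
    · simpa [coordFun, ctr, rad] using hlt z hz none
  refine ⟨cutoff L b, contDiff_cutoff L b, ?_, fun z => Real.smoothTransition.nonneg _,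
    fun z => Real.smoothTransition.le_one _, fun z hz => ?_, hsupp, fun x t ht => ?_, fun z => ?_,
    fun x y => ?_⟩
  · refine HasCompactSupport.of_support_subset_isCompact
      (K := (Metric.closedBall (0 : Rd d) (√ d * (‖c‖ + R / 2 + τ / 4))) ×ˢ
        Icc (-(R + τ / 4)) (R + τ / 4)) ((isCompact_closedBall _ _).prod isCompact_Icc) fun z hz => ?_
    obtain ⟨h1, h2⟩ := hsupp z hz
    refine ⟨?_, abs_le.1 h2.le⟩
    have hco : ∀ i, |z.1 i| ≤ ‖c‖ + R / 2 + τ / 4 := by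
      intro i
      have h3 := PiLp.norm_apply_le c i
      rw [Real.norm_eq_abs] at h3
      have h4 := abs_add_le (z.1 i - c i) (c i)
      rw [sub_add_cancel] at h4
      linarith [h1 i]
    rw [mem_closedBall_zero_iff, EuclideanSpace.norm_eq]
    have hpos : 0 ≤ ‖c‖ + R / 2 + τ / 4 := by positivity
    rw [← Real.sqrt_sq hpos, ← Real.sqrt_mul (by positivity)]
    refine Real.sqrt_le_sqrt ?_
    calc ∑ i, ‖z.1 i‖ ^ 2 ≤ ∑ _i : Fin d, (‖c‖ + R / 2 + τ / 4) ^ 2 := by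
          refine Finset.sum_le_sum fun i _ => ?_
          rw [Real.norm_eq_abs]
          exact pow_le_pow_left₀ (abs_nonneg _) (hco i) 2
      _ = _ := by simp
  · refine cutoff_eq_one (hle z fun i => ?_)
    match i with
    | none =>
      simp only [coordFun, ctr, rad, Option.elim, ContinuousLinearMap.coe_snd', sub_zero]
      rw [abs_of_pos hz.2.1]; exact hz.2.2.le
    | some i => simpa [coordFun, ctr, rad] using (hz.1 i).le
  · have hz : ∀ q, |t| ≤ R → Real.smoothTransition (L (q, none) (x, t) + b (q, none)) = 0 := by
      intro q ht
      refine Real.smoothTransition.zero_of_nonpos ?_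
      rw [hLb]
      refine mul_nonpos_of_nonpos_of_nonneg ?_ (by positivity)
      have h2 : sg q * t ≤ |t| := by
        refine (le_abs_self _).trans ?_
        rw [abs_mul, hsg, one_mul]
      simp only [coordFun, ctr, rad, Option.elim, ContinuousLinearMap.coe_snd', sub_zero]
      linarith
    have hz0 : ∀ q, Real.smoothTransition (L (q, none) (x, 0) + b (q, none)) = 0 := by
      intro q
      refine Real.smoothTransition.zero_of_nonpos ?_
      rw [hLb]
      refine mul_nonpos_of_nonpos_of_nonneg ?_ (by positivity)
      simp only [coordFun, ctr, rad, Option.elim, ContinuousLinearMap.coe_snd', sub_zero]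
      linarith
    have : cutSum L b (x, t) = cutSum L b (x, 0) := by
      refine Finset.sum_congr rfl fun j _ => ?_
      obtain ⟨q, i⟩ := j
      match i with
      | none => rw [hz q ht, hz0 q]
      | some i => rfl
    rw [cutoff, cutoff, this]
  · refine (norm_fderiv_cutoff_le hDb hL z).trans ?_
    rw [← hN, mul_div_assoc', div_le_div_iff_of_pos_right hτ]
    have : 0 ≤ N ^ 2 * D ^ 3 := by positivity
    have : 0 ≤ N * D ^ 2 := by positivity
    nlinarith
  · refine (norm_fderiv_cutoff_sub_le hDb hDl (by positivity) hL x y).trans (le_of_eq ?_)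
    rw [← hN]
    field_simp
    ring

/-! ### The profile of the lifting -/

/-- The model is `1 - (t/h)^(2s)`, since `t^(2s)` solves `(t^α u')' = 0`; a profile linear near zero
would not give bounds uniform in `s`. The model is smoothed by replacing `t²` with `t² + ε²` and
cutting off with the transition function, losing only a universal factor. -/
theorem exists_profile : ∃ D : ℝ, 1 ≤ D ∧ ∀ α ∈ Ioo (-1 : ℝ) 1, ∀ h : ℝ, 0 < h →
    ∃ χ : ℝ → ℝ, ContDiff ℝ ∞ χ ∧ χ 0 = 1 ∧ (∀ t, h ≤ |t| → χ t = 0) ∧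
      (∫⁻ t, ‖χ t‖ₑ ^ 2 ∂(wline α)) ≤ ENNReal.ofReal ((1 - α) / (1 + α) * h ^ (1 + α)) ∧
      (∫⁻ t, ‖deriv χ t‖ₑ ^ 2 ∂(wline α)) ≤
        ENNReal.ofReal (D * ((1 - α) / (1 + α) * h ^ (1 + α)) / h ^ 2) := by
  obtain ⟨D, hD1, hDb, -⟩ := exists_smoothTransition_bound
  refine ⟨32 * D ^ 2, by nlinarith, fun α hα h hh => ?_⟩
  obtain ⟨hα1, hα2⟩ := hα
  set s : ℝ := (1 - α) / 2 with hs
  have hs0 : 0 < s := by rw [hs]; linarith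
  have hs1 : s < 1 := by rw [hs]; linarith
  have hαs : α = 1 - 2 * s := by rw [hs]; ring
  -- Chosen so that `r 0 = 1 / 4`: the argument `2 - 4 r` of the transition is then exactly one at
  -- zero.
  set ε : ℝ := h * (1 / 4) ^ (1 / (2 * s)) with hε
  have hε0 : 0 < ε := by positivity
  set H : ℝ := h ^ (2 * s) with hH
  have hH0 : 0 < H := by positivity
  let r : ℝ → ℝ := fun t => (t ^ 2 + ε ^ 2) ^ s / H
  have hpos : ∀ t : ℝ, 0 < t ^ 2 + ε ^ 2 := fun t => by positivity
  let χ : ℝ → ℝ := fun t => Real.smoothTransition (2 - 4 * r t)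
  have hr : ContDiff ℝ ∞ r := by
    have h1 : ContDiff ℝ ∞ fun t : ℝ => t ^ 2 + ε ^ 2 := by fun_prop
    exact (h1.rpow_const_of_ne fun t => (hpos t).ne').div_const H
  have hrlow : ∀ t : ℝ, |t| ^ (2 * s) / H ≤ r t := by
    intro t
    simp only [r]
    gcongr
    rw [Real.rpow_mul (abs_nonneg t), Real.rpow_two, sq_abs]
    exact Real.rpow_le_rpow (sq_nonneg t) (by nlinarith [sq_nonneg ε]) hs0.le
  have hr0 : ∀ t, 0 ≤ r t := fun t => div_nonneg (Real.rpow_nonneg (hpos t).le _) hH0.le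
  have hχ0 : ∀ t, h ≤ |t| → χ t = 0 := by
    intro t ht
    refine Real.smoothTransition.zero_of_nonpos ?_
    have h1 : H ≤ |t| ^ (2 * s) := Real.rpow_le_rpow hh.le ht (by positivity)
    have h2 : 1 ≤ |t| ^ (2 * s) / H := (one_le_div hH0).2 h1
    linarith [hrlow t]
  have hχ1 : χ 0 = 1 := by
    refine Real.smoothTransition.one_of_one_le ?_
    have : r 0 = 1 / 4 := by
      simp only [r, hε, hH]
      rw [zero_pow two_ne_zero, zero_add, ← Real.rpow_two, ← Real.rpow_mul (by positivity),
        Real.mul_rpow hh.le (by positivity), ← Real.rpow_mul (by norm_num),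
        show 1 / (2 * s) * (2 * s) = 1 by field_simp, Real.rpow_one]
      field_simp
    rw [this]; norm_num
  have hderiv : ∀ t, HasDerivAt χ (deriv Real.smoothTransition (2 - 4 * r t) *
      (-(4 * (2 * t * s * (t ^ 2 + ε ^ 2) ^ (s - 1) / H)))) t := by
    intro t
    have h1 : HasDerivAt (fun t : ℝ => t ^ 2 + ε ^ 2) (2 * t) t := by
      simpa using (hasDerivAt_pow 2 t).add_const (ε ^ 2)
    have h2 := ((h1.rpow_const (p := s) (Or.inl (hpos t).ne')).div_const H).const_mul 4
    exact (hasDerivAt_smoothTransition _).comp t (h2.const_sub 2)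
  have hcont : ContDiff ℝ ∞ χ :=
    Real.smoothTransition.contDiff.comp (contDiff_const.sub (contDiff_const.mul hr))
  have hdbound : ∀ t : ℝ, 0 < t → |deriv χ t| ≤ D * (8 * s * t ^ (2 * s - 1) / H) := by
    intro t ht
    rw [(hderiv t).deriv, abs_mul]
    refine mul_le_mul (hDb _) ?_ (abs_nonneg _) (by linarith)
    rw [abs_neg, abs_of_nonneg (mul_nonneg (by norm_num) (div_nonneg (mul_nonneg (by positivity)
      (Real.rpow_nonneg (hpos t).le _)) hH0.le)), mul_div_assoc']
    refine div_le_div_of_nonneg_right ?_ hH0.le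
    -- Since `s < 1`, removing `ε` enlarges the power; the smoothing costs nothing in the derivative
    -- bound.
    have h1 : (t ^ 2 + ε ^ 2) ^ (s - 1) ≤ (t ^ 2) ^ (s - 1) :=
      Real.rpow_le_rpow_of_nonpos (by positivity) (by nlinarith [sq_nonneg ε]) (by linarith)
    have h2 : t * (t ^ 2) ^ (s - 1) = t ^ (2 * s - 1) := by
      rw [← Real.rpow_two, ← Real.rpow_mul ht.le]
      nth_rewrite 1 [← Real.rpow_one t]
      rw [← Real.rpow_add ht]; congr 1; ring
    calc 4 * (2 * t * s * (t ^ 2 + ε ^ 2) ^ (s - 1)) ≤ 4 * (2 * t * s * (t ^ 2) ^ (s - 1)) := by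
          gcongr
      _ = 8 * s * (t * (t ^ 2) ^ (s - 1)) := by ring
      _ = _ := by rw [h2]
  have hd0 : ∀ t, h < t → deriv χ t = 0 := by
    intro t ht
    have : χ =ᶠ[𝓝 t] fun _ => 0 := by
      filter_upwards [lt_mem_nhds ht] with y hy using hχ0 y (hy.le.trans (le_abs_self y))
    rw [this.deriv_eq]; simp
  have hred : ∀ f : ℝ → ℝ, Measurable f → (∀ t, h < t → f t = 0) →
      ∫⁻ t, ‖f t‖ₑ ^ 2 ∂(wline α) ≤ ∫⁻ t in Ioo 0 h, ENNReal.ofReal (t ^ α * f t ^ 2) := by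
    intro f hf hf0
    unfold wline
    rw [lintegral_withDensity_eq_lintegral_mul _ (measurable_weight α) (by fun_prop)]
    have hle : ∫⁻ t in Ioo 0 h, ENNReal.ofReal (t ^ α * f t ^ 2) =
        ∫⁻ t in Ioc 0 h, ENNReal.ofReal (t ^ α * f t ^ 2) := by
      rw [restrict_Ioo_eq_restrict_Ioc]
    rw [hle, ← lintegral_indicator measurableSet_Ioi, ← lintegral_indicator measurableSet_Ioc]
    refine lintegral_mono fun t => ?_
    by_cases ht : t ∈ Ioi (0 : ℝ)
    · rw [indicator_of_mem ht]
      by_cases hth : t ≤ h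
      · rw [indicator_of_mem (show t ∈ Ioc 0 h from ⟨ht, hth⟩), Pi.mul_apply, ← ofReal_norm,
          ← ENNReal.ofReal_pow (norm_nonneg _), ← ENNReal.ofReal_mul (Real.rpow_nonneg (le_of_lt ht) _),
          Real.norm_eq_abs, sq_abs]
      · simp [hf0 t (not_le.1 hth)]
    · rw [indicator_of_notMem ht]; exact zero_le
  have hk : (1 - α) / (1 + α) * h ^ (1 + α) = s / (1 - s) * h ^ (2 - 2 * s) := by
    rw [hαs, show 1 - (1 - 2 * s) = 2 * s by ring, show 1 + (1 - 2 * s) = 2 * (1 - s) by ring,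
      mul_div_mul_left _ _ (two_ne_zero), show 2 * (1 - s) = 2 - 2 * s by ring]
  have h1s : 0 < 1 - s := by linarith
  refine ⟨χ, hcont, hχ1, hχ0, ?_, ?_⟩
  · refine (hred χ hcont.continuous.measurable fun t ht => hχ0 t (ht.le.trans (le_abs_self t))).trans ?_
    -- Comparison with twice the model profile: where `χ` is not zero, `r ≤ 1/2` and the doubled
    -- model is at least one. Its weighted integral is exactly `s / (1 - s) * h ^ (2 - 2 * s)`, so
    -- the small factor `s` is retained.
    have hb : ∀ t ∈ Ioo 0 h, t ^ α * χ t ^ 2 ≤ 2 * (t ^ α - H⁻¹ * t ^ (1 : ℝ)) := by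
      intro t ht
      have hta : 0 ≤ t ^ α := Real.rpow_nonneg ht.1.le _
      have h1 : χ t ≤ 2 * (1 - t ^ (2 * s) / H) := by
        have hrl := hrlow t
        rw [abs_of_pos ht.1] at hrl
        have h3 : t ^ (2 * s) / H ≤ 1 :=
          (div_le_one hH0).2 (Real.rpow_le_rpow ht.1.le ht.2.le (by positivity))
        by_cases hc : r t ≤ 1 / 2
        · have : χ t ≤ 1 := Real.smoothTransition.le_one _
          linarith
        · have : χ t = 0 := Real.smoothTransition.zero_of_nonpos (by linarith)
          linarith
      have h2 : χ t ^ 2 ≤ χ t := by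
        have h0 : 0 ≤ χ t := Real.smoothTransition.nonneg _
        have h1 : χ t ≤ 1 := Real.smoothTransition.le_one _
        nlinarith
      have h3 : t ^ α * t ^ (2 * s) = t ^ (1 : ℝ) := by
        rw [← Real.rpow_add ht.1, hαs]; congr 1; ring
      calc t ^ α * χ t ^ 2 ≤ t ^ α * (2 * (1 - t ^ (2 * s) / H)) :=
            mul_le_mul_of_nonneg_left (h2.trans h1) hta
        _ = _ := by rw [← h3]; field_simp
    have hnn : ∀ t ∈ Ioo 0 h, 0 ≤ t ^ α - H⁻¹ * t ^ (1 : ℝ) := fun t ht => by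
      have h1 := hb t ht
      have h2 : 0 ≤ t ^ α * χ t ^ 2 := mul_nonneg (Real.rpow_nonneg ht.1.le _) (sq_nonneg _)
      linarith
    calc ∫⁻ t in Ioo 0 h, ENNReal.ofReal (t ^ α * χ t ^ 2)
        ≤ ∫⁻ t in Ioo 0 h, ENNReal.ofReal 2 * ENNReal.ofReal (t ^ α - H⁻¹ * t ^ (1 : ℝ)) := by
          refine setLIntegral_mono' measurableSet_Ioo fun t ht => ?_
          rw [← ENNReal.ofReal_mul (by norm_num)]
          exact ENNReal.ofReal_le_ofReal (hb t ht)
      _ = _ := by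
          rw [lintegral_const_mul' _ _ ENNReal.ofReal_ne_top,
            setLIntegral_Ioo_rpow_sub hα1 (by norm_num) hh hnn, ← ENNReal.ofReal_mul (by norm_num),
            hk]
          congr 1
          have h3 : h ^ (1 + 1 : ℝ) = h ^ (2 - 2 * s) * H := by
            rw [hH, ← Real.rpow_add hh]; congr 1; ring
          rw [h3, hαs, show 1 - 2 * s + 1 = 2 - 2 * s by ring]
          have : 2 - 2 * s ≠ 0 := by linarith
          field_simp
          ring
  · refine (hred _ (hcont.continuous_deriv (by simp)).measurable hd0).trans ?_
    have hb : ∀ t ∈ Ioo 0 h, t ^ α * deriv χ t ^ 2 ≤ (64 * D ^ 2 * s ^ 2 / H ^ 2) * t ^ (2 * s - 1) := by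
      intro t ht
      have hta : 0 ≤ t ^ α := Real.rpow_nonneg ht.1.le _
      have h1 : deriv χ t ^ 2 ≤ (D * (8 * s * t ^ (2 * s - 1) / H)) ^ 2 := by
        rw [← sq_abs]; exact pow_le_pow_left₀ (abs_nonneg _) (hdbound t ht.1) 2
      have h3 : t ^ α * (t ^ (2 * s - 1) * t ^ (2 * s - 1)) = t ^ (2 * s - 1) := by
        rw [← Real.rpow_add ht.1, ← Real.rpow_add ht.1, hαs]; congr 1; ring
      calc t ^ α * deriv χ t ^ 2 ≤ t ^ α * (D * (8 * s * t ^ (2 * s - 1) / H)) ^ 2 :=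
            mul_le_mul_of_nonneg_left h1 hta
        _ = (64 * D ^ 2 * s ^ 2 / H ^ 2) * (t ^ α * (t ^ (2 * s - 1) * t ^ (2 * s - 1))) := by
            field_simp; ring
        _ = _ := by rw [h3]
    calc ∫⁻ t in Ioo 0 h, ENNReal.ofReal (t ^ α * deriv χ t ^ 2)
        ≤ ∫⁻ t in Ioo 0 h, ENNReal.ofReal (64 * D ^ 2 * s ^ 2 / H ^ 2) *
            ENNReal.ofReal (t ^ (2 * s - 1)) := by
          refine setLIntegral_mono' measurableSet_Ioo fun t ht => ?_
          rw [← ENNReal.ofReal_mul (by positivity)]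
          exact ENNReal.ofReal_le_ofReal (hb t ht)
      _ ≤ _ := by
          rw [lintegral_const_mul' _ _ ENNReal.ofReal_ne_top,
            setLIntegral_Ioo_rpow (by linarith) hh, ← ENNReal.ofReal_mul (by positivity), hk]
          refine ENNReal.ofReal_le_ofReal ?_
          have h3 : h ^ (2 - 2 * s) = h ^ 2 / H := by
            rw [hH, Real.rpow_sub hh, Real.rpow_two]
          rw [show 2 * s - 1 + 1 = 2 * s by ring, ← hH, h3]
          have e1 : 64 * D ^ 2 * s ^ 2 / H ^ 2 * (H / (2 * s)) = 32 * D ^ 2 * s / H := by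
            field_simp; ring
          have e2 : 32 * D ^ 2 * (s / (1 - s) * (h ^ 2 / H)) / h ^ 2 =
              32 * D ^ 2 * s / H * (1 / (1 - s)) := by field_simp
          rw [e1, e2]
          refine le_mul_of_one_le_right (by positivity) ?_
          rw [le_div_iff₀ h1s]; linarith

/-! ### Interpolation error and inverse estimates on one element -/

theorem abs_mul_sub_mul_le {a b a' b' A B LA LB δ : ℝ} (ha : |a| ≤ A) (hb : |b'| ≤ B)
    (h1 : |a - a'| ≤ LA * δ) (h2 : |b - b'| ≤ LB * δ) :
    |a * b - a' * b'| ≤ (A * LB + LA * B) * δ := by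
  have e : a * b - a' * b' = a * (b - b') + (a - a') * b' := by ring
  rw [e]
  refine (abs_add_le _ _).trans ?_
  rw [abs_mul, abs_mul]
  have hA : 0 ≤ A := (abs_nonneg _).trans ha
  have h3 : |a| * |b - b'| ≤ A * (LB * δ) := mul_le_mul ha h2 (abs_nonneg _) hA
  have h4 : |a - a'| * |b'| ≤ LA * δ * B :=
    mul_le_mul h1 hb (abs_nonneg _) ((abs_nonneg _).trans h1)
  linarith

/-- The interpolation error of the product of `m` with an affine function on a simplex, in terms of
the first order Taylor expansion of `m`. -/
theorem interp_error_le {s : Finset (Rd d)} (hs : IsSimplex s) {z : Rd d}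
    (hz : z ∈ convexHull ℝ (s : Set (Rd d))) {H Γ M P : ℝ} (hH0 : 0 < H)
    (hH : Metric.diam (convexHull ℝ (s : Set (Rd d))) ≤ H)
    (hΓ : ∀ v, ‖affGrad (bary s v)‖ * H ≤ Γ) (hM : 0 ≤ M) (hP : 0 ≤ P)
    {m : Rd d → ℝ} {p : Rd d →L[ℝ] ℝ} (hp : ‖p‖ ≤ P)
    (hρ : ∀ x ∈ convexHull ℝ (s : Set (Rd d)), |m x - m z - p (x - z)| ≤ M * H ^ 2)
    (hρl : ∀ x ∈ convexHull ℝ (s : Set (Rd d)), ∀ y ∈ convexHull ℝ (s : Set (Rd d)),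
      |(m x - m z - p (x - z)) - (m y - m z - p (y - z))| ≤ M * H * ‖x - y‖)
    (A : Rd d →ᵃ[ℝ] ℝ) :
    (∀ x ∈ convexHull ℝ (s : Set (Rd d)), |m x * A x - ∑ v ∈ s, bary s v x * (m v * A v)| ≤
      (2 + (d + 1) * Γ) * H ^ 2 * (M * (|A z| + H * ‖affGrad A‖) + P * ‖affGrad A‖)) ∧
    ∀ x ∈ convexHull ℝ (s : Set (Rd d)), ∀ y ∈ convexHull ℝ (s : Set (Rd d)),
      |(m x * A x - ∑ v ∈ s, bary s v x * (m v * A v)) -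
        (m y * A y - ∑ v ∈ s, bary s v y * (m v * A v))| ≤
      (2 + (d + 1) * Γ) * H * (M * (|A z| + H * ‖affGrad A‖) + P * ‖affGrad A‖) * ‖x - y‖ := by
  set K := convexHull ℝ (s : Set (Rd d)) with hK
  set G := ‖affGrad A‖ with hG
  have hG0 : 0 ≤ G := norm_nonneg _
  set B := |A z| + H * G with hB
  have hB0 : 0 ≤ B := by positivity
  set q := M * B + P * G with hq
  have hq0 : 0 ≤ q := by positivity
  set ρ : Rd d → ℝ := fun x => m x - m z - p (x - z) with hρdef
  set r : Rd d → ℝ := fun x => ρ x * A x + p (x - z) * (A x - A z) with hr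
  have hd1 : ∀ x ∈ K, ∀ y ∈ K, ‖x - y‖ ≤ H := fun x hx y hy => (norm_sub_le_diam hx hy).trans hH
  have hAl : ∀ x y, |A x - A y| ≤ G * ‖x - y‖ := abs_affine_sub_le A
  have hA1 : ∀ x ∈ K, |A x - A z| ≤ G * H := fun x hx =>
    (hAl x z).trans (by gcongr; exact hd1 x hx z hz)
  have hA : ∀ x ∈ K, |A x| ≤ B := fun x hx => by
    have h1 := abs_add_le (A x - A z) (A z)
    rw [sub_add_cancel] at h1
    rw [hB]; linarith [hA1 x hx]
  have hpx : ∀ x ∈ K, |p (x - z)| ≤ P * H := fun x hx => by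
    refine (p.le_opNorm _).trans ?_
    exact mul_le_mul hp (hd1 x hx z hz) (norm_nonneg _) hP
  have hpl : ∀ x y, |p (x - z) - p (y - z)| ≤ P * ‖x - y‖ := fun x y => by
    rw [← map_sub, sub_sub_sub_cancel_right]
    exact (p.le_opNorm _).trans (by gcongr)
  have hrb : ∀ x ∈ K, |r x| ≤ H ^ 2 * q := by
    intro x hx
    refine (abs_add_le _ _).trans ?_
    rw [abs_mul, abs_mul]
    have h1 : |ρ x| * |A x| ≤ M * H ^ 2 * B :=
      mul_le_mul (hρ x hx) (hA x hx) (abs_nonneg _) (by positivity)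
    have h2 : |p (x - z)| * |A x - A z| ≤ P * H * (G * H) :=
      mul_le_mul (hpx x hx) (hA1 x hx) (abs_nonneg _) (by positivity)
    rw [hq]; linarith
  have hrl : ∀ x ∈ K, ∀ y ∈ K, |r x - r y| ≤ 2 * H * q * ‖x - y‖ := by
    intro x hx y hy
    have h1 := abs_mul_sub_mul_le (hρ x hx) (hA y hy) (hρl x hx y hy) (hAl x y)
    have h2 := abs_mul_sub_mul_le (b := A x - A z) (b' := A y - A z) (LB := G) (hpx x hx) (hA1 y hy)
      (hpl x y) (by rw [sub_sub_sub_cancel_right]; exact hAl x y)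
    have e : r x - r y = (ρ x * A x - ρ y * A y) +
      (p (x - z) * (A x - A z) - p (y - z) * (A y - A z)) := by simp only [hr]; ring
    rw [e]
    refine (abs_add_le _ _).trans ((add_le_add h1 h2).trans ?_)
    rw [← add_mul]
    refine mul_le_mul_of_nonneg_right ?_ (norm_nonneg _)
    have h3 : M * H * (H * G) ≤ M * H * B := by
      gcongr; rw [hB]; linarith [abs_nonneg (A z)]
    rw [hq]; nlinarith
  -- the nodal interpolation only sees the remainder
  let pl : Rd d →ᵃ[ℝ] ℝ := (p : Rd d →ₗ[ℝ] ℝ).toAffineMap - AffineMap.const ℝ _ (p z)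
  have hpl' : ∀ x, pl x = p (x - z) := fun x => by simp [pl]
  let Q : Rd d →ᵃ[ℝ] ℝ := m z • A + A z • pl
  have hQ : ∀ x, m x * A x = r x + Q x := fun x => by
    have : Q x = m z * A x + A z * p (x - z) := by simp [Q, hpl']
    rw [this]; simp only [hr, hρdef]; ring
  have he : ∀ x, m x * A x - ∑ v ∈ s, bary s v x * (m v * A v) =
      r x - ∑ v ∈ s, bary s v x * r v := by
    intro x
    simp_rw [hQ, mul_add, Finset.sum_add_distrib]
    rw [← affine_eq_sum_bary hs Q x]; ring
  have hvK : ∀ v ∈ s, v ∈ K := fun v hv => subset_convexHull ℝ _ hv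
  have hΓ0 : 0 ≤ Γ := (mul_nonneg (norm_nonneg _) hH0.le).trans (hΓ 0)
  have hd0 : (0 : ℝ) ≤ d := Nat.cast_nonneg d
  constructor
  · intro x hx
    rw [he]
    have h1 : |∑ v ∈ s, bary s v x * r v| ≤ H ^ 2 * q := by
      calc |∑ v ∈ s, bary s v x * r v| ≤ ∑ v ∈ s, |bary s v x * r v| := Finset.abs_sum_le_sum_abs _ _
        _ ≤ ∑ v ∈ s, bary s v x * (H ^ 2 * q) := by
            refine Finset.sum_le_sum fun v hv => ?_
            rw [abs_mul, abs_of_nonneg (bary_nonneg hs hx v)]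
            exact mul_le_mul_of_nonneg_left (hrb v (hvK v hv)) (bary_nonneg hs hx v)
        _ = H ^ 2 * q := by rw [← Finset.sum_mul, sum_bary hs, one_mul]
    refine (abs_sub _ _).trans ?_
    have h2 : 0 ≤ (d + 1) * Γ * (H ^ 2 * q) := by positivity
    nlinarith [hrb x hx]
  · intro x hx y hy
    rw [he, he]
    have h1 : |∑ v ∈ s, bary s v x * r v - ∑ v ∈ s, bary s v y * r v| ≤
        (d + 1) * Γ * H * q * ‖x - y‖ := by
      rw [← Finset.sum_sub_distrib]
      calc _ ≤ ∑ v ∈ s, |bary s v x * r v - bary s v y * r v| := Finset.abs_sum_le_sum_abs _ _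
        _ ≤ ∑ _v ∈ s, Γ * H * q * ‖x - y‖ := by
            refine Finset.sum_le_sum fun v hv => ?_
            rw [← sub_mul, abs_mul]
            calc _ ≤ (‖affGrad (bary s v)‖ * ‖x - y‖) * (H ^ 2 * q) := by
                  gcongr
                  · exact abs_affine_sub_le _ x y
                  · exact hrb v (hvK v hv)
              _ = (‖affGrad (bary s v)‖ * H) * (H * q * ‖x - y‖) := by ring
              _ ≤ Γ * (H * q * ‖x - y‖) := by gcongr; exact hΓ v
              _ = _ := by ring
        _ = _ := by
            rw [Finset.sum_const, hs.card_eq, nsmul_eq_mul]; push_cast; ring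
    have e : r x - ∑ v ∈ s, bary s v x * r v - (r y - ∑ v ∈ s, bary s v y * r v) =
      (r x - r y) - (∑ v ∈ s, bary s v x * r v - ∑ v ∈ s, bary s v y * r v) := by ring
    rw [e]
    refine (abs_sub _ _).trans ?_
    have := hrl x hx y hy
    nlinarith

theorem isBounded_hull (s : Finset (Rd d)) : Bornology.IsBounded (convexHull ℝ (s : Set (Rd d))) :=
  (isCompact_hull s).isBounded

theorem measurableSet_hull (s : Finset (Rd d)) : MeasurableSet (convexHull ℝ (s : Set (Rd d))) :=
  (isCompact_hull s).isClosed.measurableSet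

theorem lintegral_sq_ne_top {X E : Type*} [MeasurableSpace X] [NormedAddCommGroup E] {f : X → E}
    {μ : Measure X} (hf : MemLp f 2 μ) : ∫⁻ x, ‖f x‖ₑ ^ 2 ∂μ ≠ ⊤ := by
  rw [← eLpNorm_two_sq]; exact ENNReal.pow_ne_top hf.eLpNorm_ne_top

/-- The inverse estimate for the gradient of an affine trace. -/
theorem inverse_estimate_grad {α : ℝ} (hα : α ∈ Ioo (-1 : ℝ) 1) {w : BeppoLevi d α} {g : Rd d → ℝ}
    (hg : Continuous g) (ht : HasTrace w g) {s : Finset (Rd d)} (hs : IsSimplex s)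
    {H Γ : ℝ} (hH0 : 0 < H) (hΓ1 : 1 ≤ Γ) (hΓ : ∀ v, ‖affGrad (bary s v)‖ * H ≤ Γ)
    (A : Rd d →ᵃ[ℝ] ℝ) (hA : EqOn g A (convexHull ℝ (s : Set (Rd d)))) :
    (1 - α) / (1 + α) * H ^ (1 + α) * ‖affGrad A‖ ^ 2 *
        volume.real (convexHull ℝ (s : Set (Rd d))) ≤
      32 * 2 ^ d * (d + 1) ^ 2 * Γ ^ 2 *
        (∫⁻ z in convexHull ℝ (s : Set (Rd d)) ×ˢ Ioo 0 H, ‖w.grad z‖ₑ ^ 2 ∂(wvol d α)).toReal := by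
  set K := convexHull ℝ (s : Set (Rd d)) with hK
  set G := ‖affGrad A‖ with hG
  set AK := ∫⁻ z in K ×ˢ Ioo 0 H, ‖w.grad z‖ₑ ^ 2 ∂(wvol d α) with hAK
  have hAKf : AK ≠ ⊤ := lintegral_sq_ne_top (w.memLp_grad.restrict _)
  by_cases hG0 : G = 0
  · rw [hG0]; simp; positivity
  have hGpos : 0 < G := lt_of_le_of_ne (norm_nonneg _) (Ne.symm hG0)
  set k := (1 - α) / (1 + α) * H ^ (1 + α) with hk
  have hk0 : 0 ≤ k := by
    have h1 : 0 < 1 - α := by linarith [hα.2]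
    have h2 : 0 < 1 + α := by linarith [hα.1]
    positivity
  -- The step length for which `halfHull_add_mem` keeps the shifted half-size simplex inside the
  -- element.
  set a := H / (2 * (d + 1) * Γ) with ha
  have ha0 : 0 < a := by positivity
  have haH : a ≤ H := by
    rw [ha, div_le_iff₀ (by positivity)]
    have : (1 : ℝ) ≤ 2 * (d + 1) * Γ := by
      have : (0 : ℝ) ≤ d := Nat.cast_nonneg d
      nlinarith
    nlinarith
  -- Shifting along the gradient changes the affine trace by the constant `a * G`, so the trace
  -- difference estimate directly bounds `G`.
  set y : Rd d := (a / G) • affGrad A with hy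
  have hyn : ‖y‖ = a := by
    rw [hy, norm_smul, Real.norm_eq_abs, abs_of_pos (by positivity), ← hG]; field_simp
  have hN : ∀ v, ‖affGrad (bary s v)‖ ≤ Γ / H := fun v => (le_div_iff₀ hH0).2 (hΓ v)
  have hmem := halfHull_add_mem hs (N := Γ / H) (by positivity) hN (y := y) (by
    rw [hyn, ha]; apply le_of_eq; field_simp)
  have h1 := ht.trace_difference hα hH0 hg (isBounded_hull s) (measurableSet_hull s) hmem
  have hconst : ∫⁻ x in halfHull s, ‖g (x + y) - g x‖ₑ ^ 2 =
      ENNReal.ofReal ((a * G) ^ 2) * volume (halfHull s) := by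
    rw [← setLIntegral_const]
    have hms : MeasurableSet (halfHull s) := by
      have : IsCompact (halfHull s) := by
        refine (isCompact_hull s).image ?_
        exact AffineMap.continuous_of_finiteDimensional _
      exact this.isClosed.measurableSet
    refine setLIntegral_congr_fun hms fun x hx => ?_
    have hx1 : x + y ∈ K := by simpa using hmem x hx 1 (by simp)
    have hx0 : x ∈ K := by simpa using hmem x hx 0 (by simp)
    have e : g (x + y) - g x = a * G := by
      rw [hA hx1, hA hx0, ← inner_affGrad, add_sub_cancel_left, hy, real_inner_smul_right,
        real_inner_self_eq_norm_sq, ← hG]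
      field_simp
    rw [e, ← ofReal_norm, Real.norm_eq_abs, abs_of_nonneg (by positivity),
      ENNReal.ofReal_pow (by positivity)]
  rw [hconst, volume_halfHull, hyn] at h1
  have h2 := ENNReal.toReal_mono (ENNReal.mul_ne_top ENNReal.ofReal_ne_top hAKf) h1
  simp only [ENNReal.toReal_mul] at h2
  rw [ENNReal.toReal_ofReal hk0, ENNReal.toReal_ofReal (by positivity),
    ENNReal.toReal_ofReal (by positivity), ENNReal.toReal_ofReal (by positivity)] at h2
  change k * ((a * G) ^ 2 * ((1 / 2) ^ d * volume.real K)) ≤ _ at h2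
  have hA0 : 0 ≤ AK.toReal := ENNReal.toReal_nonneg
  have h3 : k * ((a * G) ^ 2 * ((1 / 2) ^ d * volume.real K)) ≤ 8 * H ^ 2 * AK.toReal := by
    refine h2.trans ?_
    gcongr
    nlinarith
  have e2 : k * ((a * G) ^ 2 * ((1 / 2) ^ d * volume.real K)) =
      (k * G ^ 2 * volume.real K) * (H ^ 2 / (4 * 2 ^ d * (d + 1) ^ 2 * Γ ^ 2)) := by
    rw [ha, one_div, inv_pow]; field_simp; ring
  rw [e2, mul_div_assoc', div_le_iff₀ (by positivity)] at h3
  have hH2 : 0 < H ^ 2 := by positivity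
  refine le_of_mul_le_mul_right (h3.trans (le_of_eq ?_)) hH2
  ring

/-- The inverse estimate for the point values of an affine trace. -/
theorem inverse_estimate_value {α : ℝ} (hα : α ∈ Ioo (-1 : ℝ) 1) {w : BeppoLevi d α} {g : Rd d → ℝ}
    (hg : Continuous g) (ht : HasTrace w g) {s : Finset (Rd d)} (hs : IsSimplex s)
    {H Γ : ℝ} (hH0 : 0 < H) (hH : Metric.diam (convexHull ℝ (s : Set (Rd d))) ≤ H)
    (hΓ1 : 1 ≤ Γ) (hΓ : ∀ v, ‖affGrad (bary s v)‖ * H ≤ Γ)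
    (A : Rd d →ᵃ[ℝ] ℝ) (hA : EqOn g A (convexHull ℝ (s : Set (Rd d)))) {z : Rd d}
    (hz : z ∈ convexHull ℝ (s : Set (Rd d))) :
    (1 - α) / (1 + α) * H ^ (1 + α) * |A z| ^ 2 *
        volume.real (convexHull ℝ (s : Set (Rd d))) ≤
      8 * (∫⁻ z in convexHull ℝ (s : Set (Rd d)) ×ˢ Ioo 0 H, ‖w.toFun z‖ₑ ^ 2 ∂(wvol d α)).toReal +
      66 * 2 ^ d * (d + 1) ^ 2 * Γ ^ 2 * H ^ 2 *
        (∫⁻ z in convexHull ℝ (s : Set (Rd d)) ×ˢ Ioo 0 H, ‖w.grad z‖ₑ ^ 2 ∂(wvol d α)).toReal := by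
  have hI2 := inverse_estimate_grad hα hg ht hs hH0 hΓ1 hΓ A hA
  set K := convexHull ℝ (s : Set (Rd d)) with hK
  set G := ‖affGrad A‖ with hG
  set AK := ∫⁻ z in K ×ˢ Ioo 0 H, ‖w.grad z‖ₑ ^ 2 ∂(wvol d α) with hAK
  have hAKf : AK ≠ ⊤ := lintegral_sq_ne_top (w.memLp_grad.restrict _)
  have hb : Bornology.IsBounded (K ×ˢ Ioo 0 H) := (isBounded_hull s).prod (Metric.isBounded_Ioo 0 H)
  set WK := ∫⁻ z in K ×ˢ Ioo 0 H, ‖w.toFun z‖ₑ ^ 2 ∂(wvol d α) with hWK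
  have hWKf : WK ≠ ⊤ := lintegral_sq_ne_top (ht.memLp_restrict hα.1 hb)
  set k := (1 - α) / (1 + α) * H ^ (1 + α) with hk
  have hk0 : 0 ≤ k := by
    have h1 : 0 < 1 - α := by linarith [hα.2]
    have h2 : 0 < 1 + α := by linarith [hα.1]
    positivity
  have hVf : volume K ≠ ⊤ := (isBounded_hull s).measure_lt_top.ne
  have h1 := ht.trace_inequality hα hH0 hg (isBounded_hull s)
  -- The value at `z` differs from any other value on the element by at most `H * G`. Averaging over
  -- the element reduces the claim to the trace inequality and the gradient estimate `hI2`.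
  have h2 : ENNReal.ofReal (|A z| ^ 2) * volume K ≤
      2 * (∫⁻ x in K, ‖g x‖ₑ ^ 2) + ENNReal.ofReal (2 * H ^ 2 * G ^ 2) * volume K := by
    rw [← setLIntegral_const, ← setLIntegral_const, ← lintegral_const_mul' _ _ (by norm_num),
      ← lintegral_add_right _ measurable_const]
    refine setLIntegral_mono' (measurableSet_hull s) fun x hx => ?_
    rw [← ofReal_norm, ← ENNReal.ofReal_pow (norm_nonneg _)]
    have e2 (r : ℝ) : 2 * ENNReal.ofReal r = ENNReal.ofReal (2 * r) := by
      rw [ENNReal.ofReal_mul (by norm_num), ENNReal.ofReal_ofNat]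
    rw [e2, ← ENNReal.ofReal_add (by positivity) (by positivity)]
    refine ENNReal.ofReal_le_ofReal ?_
    have h3 : |A z| ≤ |A x| + H * G := by
      have h4 := abs_add_le (A z - A x) (A x)
      rw [sub_add_cancel] at h4
      have h5 := (abs_affine_sub_le A z x).trans
        (mul_le_mul_of_nonneg_left ((norm_sub_le_diam hz hx).trans hH) (norm_nonneg _))
      linarith
    rw [hA hx, Real.norm_eq_abs]
    have h0 : 0 ≤ H * G := by positivity
    calc |A z| ^ 2 ≤ (|A x| + H * G) ^ 2 := pow_le_pow_left₀ (abs_nonneg _) h3 2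
      _ ≤ _ := by nlinarith [sq_nonneg (|A x| - H * G)]
  have h1f : ENNReal.ofReal k * (∫⁻ x in K, ‖g x‖ₑ ^ 2) ≠ ⊤ := by
    refine ENNReal.mul_ne_top ENNReal.ofReal_ne_top (lintegral_sq_ne_top ?_)
    exact memLp_of_continuous hg (isBounded_hull s) hVf.lt_top
  have h3 : ENNReal.ofReal k * (ENNReal.ofReal (|A z| ^ 2) * volume K) ≤
      2 * (4 * WK + ENNReal.ofReal (H ^ 2) * AK) +
        ENNReal.ofReal k * (ENNReal.ofReal (2 * H ^ 2 * G ^ 2) * volume K) := by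
    calc _ ≤ ENNReal.ofReal k * (2 * (∫⁻ x in K, ‖g x‖ₑ ^ 2) +
          ENNReal.ofReal (2 * H ^ 2 * G ^ 2) * volume K) := by gcongr
      _ = 2 * (ENNReal.ofReal k * (∫⁻ x in K, ‖g x‖ₑ ^ 2)) +
          ENNReal.ofReal k * (ENNReal.ofReal (2 * H ^ 2 * G ^ 2) * volume K) := by ring
      _ ≤ _ := by gcongr
  have f1 : 2 * (4 * WK + ENNReal.ofReal (H ^ 2) * AK) ≠ ⊤ :=
    ENNReal.mul_ne_top (by norm_num) (ENNReal.add_ne_top.2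
      ⟨ENNReal.mul_ne_top (by norm_num) hWKf, ENNReal.mul_ne_top ENNReal.ofReal_ne_top hAKf⟩)
  have f2 : ENNReal.ofReal k * (ENNReal.ofReal (2 * H ^ 2 * G ^ 2) * volume K) ≠ ⊤ :=
    ENNReal.mul_ne_top ENNReal.ofReal_ne_top (ENNReal.mul_ne_top ENNReal.ofReal_ne_top hVf)
  have h4 := ENNReal.toReal_mono (ENNReal.add_ne_top.2 ⟨f1, f2⟩) h3
  rw [ENNReal.toReal_add f1 f2] at h4
  simp only [ENNReal.toReal_mul] at h4
  rw [ENNReal.toReal_add (ENNReal.mul_ne_top (by norm_num) hWKf)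
    (ENNReal.mul_ne_top ENNReal.ofReal_ne_top hAKf)] at h4
  simp only [ENNReal.toReal_mul] at h4
  rw [ENNReal.toReal_ofReal hk0, ENNReal.toReal_ofReal (by positivity),
    ENNReal.toReal_ofReal (by positivity), ENNReal.toReal_ofReal (by positivity)] at h4
  change k * (|A z| ^ 2 * volume.real K) ≤ _ + k * (2 * H ^ 2 * G ^ 2 * volume.real K) at h4
  simp only [ENNReal.toReal_ofNat] at h4
  have hA0 : 0 ≤ AK.toReal := ENNReal.toReal_nonneg
  have h5 : 1 ≤ 2 ^ d * ((d : ℝ) + 1) ^ 2 * Γ ^ 2 := by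
    have a1 : (1 : ℝ) ≤ 2 ^ d := one_le_pow₀ (by norm_num)
    have a2 : (1 : ℝ) ≤ ((d : ℝ) + 1) ^ 2 := one_le_pow₀ (by linarith [(Nat.cast_nonneg d : (0 : ℝ) ≤ d)])
    have a3 : 1 ≤ Γ ^ 2 := one_le_pow₀ hΓ1
    exact one_le_mul_of_one_le_of_one_le (one_le_mul_of_one_le_of_one_le a1 a2) a3
  have h6 : H ^ 2 * AK.toReal ≤ 2 ^ d * ((d : ℝ) + 1) ^ 2 * Γ ^ 2 * (H ^ 2 * AK.toReal) :=
    le_mul_of_one_le_left (by positivity) h5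
  have h7 : H ^ 2 * (k * G ^ 2 * volume.real K) ≤
      H ^ 2 * (32 * 2 ^ d * (d + 1) ^ 2 * Γ ^ 2 * AK.toReal) := by gcongr
  nlinarith

/-! ### The error of interpolating the localized trace on one element -/

/-- A smooth cutoff function for the box of size `R` that vanishes outside the box of size `R + τ / 2`. -/
structure IsCutoff (η : Rd1 d → ℝ) (c : Rd d) (R τ C : ℝ) : Prop where
  contDiff : ContDiff ℝ ∞ η
  hasCompactSupport : HasCompactSupport η
  nonneg : ∀ z, 0 ≤ η z
  le_one : ∀ z, η z ≤ 1
  eq_one : ∀ z ∈ box c R, η z = 1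
  of_ne_zero : ∀ z, η z ≠ 0 → (∀ i, |z.1 i - c i| < R / 2 + τ / 4) ∧ |z.2| < R + τ / 4
  eq_of_abs_le : ∀ x t, |t| ≤ R → η (x, t) = η (x, 0)
  norm_fderiv_le : ∀ z, ‖fderiv ℝ η z‖ ≤ C / τ
  norm_fderiv_sub_le : ∀ x y, ‖fderiv ℝ η x - fderiv ℝ η y‖ ≤ C / τ ^ 2 * ‖x - y‖

namespace IsCutoff

variable {η : Rd1 d → ℝ} {c : Rd d} {R τ C : ℝ}

theorem abs_sub_le (h : IsCutoff η c R τ C) (x y : Rd1 d) : |η x - η y| ≤ C / τ * ‖x - y‖ :=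
  Convex.norm_image_sub_le_of_norm_fderiv_le (f := η) (s := univ)
    (fun z _ => h.contDiff.differentiable (by simp) z) (fun z _ => h.norm_fderiv_le z)
    convex_univ (mem_univ y) (mem_univ x)

theorem fderiv_sq (h : IsCutoff η c R τ C) (z : Rd1 d) :
    fderiv ℝ (fun y => η y ^ 2) z = (2 * η z) • fderiv ℝ η z := by
  have := (h.contDiff.differentiable (by simp) z).hasFDerivAt.pow 2
  rw [this.fderiv]; simp

/-- The factor `η z` is kept on purpose: the first order part of the interpolation error becomes a
multiple of `η ∇w`, which can be absorbed. -/
theorem norm_fderiv_sq_le (h : IsCutoff η c R τ C) (z : Rd1 d) :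
    ‖fderiv ℝ (fun y => η y ^ 2) z‖ ≤ 2 * η z * (C / τ) := by
  rw [h.fderiv_sq, norm_smul, Real.norm_eq_abs, abs_of_nonneg (by linarith [h.nonneg z])]
  exact mul_le_mul_of_nonneg_left (h.norm_fderiv_le z) (by linarith [h.nonneg z])

theorem norm_fderiv_sq_sub_le (h : IsCutoff η c R τ C) (hC : 1 ≤ C) (hτ : 0 < τ) (x y : Rd1 d) :
    ‖fderiv ℝ (fun y => η y ^ 2) x - fderiv ℝ (fun y => η y ^ 2) y‖ ≤
      4 * C ^ 2 / τ ^ 2 * ‖x - y‖ := by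
  rw [h.fderiv_sq, h.fderiv_sq]
  have e : (2 * η x) • fderiv ℝ η x - (2 * η y) • fderiv ℝ η y =
      (2 * (η x - η y)) • fderiv ℝ η x + (2 * η y) • (fderiv ℝ η x - fderiv ℝ η y) := by
    module
  rw [e]
  refine (norm_add_le _ _).trans ?_
  rw [norm_smul, norm_smul, Real.norm_eq_abs, Real.norm_eq_abs, abs_mul, abs_two,
    abs_of_nonneg (by linarith [h.nonneg y] : 0 ≤ 2 * η y)]
  have h1 : 2 * |η x - η y| * ‖fderiv ℝ η x‖ ≤ 2 * (C / τ * ‖x - y‖) * (C / τ) := by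
    gcongr
    · exact h.abs_sub_le x y
    · exact h.norm_fderiv_le x
  have h2 : 2 * η y * ‖fderiv ℝ η x - fderiv ℝ η y‖ ≤ 2 * 1 * (C / τ ^ 2 * ‖x - y‖) := by
    gcongr
    · exact h.le_one y
    · exact h.norm_fderiv_sub_le x y
  have h3 : C / τ ^ 2 * ‖x - y‖ ≤ C ^ 2 / τ ^ 2 * ‖x - y‖ := by
    gcongr; nlinarith
  calc _ ≤ 2 * (C / τ * ‖x - y‖) * (C / τ) + 2 * 1 * (C ^ 2 / τ ^ 2 * ‖x - y‖) := by linarith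
    _ = _ := by ring

/-- Taylor expansion of the squared cutoff function on a set of diameter `H`. -/
theorem taylor (h : IsCutoff η c R τ C) (hC : 1 ≤ C) (hτ : 0 < τ) {K : Set (Rd d)}
    (hK : Convex ℝ K) {H : ℝ} (hH : ∀ x ∈ K, ∀ y ∈ K, ‖x - y‖ ≤ H) {z : Rd d} (hz : z ∈ K) :
    ∃ p : Rd d →L[ℝ] ℝ, ‖p‖ ≤ 2 * η (z, 0) * (C / τ) ∧
      (∀ x ∈ K, |η (x, 0) ^ 2 - η (z, 0) ^ 2 - p (x - z)| ≤ 4 * C ^ 2 / τ ^ 2 * H ^ 2) ∧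
      ∀ x ∈ K, ∀ y ∈ K, |(η (x, 0) ^ 2 - η (z, 0) ^ 2 - p (x - z)) -
        (η (y, 0) ^ 2 - η (z, 0) ^ 2 - p (y - z))| ≤ 4 * C ^ 2 / τ ^ 2 * H * ‖x - y‖ := by
  set Dm := fderiv ℝ (fun y => η y ^ 2) with hDm
  set ι := ContinuousLinearMap.inl ℝ (Rd d) ℝ with hι
  have hcomp : ∀ ℓ : Rd1 d →L[ℝ] ℝ, ‖ℓ.comp ι‖ ≤ ‖ℓ‖ := fun ℓ => by
    refine (ℓ.opNorm_comp_le ι).trans (mul_le_of_le_one_right (norm_nonneg _) ?_)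
    exact ContinuousLinearMap.norm_inl_le_one ℝ _ _
  set p := (Dm (z, 0)).comp ι with hp
  set ρ : Rd d → ℝ := fun x => η (x, 0) ^ 2 - η (z, 0) ^ 2 - p (x - z) with hρ
  have hder : ∀ x, HasFDerivAt ρ ((Dm (x, 0)).comp ι - p) x := by
    intro x
    have h1 : HasFDerivAt (fun y : Rd d => η (y, 0) ^ 2) ((Dm (x, 0)).comp ι) x := by
      have hd : HasFDerivAt (fun y => η y ^ 2) (Dm (x, 0)) (x, 0) :=
        ((h.contDiff.differentiable (by simp)).pow 2 _).hasFDerivAt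
      exact hd.comp x (f := fun y : Rd d => (y, (0 : ℝ))) (hasFDerivAt_prodMk_left x (0 : ℝ))
    have h2 : HasFDerivAt (fun y : Rd d => p (y - z)) p x := by
      simp_rw [map_sub]
      exact p.hasFDerivAt.sub_const _
    exact (h1.sub_const _).sub h2
  have hl : ∀ x ∈ K, ∀ y ∈ K, |ρ x - ρ y| ≤ 4 * C ^ 2 / τ ^ 2 * H * ‖x - y‖ := by
    intro x hx y hy
    refine Convex.norm_image_sub_le_of_norm_hasFDerivWithin_le (f := ρ) (s := K)
      (fun u _ => (hder u).hasFDerivWithinAt) (fun u hu => ?_) hK hy hx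
    rw [hp, ← ContinuousLinearMap.sub_comp]
    refine (hcomp _).trans ((h.norm_fderiv_sq_sub_le hC hτ _ _).trans ?_)
    have : ‖((u, 0) : Rd1 d) - (z, 0)‖ ≤ H := by
      rw [Prod.mk_sub_mk, sub_zero, Prod.norm_mk, norm_zero, max_eq_left (norm_nonneg _)]
      exact hH u hu z hz
    gcongr
  refine ⟨p, (hcomp _).trans (h.norm_fderiv_sq_le _), fun x hx => ?_, hl⟩
  have h1 := hl x hx z hz
  have h0 : ρ z = 0 := by simp [hρ]
  rw [h0, sub_zero] at h1
  refine h1.trans ?_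
  have hH0 : 0 ≤ H := (norm_nonneg _).trans (hH x hx z hz)
  have := hH x hx z hz
  calc _ ≤ 4 * C ^ 2 / τ ^ 2 * H * H := by gcongr
    _ = _ := by ring

end IsCutoff

/-- The value of the cutoff function at a point of an element is controlled by its values on the
prism over that element. -/
theorem IsCutoff.value_mul_le {η : Rd1 d → ℝ} {c : Rd d} {R τ C : ℝ} (h : IsCutoff η c R τ C)
    (hC : 1 ≤ C) (hτ : 0 < τ) {K : Set (Rd d)} (hKm : MeasurableSet K) {H : ℝ}
    (hHR : H ≤ R) (hH : ∀ x ∈ K, ∀ y ∈ K, ‖x - y‖ ≤ H) {z : Rd d} (hz : z ∈ K) {α : ℝ}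
    {F : Rd1 d → Vec d} (hF : MemLp F 2 (wvol d α)) :
    η (z, 0) ^ 2 * (∫⁻ y in K ×ˢ Ioo 0 H, ‖F y‖ₑ ^ 2 ∂(wvol d α)).toReal ≤
      2 * (∫⁻ y in K ×ˢ Ioo 0 H, ‖η y • F y‖ₑ ^ 2 ∂(wvol d α)).toReal +
        2 * (C * H / τ) ^ 2 * (∫⁻ y in K ×ˢ Ioo 0 H, ‖F y‖ₑ ^ 2 ∂(wvol d α)).toReal := by
  set A := ∫⁻ y in K ×ˢ Ioo 0 H, ‖F y‖ₑ ^ 2 ∂(wvol d α) with hA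
  set Z := ∫⁻ y in K ×ˢ Ioo 0 H, ‖η y • F y‖ₑ ^ 2 ∂(wvol d α) with hZ
  have hAf : A ≠ ⊤ := lintegral_sq_ne_top (hF.restrict _)
  have hZA : Z ≤ A := lintegral_mono fun y => by
    refine pow_le_pow_left' ?_ 2
    rw [enorm_smul, Real.enorm_eq_ofReal (h.nonneg y)]
    refine mul_le_of_le_one_left' ?_
    rw [← ENNReal.ofReal_one]
    exact ENNReal.ofReal_le_ofReal (h.le_one y)
  have hZf : Z ≠ ⊤ := ne_top_of_le_ne_top hAf hZA
  have hC0 : 0 ≤ C := zero_le_one.trans hC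
  have key : ENNReal.ofReal (η (z, 0) ^ 2) * A ≤
      ENNReal.ofReal 2 * Z + ENNReal.ofReal (2 * (C * H / τ) ^ 2) * A := by
    rw [hA, hZ, ← lintegral_const_mul' _ _ ENNReal.ofReal_ne_top,
      ← lintegral_const_mul' _ _ ENNReal.ofReal_ne_top,
      ← lintegral_const_mul' _ _ ENNReal.ofReal_ne_top, ← lintegral_add_left']
    · refine setLIntegral_mono' (hKm.prod measurableSet_Ioo) fun y hy => ?_
      rw [enorm_smul, mul_pow, ← mul_assoc, ← add_mul]
      gcongr
      rw [Real.enorm_eq_ofReal (h.nonneg y), ← ENNReal.ofReal_pow (h.nonneg y),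
        ← ENNReal.ofReal_mul (by norm_num), ← ENNReal.ofReal_add (by positivity) (by positivity)]
      refine ENNReal.ofReal_le_ofReal ?_
      obtain ⟨hy1, hy2⟩ := hy
      -- The prism has height `H ≤ R`, where the cutoff does not depend on the last variable;
      -- comparing `y` with `z` is then purely tangential.
      have e1 : η y = η (y.1, 0) :=
        h.eq_of_abs_le y.1 y.2 (by rw [abs_of_pos hy2.1]; linarith [hy2.2])
      have h1 : η (z, 0) ≤ η y + C * H / τ := by
        have h2 := (le_abs_self _).trans (h.abs_sub_le (z, 0) (y.1, 0))
        rw [Prod.mk_sub_mk, sub_zero, Prod.norm_mk, norm_zero, max_eq_left (norm_nonneg _)] at h2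
        have h3 : C / τ * ‖z - y.1‖ ≤ C / τ * H := by
          gcongr; exact hH z hz y.1 hy1
        rw [e1, mul_div_right_comm]; linarith
      have := pow_le_pow_left₀ (h.nonneg _) h1 2
      nlinarith [sq_nonneg (η y - C * H / τ)]
    · have h1 : AEStronglyMeasurable (fun y => η y • F y) ((wvol d α).restrict (K ×ˢ Ioo 0 H)) :=
        h.contDiff.continuous.aestronglyMeasurable.smul hF.1.restrict
      exact (h1.enorm.pow_const 2).const_mul _
  have h2 := ENNReal.toReal_mono (ENNReal.add_ne_top.2
    ⟨ENNReal.mul_ne_top ENNReal.ofReal_ne_top hZf, ENNReal.mul_ne_top ENNReal.ofReal_ne_top hAf⟩) key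
  rw [ENNReal.toReal_add (ENNReal.mul_ne_top ENNReal.ofReal_ne_top hZf)
    (ENNReal.mul_ne_top ENNReal.ofReal_ne_top hAf), ENNReal.toReal_mul, ENNReal.toReal_mul,
    ENNReal.toReal_mul, ENNReal.toReal_ofReal (by positivity), ENNReal.toReal_ofReal (by positivity),
    ENNReal.toReal_ofReal (by positivity)] at h2
  exact h2

theorem add_add_sq_le (a b c : ℝ) : (a + b + c) ^ 2 ≤ 3 * (a ^ 2 + b ^ 2 + c ^ 2) := by
  nlinarith [sq_nonneg (a - b), sq_nonneg (a - c), sq_nonneg (b - c)]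

/-- The constant in the estimate of the interpolation error. -/
def interpConst (d : ℕ) (Γ C D : ℝ) : ℝ :=
  384 * (2 + (d + 1) * Γ) ^ 2 * (1 + D) * (66 * 2 ^ d * (d + 1) ^ 2 * Γ ^ 2) * C ^ 4

-- The second order error estimate is combined with the inverse estimates on the prism of the
-- element's own height `H`. The lifting has the global height `h` instead; as `α < 1`, the
-- inequality `h ^ (1 + α) * H ^ 2 ≤ H ^ (1 + α) * h ^ 2` bridges the two without comparing element
-- sizes from below.
set_option maxHeartbeats 1000000 in
theorem exists_interp_error {α : ℝ} (hα : α ∈ Ioo (-1 : ℝ) 1) {w : BeppoLevi d α}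
    {g : Rd d → ℝ} (hg : Continuous g) (ht : HasTrace w g) {s : Finset (Rd d)} (hs : IsSimplex s)
    {H h Γ R τ C D : ℝ} (hH0 : 0 < H) (hH : Metric.diam (convexHull ℝ (s : Set (Rd d))) ≤ H)
    (hHh : H ≤ h) (hhR : h ≤ R) (hτ : 0 < τ) (hC : 1 ≤ C) (hD : 1 ≤ D)
    (hΓ1 : 1 ≤ Γ) (hΓ : ∀ v, ‖affGrad (bary s v)‖ * H ≤ Γ)
    {A : Rd d →ᵃ[ℝ] ℝ} (hA : EqOn g A (convexHull ℝ (s : Set (Rd d)))) {c : Rd d}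
    {η : Rd1 d → ℝ} (hη : IsCutoff η c R τ C) {z : Rd d} (hz : z ∈ convexHull ℝ (s : Set (Rd d))) :
    ∃ S L : ℝ, 0 ≤ S ∧ 0 ≤ L ∧
      (∀ x ∈ convexHull ℝ (s : Set (Rd d)),
        |η (x, 0) ^ 2 * g x - ∑ v ∈ s, bary s v x * (η (v, 0) ^ 2 * g v)| ≤ S) ∧
      (∀ x ∈ convexHull ℝ (s : Set (Rd d)), ∀ y ∈ convexHull ℝ (s : Set (Rd d)),
        |(η (x, 0) ^ 2 * g x - ∑ v ∈ s, bary s v x * (η (v, 0) ^ 2 * g v)) -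
          (η (y, 0) ^ 2 * g y - ∑ v ∈ s, bary s v y * (η (v, 0) ^ 2 * g v))| ≤ L * ‖x - y‖) ∧
      volume.real (convexHull ℝ (s : Set (Rd d))) *
        (L ^ 2 * ((1 - α) / (1 + α) * h ^ (1 + α)) +
          S ^ 2 * (D * ((1 - α) / (1 + α) * h ^ (1 + α)) / h ^ 2)) ≤
      interpConst d Γ C D * (h / τ) ^ 2 *
        (1 / τ ^ 2 * (∫⁻ y in convexHull ℝ (s : Set (Rd d)) ×ˢ Ioo 0 H,
            ‖w.toFun y‖ₑ ^ 2 ∂(wvol d α)).toReal +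
          (h / τ) ^ 2 * (∫⁻ y in convexHull ℝ (s : Set (Rd d)) ×ˢ Ioo 0 H,
            ‖w.grad y‖ₑ ^ 2 ∂(wvol d α)).toReal +
          (∫⁻ y in convexHull ℝ (s : Set (Rd d)) ×ˢ Ioo 0 H,
            ‖η y • w.grad y‖ₑ ^ 2 ∂(wvol d α)).toReal) := by
  have hGi := inverse_estimate_grad hα hg ht hs hH0 hΓ1 hΓ A hA
  have hVi := inverse_estimate_value hα hg ht hs hH0 hH hΓ1 hΓ A hA hz
  set K := convexHull ℝ (s : Set (Rd d)) with hK
  have hdK : ∀ x ∈ K, ∀ y ∈ K, ‖x - y‖ ≤ H := fun x hx y hy => (norm_sub_le_diam hx hy).trans hH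
  have hZi := hη.value_mul_le hC hτ (measurableSet_hull s) (hHh.trans hhR) hdK hz w.memLp_grad
  obtain ⟨p, hp, hρ, hρl⟩ := hη.taylor hC hτ (convex_convexHull ℝ _) hdK hz
  set M := 4 * C ^ 2 / τ ^ 2 with hM
  set P := 2 * η (z, 0) * (C / τ) with hP
  have hηz := hη.nonneg (z, 0)
  have hP0 : 0 ≤ P := by positivity
  obtain ⟨hS, hL⟩ := interp_error_le hs hz hH0 hH hΓ (by positivity : 0 ≤ M) hP0
    (m := fun x => η (x, 0) ^ 2) hp hρ hρl A
  set G := ‖affGrad A‖ with hG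
  have hG0 : 0 ≤ G := norm_nonneg _
  set q := M * (|A z| + H * G) + P * G with hq
  have hq0 : 0 ≤ q := by positivity
  set b := 2 + ((d : ℝ) + 1) * Γ with hb
  have hb0 : 0 < b := by positivity
  set AK := (∫⁻ y in K ×ˢ Ioo 0 H, ‖w.grad y‖ₑ ^ 2 ∂(wvol d α)).toReal with hAK
  set WK := (∫⁻ y in K ×ˢ Ioo 0 H, ‖w.toFun y‖ₑ ^ 2 ∂(wvol d α)).toReal with hWK
  set ZK := (∫⁻ y in K ×ˢ Ioo 0 H, ‖η y • w.grad y‖ₑ ^ 2 ∂(wvol d α)).toReal with hZK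
  have hA0 : 0 ≤ AK := ENNReal.toReal_nonneg
  have hW0 : 0 ≤ WK := ENNReal.toReal_nonneg
  have hZ0 : 0 ≤ ZK := ENNReal.toReal_nonneg
  have hvs : ∀ v ∈ s, v ∈ K := fun v hv => subset_convexHull ℝ _ hv
  have hsum : ∀ x, ∑ v ∈ s, bary s v x * (η (v, 0) ^ 2 * g v) =
      ∑ v ∈ s, bary s v x * (η (v, 0) ^ 2 * A v) := fun x =>
    Finset.sum_congr rfl fun v hv => by rw [hA (hvs v hv)]
  refine ⟨b * H ^ 2 * q, b * H * q, by positivity, by positivity, fun x hx => ?_,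
    fun x hx y hy => ?_, ?_⟩
  · rw [hsum, hA hx]; exact hS x hx
  · rw [hsum, hsum, hA hx, hA hy]; exact hL x hx y hy
  have hh0 : 0 < h := hH0.trans_le hHh
  set κ := (1 - α) / (1 + α) with hκ
  have hκ0 : 0 ≤ κ := by
    have h1 : 0 < 1 - α := by linarith [hα.2]
    have h2 : 0 < 1 + α := by linarith [hα.1]
    positivity
  set V := volume.real K with hV
  have hV0 : 0 ≤ V := measureReal_nonneg
  set c1 := 66 * 2 ^ d * ((d : ℝ) + 1) ^ 2 * Γ ^ 2 with hc1
  have hc1' : 1 ≤ c1 := by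
    have a1 : (1 : ℝ) ≤ 2 ^ d := one_le_pow₀ (by norm_num)
    have a2 : (1 : ℝ) ≤ ((d : ℝ) + 1) ^ 2 :=
      one_le_pow₀ (by linarith [(Nat.cast_nonneg d : (0 : ℝ) ≤ d)])
    have a3 : 1 ≤ Γ ^ 2 := one_le_pow₀ hΓ1
    exact one_le_mul_of_one_le_of_one_le (one_le_mul_of_one_le_of_one_le
      (one_le_mul_of_one_le_of_one_le (by norm_num) a1) a2) a3
  set X := κ * H ^ (1 + α) * V with hX
  have hX0 : 0 ≤ X := by positivity
  have hGi' : X * G ^ 2 ≤ c1 * AK := by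
    have : 32 * 2 ^ d * ((d : ℝ) + 1) ^ 2 * Γ ^ 2 * AK ≤ c1 * AK := by
      rw [hc1]; gcongr; norm_num
    calc X * G ^ 2 = κ * H ^ (1 + α) * G ^ 2 * V := by rw [hX]; ring
      _ ≤ _ := hGi.trans this
  have hVi' : X * |A z| ^ 2 ≤ 8 * WK + c1 * h ^ 2 * AK := by
    have : c1 * H ^ 2 * AK ≤ c1 * h ^ 2 * AK := by gcongr
    calc X * |A z| ^ 2 = κ * H ^ (1 + α) * |A z| ^ 2 * V := by rw [hX]; ring
      _ ≤ 8 * WK + c1 * H ^ 2 * AK := hVi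
      _ ≤ _ := by linarith
  have hZi' : η (z, 0) ^ 2 * AK ≤ 2 * ZK + 2 * (C * h / τ) ^ 2 * AK := by
    refine hZi.trans ?_
    gcongr
  -- powers of the local and global mesh sizes
  have hpow : h ^ (1 + α) * H ^ 2 ≤ H ^ (1 + α) * h ^ 2 := by
    have e1 : H ^ (2 : ℕ) = H ^ (1 + α) * H ^ (1 - α) := by
      rw [← Real.rpow_add hH0, ← Real.rpow_natCast]; congr 1; push_cast; ring
    have e2 : h ^ (2 : ℕ) = h ^ (1 + α) * h ^ (1 - α) := by
      rw [← Real.rpow_add hh0, ← Real.rpow_natCast]; congr 1; push_cast; ring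
    have h3 : H ^ (1 - α) ≤ h ^ (1 - α) :=
      Real.rpow_le_rpow hH0.le hHh (by linarith [hα.2])
    have h4 : 0 ≤ h ^ (1 + α) * H ^ (1 + α) := by positivity
    calc h ^ (1 + α) * H ^ 2 = h ^ (1 + α) * H ^ (1 + α) * H ^ (1 - α) := by rw [e1]; ring
      _ ≤ h ^ (1 + α) * H ^ (1 + α) * h ^ (1 - α) := mul_le_mul_of_nonneg_left h3 h4
      _ = _ := by rw [e2]; ring
  have hH2 : H ^ 2 / h ^ 2 ≤ 1 := by
    rw [div_le_one (by positivity)]; gcongr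
  have hstep : V * ((b * H * q) ^ 2 * (κ * h ^ (1 + α)) +
      (b * H ^ 2 * q) ^ 2 * (D * (κ * h ^ (1 + α)) / h ^ 2)) ≤ b ^ 2 * (1 + D) * h ^ 2 * (X * q ^ 2) := by
    have e : V * ((b * H * q) ^ 2 * (κ * h ^ (1 + α)) +
      (b * H ^ 2 * q) ^ 2 * (D * (κ * h ^ (1 + α)) / h ^ 2)) =
      (b ^ 2 * q ^ 2 * V * κ) * (h ^ (1 + α) * H ^ 2) * (1 + D * (H ^ 2 / h ^ 2)) := by
      field_simp
    rw [e]
    calc _ ≤ (b ^ 2 * q ^ 2 * V * κ) * (H ^ (1 + α) * h ^ 2) * (1 + D * 1) := by gcongr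
      _ = _ := by rw [hX]; ring
  have hqs : q ^ 2 ≤ 3 * (M ^ 2 * |A z| ^ 2 + M ^ 2 * H ^ 2 * G ^ 2 + P ^ 2 * G ^ 2) := by
    have e : q = M * |A z| + M * H * G + P * G := by rw [hq]; ring
    rw [e]
    refine (add_add_sq_le _ _ _).trans (le_of_eq ?_)
    ring
  have hXq : X * q ^ 2 ≤ 3 * (M ^ 2 * (8 * WK + c1 * h ^ 2 * AK) + M ^ 2 * h ^ 2 * (c1 * AK) +
      c1 * (P ^ 2 * AK)) := by
    calc X * q ^ 2 ≤ X * (3 * (M ^ 2 * |A z| ^ 2 + M ^ 2 * H ^ 2 * G ^ 2 + P ^ 2 * G ^ 2)) := by gcongr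
      _ = 3 * (M ^ 2 * (X * |A z| ^ 2) + M ^ 2 * H ^ 2 * (X * G ^ 2) + P ^ 2 * (X * G ^ 2)) := by ring
      _ ≤ 3 * (M ^ 2 * (8 * WK + c1 * h ^ 2 * AK) + M ^ 2 * h ^ 2 * (c1 * AK) + P ^ 2 * (c1 * AK)) := by
          gcongr
      _ = _ := by ring
  -- `P` carries `η (z, 0)`; the point value is exchanged for the localized energy `ZK`, with an
  -- error that has a further factor `(h / τ) ^ 2`.
  have hPA : P ^ 2 * AK ≤ 4 * C ^ 2 / τ ^ 2 * (2 * ZK + 2 * (C * h / τ) ^ 2 * AK) := by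
    calc P ^ 2 * AK = 4 * C ^ 2 / τ ^ 2 * (η (z, 0) ^ 2 * AK) := by rw [hP]; ring
      _ ≤ _ := by gcongr
  have hfin : X * q ^ 2 ≤ 384 * c1 * C ^ 4 / τ ^ 2 * (1 / τ ^ 2 * WK + (h / τ) ^ 2 * AK + ZK) := by
    have hC2 : C ^ 2 ≤ C ^ 4 := pow_le_pow_right₀ hC (by norm_num)
    calc X * q ^ 2 ≤ 3 * (M ^ 2 * (8 * WK + c1 * h ^ 2 * AK) + M ^ 2 * h ^ 2 * (c1 * AK) +
          c1 * (4 * C ^ 2 / τ ^ 2 * (2 * ZK + 2 * (C * h / τ) ^ 2 * AK))) := by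
            refine hXq.trans ?_; gcongr
      _ = (384 * C ^ 4 * WK / τ ^ 4) * 1 + 120 * (c1 * C ^ 4 * h ^ 2 * AK / τ ^ 4) +
          24 * (c1 * ZK / τ ^ 2 * C ^ 2) := by rw [hM]; ring
      _ ≤ (384 * C ^ 4 * WK / τ ^ 4) * c1 + 384 * (c1 * C ^ 4 * h ^ 2 * AK / τ ^ 4) +
          384 * (c1 * ZK / τ ^ 2 * C ^ 4) := by gcongr <;> norm_num
      _ = _ := by ring
  calc _ ≤ b ^ 2 * (1 + D) * h ^ 2 * (X * q ^ 2) := hstep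
    _ ≤ b ^ 2 * (1 + D) * h ^ 2 *
        (384 * c1 * C ^ 4 / τ ^ 2 * (1 / τ ^ 2 * WK + (h / τ) ^ 2 * AK + ZK)) := by gcongr
    _ = _ := by rw [interpConst]; ring

/-! ### Extensions of product form and the energy of the interpolation error -/

theorem lipschitzWith_tensor {e₀ : Rd d → ℝ} {C : NNReal} (he : LipschitzWith C e₀)
    (hc : HasCompactSupport e₀) {χ : ℝ → ℝ} (hχ : ContDiff ℝ ∞ χ) (hχc : HasCompactSupport χ) :
    ∃ C', LipschitzWith C' (fun z : Rd1 d => e₀ z.1 * χ z.2) := by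
  obtain ⟨A, hA⟩ := he.continuous.bounded_above_of_compact_support hc
  obtain ⟨B, hB⟩ := hχ.continuous.bounded_above_of_compact_support hχc
  obtain ⟨C₂, hC₂⟩ := ContDiff.lipschitzWith_of_hasCompactSupport hχc hχ (by simp)
  refine ⟨(A * C₂ + C * B).toNNReal, LipschitzWith.of_dist_le' fun x y => ?_⟩
  rw [Real.dist_eq]
  refine abs_mul_sub_mul_le (hA _) (hB _) ?_ ?_
  · refine (he.dist_le_mul x.1 y.1).trans ?_
    gcongr
    exact le_max_left _ _
  · refine (hC₂.dist_le_mul x.2 y.2).trans ?_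
    gcongr
    exact le_max_right _ _

theorem hasCompactSupport_tensor {e₀ : Rd d → ℝ} (hc : HasCompactSupport e₀) {χ : ℝ → ℝ}
    (hχc : HasCompactSupport χ) : HasCompactSupport (fun z : Rd1 d => e₀ z.1 * χ z.2) := by
  refine HasCompactSupport.intro (hc.isCompact.prod hχc.isCompact) fun z hz => ?_
  by_cases h1 : z.1 ∈ tsupport e₀
  · rw [image_eq_zero_of_notMem_tsupport fun h2 => hz ⟨h1, h2⟩, mul_zero]
  · rw [image_eq_zero_of_notMem_tsupport h1, zero_mul]

/-- Tangential and vertical derivatives are orthogonal components, so there is no mixed term. -/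
theorem enorm_gradOf_tensor {e₀ : Rd d → ℝ} {χ : ℝ → ℝ} {z : Rd1 d}
    (he : DifferentiableAt ℝ e₀ z.1) (hχ : DifferentiableAt ℝ χ z.2) :
    ‖gradOf (fderiv ℝ (fun z : Rd1 d => e₀ z.1 * χ z.2) z)‖ₑ ^ 2 =
      ‖fderiv ℝ e₀ z.1‖ₑ ^ 2 * ‖χ z.2‖ₑ ^ 2 + ‖e₀ z.1‖ₑ ^ 2 * ‖deriv χ z.2‖ₑ ^ 2 := by
  have h1 : HasFDerivAt (fun z : Rd1 d => e₀ z.1)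
      ((fderiv ℝ e₀ z.1).comp (ContinuousLinearMap.fst ℝ (Rd d) ℝ)) z :=
    he.hasFDerivAt.comp z hasFDerivAt_fst
  have h2 : HasFDerivAt (fun z : Rd1 d => χ z.2)
      ((fderiv ℝ χ z.2).comp (ContinuousLinearMap.snd ℝ (Rd d) ℝ)) z :=
    hχ.hasFDerivAt.comp z hasFDerivAt_snd
  set ℓ := fderiv ℝ (fun z : Rd1 d => e₀ z.1 * χ z.2) z with hℓ
  have h : ℓ = _ := (h1.mul h2).fderiv
  have hl : ∀ y, ℓ y = e₀ z.1 * fderiv ℝ χ z.2 y.2 + χ z.2 * fderiv ℝ e₀ z.1 y.1 := fun y => by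
    rw [h]; simp
  have e1 : ℓ.comp (ContinuousLinearMap.inl ℝ (Rd d) ℝ) = χ z.2 • fderiv ℝ e₀ z.1 := by
    ext y; simp [hl]
  have e2 : ℓ (0, 1) = e₀ z.1 * deriv χ z.2 := by simp [hl]
  have key : ‖gradOf ℓ‖ ^ 2 = ‖fderiv ℝ e₀ z.1‖ ^ 2 * ‖χ z.2‖ ^ 2 +
      ‖e₀ z.1‖ ^ 2 * ‖deriv χ z.2‖ ^ 2 := by
    rw [norm_gradOf_sq, e1, e2, norm_smul]
    simp only [Real.norm_eq_abs, mul_pow, sq_abs]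
    ring
  simp only [← ofReal_norm]
  rw [← ENNReal.ofReal_pow (norm_nonneg _), key, ENNReal.ofReal_add (by positivity) (by positivity),
    ENNReal.ofReal_mul (by positivity), ENNReal.ofReal_mul (by positivity)]
  simp only [ENNReal.ofReal_pow (norm_nonneg _)]

theorem lintegral_gradOf_tensor (α : ℝ) {e₀ : Rd d → ℝ} {C : NNReal} (he : LipschitzWith C e₀)
    {χ : ℝ → ℝ} (hχ : ContDiff ℝ ∞ χ) :
    ∫⁻ z, ‖gradOf (fderiv ℝ (fun z : Rd1 d => e₀ z.1 * χ z.2) z)‖ₑ ^ 2 ∂(wvol d α) =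
      (∫⁻ x, ‖fderiv ℝ e₀ x‖ₑ ^ 2) * (∫⁻ t, ‖χ t‖ₑ ^ 2 ∂(wline α)) +
        (∫⁻ x, ‖e₀ x‖ₑ ^ 2) * ∫⁻ t, ‖deriv χ t‖ₑ ^ 2 ∂(wline α) := by
  have hae : ∀ᵐ z ∂(wvol d α), DifferentiableAt ℝ e₀ z.1 := by
    rw [wvol_eq_prod]
    exact Measure.quasiMeasurePreserving_fst.ae he.ae_differentiableAt
  have h1 : Measurable fun x => ‖fderiv ℝ e₀ x‖ₑ ^ 2 := (measurable_fderiv ℝ e₀).enorm.pow_const 2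
  have h2 : Measurable fun t => ‖χ t‖ₑ ^ 2 := hχ.continuous.measurable.enorm.pow_const 2
  have h3 : Measurable fun x => ‖e₀ x‖ₑ ^ 2 := he.continuous.measurable.enorm.pow_const 2
  have h4 : Measurable fun t => ‖deriv χ t‖ₑ ^ 2 := (measurable_deriv χ).enorm.pow_const 2
  rw [lintegral_congr_ae (hae.mono fun z hz =>
    enorm_gradOf_tensor hz (hχ.differentiable (by simp) z.2)), wvol_eq_prod, lintegral_add_left,
    lintegral_prod_mul h1.aemeasurable h2.aemeasurable,
    lintegral_prod_mul h3.aemeasurable h4.aemeasurable]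
  exact (h1.comp measurable_fst).mul (h2.comp measurable_snd)

/-- Elementwise estimate of the energy of a product extension. -/
theorem Mesh.lintegral_le_sum (T : Mesh Ω) {e₀ : Rd d → ℝ} (h0 : ∀ x ∉ closure Ω, e₀ x = 0)
    {S L : Finset (Rd d) → ℝ}
    (hS : ∀ s ∈ T.tops, ∀ x ∈ convexHull ℝ (s : Set (Rd d)), |e₀ x| ≤ S s)
    (hL0 : ∀ s ∈ T.tops, 0 ≤ L s)
    (hL : ∀ s ∈ T.tops, ∀ x ∈ convexHull ℝ (s : Set (Rd d)),
      ∀ y ∈ convexHull ℝ (s : Set (Rd d)), |e₀ x - e₀ y| ≤ L s * ‖x - y‖) :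
    (∀ᵐ x : Rd d, ‖fderiv ℝ e₀ x‖ₑ ^ 2 ≤ ∑ s ∈ T.tops_finite.toFinset,
      (convexHull ℝ (s : Set (Rd d))).indicator (fun _ => ENNReal.ofReal (L s ^ 2)) x) ∧
    (∀ᵐ x : Rd d, ‖e₀ x‖ₑ ^ 2 ≤ ∑ s ∈ T.tops_finite.toFinset,
      (convexHull ℝ (s : Set (Rd d))).indicator (fun _ => ENNReal.ofReal (S s ^ 2)) x) := by
  have hsq : ∀ {E : Type} [NormedAddCommGroup E] (a : E) (b : ℝ), ‖a‖ ≤ b →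
      ‖a‖ₑ ^ 2 ≤ ENNReal.ofReal (b ^ 2) := fun a b hab => by
    rw [← ofReal_norm, ← ENNReal.ofReal_pow (norm_nonneg _)]
    exact ENNReal.ofReal_le_ofReal (pow_le_pow_left₀ (norm_nonneg _) hab 2)
  have hsum : ∀ (F : Finset (Rd d) → ℝ) (s) (_ : s ∈ T.tops) (x)
      (_ : x ∈ convexHull ℝ (s : Set (Rd d))) (b : ℝ≥0∞), b ≤ ENNReal.ofReal (F s ^ 2) →
      b ≤ ∑ s ∈ T.tops_finite.toFinset,
      (convexHull ℝ (s : Set (Rd d))).indicator (fun _ => ENNReal.ofReal (F s ^ 2)) x := by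
    intro F s hs x hx b hb
    refine hb.trans ?_
    have := Finset.single_le_sum (f := fun s : Finset (Rd d) =>
      (convexHull ℝ (s : Set (Rd d))).indicator (fun _ => ENNReal.ofReal (F s ^ 2)) x)
      (fun _ _ => zero_le) (T.tops_finite.mem_toFinset.2 hs)
    simpa [indicator_of_mem hx] using this
  constructor
  -- Element boundaries are null sets because elements are convex. Off them a point of `closure Ω`
  -- is interior to an element, and the Lipschitz constant there bounds the derivative.
  · have hfr : ∀ᵐ x : Rd d, ∀ s ∈ T.tops, x ∉ frontier (convexHull ℝ (s : Set (Rd d))) := by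
      rw [ae_ball_iff T.tops_finite.countable]
      intro s _
      exact measure_eq_zero_iff_ae_notMem.1 ((convex_convexHull ℝ _).addHaar_frontier volume)
    filter_upwards [hfr] with x hx
    by_cases hxc : x ∈ closure Ω
    · obtain ⟨s, hs, hxs⟩ := T.mem_closure_iff.1 hxc
      have hint : x ∈ interior (convexHull ℝ (s : Set (Rd d))) := by
        by_contra hc
        exact hx s hs ⟨subset_closure hxs, hc⟩
      refine hsum L s hs x hxs _ (hsq _ _ ?_)
      refine norm_fderiv_le_of_lip' ℝ (hL0 s hs) ?_
      filter_upwards [isOpen_interior.mem_nhds hint] with y hy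
      exact hL s hs y (interior_subset hy) x hxs
    · have : fderiv ℝ e₀ x = 0 := by
        have he : e₀ =ᶠ[𝓝 x] fun _ => 0 := by
          filter_upwards [isClosed_closure.isOpen_compl.mem_nhds hxc] with y hy
          exact h0 y hy
        rw [he.fderiv_eq]; simp
      rw [← ofReal_norm, this, norm_zero, ENNReal.ofReal_zero, zero_pow two_ne_zero]
      exact zero_le
  · refine Eventually.of_forall fun x => ?_
    by_cases hxc : x ∈ closure Ω
    · obtain ⟨s, hs, hxs⟩ := T.mem_closure_iff.1 hxc
      exact hsum S s hs x hxs _ (hsq _ _ (hS s hs x hxs))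
    · rw [h0 x hxc]; simp

theorem lintegral_sum_indicator (F : Finset (Finset (Rd d))) (b : Finset (Rd d) → ℝ≥0∞) :
    ∫⁻ x, ∑ s ∈ F, (convexHull ℝ (s : Set (Rd d))).indicator (fun _ => b s) x =
      ∑ s ∈ F, b s * volume (convexHull ℝ (s : Set (Rd d))) := by
  rw [lintegral_finsetSum]
  · exact Finset.sum_congr rfl fun s _ => lintegral_indicator_const (measurableSet_hull s) _
  · exact fun s _ => measurable_const.indicator (measurableSet_hull s)

/-- Integrals over disjoint prisms. -/
theorem Mesh.sum_setLIntegral_le (T : Mesh Ω) {α : ℝ} {F : Finset (Finset (Rd d))}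
    (hF : ∀ s ∈ F, s ∈ T.tops) (H : Finset (Rd d) → ℝ) {D : Set (Rd1 d)}
    (hD : ∀ s ∈ F, convexHull ℝ (s : Set (Rd d)) ×ˢ Ioo 0 (H s) ⊆ D) (f : Rd1 d → ℝ≥0∞) :
    ∑ s ∈ F, ∫⁻ z in convexHull ℝ (s : Set (Rd d)) ×ˢ Ioo 0 (H s), f z ∂(wvol d α) ≤
      ∫⁻ z in D, f z ∂(wvol d α) := by
  rw [← lintegral_biUnion_finset₀]
  · exact lintegral_mono_set (iUnion₂_subset hD)
  · intro s hs t ht hne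
    refine measure_mono_null (t := (convexHull ℝ (s : Set (Rd d)) ∩ convexHull ℝ (t : Set (Rd d))) ×ˢ
      univ) ?_ ?_
    · rintro z ⟨h1, h2⟩
      exact ⟨⟨h1.1, h2.1⟩, mem_univ _⟩
    · rw [wvol_eq_prod, Measure.prod_prod, T.volume_inter_eq_zero (hF s hs) (hF t ht) hne, zero_mul]
  · exact fun s _ => ((measurableSet_hull s).prod measurableSet_Ioo).nullMeasurableSet

/-! ### The interpolation error of the localized trace -/

/-- The error of the nodal interpolation of `η² g`. -/
def Mesh.interpError (T : Mesh Ω) (η : Rd1 d → ℝ) (g : Rd d → ℝ) (x : Rd d) : ℝ :=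
  η (x, 0) ^ 2 * g x - T.interp (fun y => η (y, 0) ^ 2 * g y) x

theorem Mesh.interpError_eq (T : Mesh Ω) (η : Rd1 d → ℝ) (g : Rd d → ℝ) {s : Finset (Rd d)}
    (hs : s ∈ T.tops) {x : Rd d} (hx : x ∈ convexHull ℝ (s : Set (Rd d))) :
    T.interpError η g x =
      η (x, 0) ^ 2 * g x - ∑ v ∈ s, bary s v x * (η (v, 0) ^ 2 * g v) := by
  rw [Mesh.interpError, T.interp_eq _ hs hx]

/-- Continuity of `g` and its support condition force the vertices with nonzero value into the
interior of `closure Ω`. -/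
theorem Mesh.interp_mem (T : Mesh Ω) (η : Rd1 d → ℝ) {g : Rd d → ℝ}
    (hg : g ∈ T.S10) : T.interp (fun y => η (y, 0) ^ 2 * g y) ∈ T.S10 :=
  T.interp_mem_S10 fun _ hv => mem_interior_of_ne_zero hg.1 hg.2.1 (right_ne_zero_of_mul hv)

theorem Mesh.interpError_of_notMem (T : Mesh Ω) (η : Rd1 d → ℝ) {g : Rd d → ℝ} (hg : g ∈ T.S10)
    {x : Rd d} (hx : x ∉ closure Ω) : T.interpError η g x = 0 := by
  rw [Mesh.interpError, T.interp_of_notMem _ hx,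
    image_eq_zero_of_notMem_tsupport fun h => hx (hg.2.1 h), mul_zero, sub_zero]

theorem Mesh.continuous_interpError (T : Mesh Ω) {η : Rd1 d → ℝ} (hη : Continuous η)
    {g : Rd d → ℝ} (hg : g ∈ T.S10) : Continuous (T.interpError η g) := by
  have h1 : Continuous fun x : Rd d => η (x, 0) := hη.comp (by fun_prop)
  exact ((h1.pow 2).mul hg.1).sub (T.interp_mem η hg).1

section

variable {T : Mesh Ω} {η : Rd1 d → ℝ} {c : Rd d} {R τ C : ℝ} {g : Rd d → ℝ}

/-- An element that meets the support of the cutoff leaves it by at most its diameter. -/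
theorem IsCutoff.near_of_relevant (hη : IsCutoff η c R τ C) {s : Finset (Rd d)} (hs : s ∈ T.tops)
    (hr : ∃ y ∈ convexHull ℝ (s : Set (Rd d)), η (y, 0) ≠ 0) {x : Rd d}
    (hx : x ∈ convexHull ℝ (s : Set (Rd d))) (i : Fin d) :
    |x i - c i| ≤ R / 2 + τ / 4 + T.width := by
  obtain ⟨y, hy, hy0⟩ := hr
  have h1 := (hη.of_ne_zero _ hy0).1 i
  have h2 : |x i - y i| ≤ T.width := by
    have h3 : ‖(x - y) i‖ ≤ ‖x - y‖ := PiLp.norm_apply_le (x - y) i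
    exact h3.trans ((norm_sub_le_diam hx hy).trans (T.diam_le_width hs))
  have h4 := abs_add_le (x i - y i) (y i - c i)
  rw [sub_add_sub_cancel] at h4
  simp only at h1
  linarith

theorem interp_eq_zero_of_irrelevant {s : Finset (Rd d)} (hs : s ∈ T.tops)
    (hr : ¬ ∃ y ∈ convexHull ℝ (s : Set (Rd d)), η (y, 0) ≠ 0) {x : Rd d}
    (hx : x ∈ convexHull ℝ (s : Set (Rd d))) : T.interp (fun y => η (y, 0) ^ 2 * g y) x = 0 := by
  push Not at hr
  rw [T.interp_eq _ hs hx]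
  refine Finset.sum_eq_zero fun v hv => ?_
  rw [hr v (subset_convexHull ℝ _ hv)]; simp

theorem interpError_eq_zero_of_irrelevant {s : Finset (Rd d)} (hs : s ∈ T.tops)
    (hr : ¬ ∃ y ∈ convexHull ℝ (s : Set (Rd d)), η (y, 0) ≠ 0) {x : Rd d}
    (hx : x ∈ convexHull ℝ (s : Set (Rd d))) : T.interpError η g x = 0 := by
  rw [Mesh.interpError, interp_eq_zero_of_irrelevant hs hr hx]
  push Not at hr
  rw [hr x hx]; simp

theorem near_of_interp_ne_zero (hη : IsCutoff η c R τ C) {x : Rd d}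
    (hx : T.interp (fun y => η (y, 0) ^ 2 * g y) x ≠ 0) (i : Fin d) :
    |x i - c i| ≤ R / 2 + τ / 4 + T.width := by
  have hxc : x ∈ closure Ω := by
    by_contra hc
    exact hx (T.interp_of_notMem _ hc)
  obtain ⟨s, hs, hxs⟩ := T.mem_closure_iff.1 hxc
  refine hη.near_of_relevant hs ?_ hxs i
  by_contra hc
  exact hx (interp_eq_zero_of_irrelevant hs hc hxs)

theorem near_of_interpError_ne_zero (hη : IsCutoff η c R τ C) (hg : g ∈ T.S10) {x : Rd d}
    (hx : T.interpError η g x ≠ 0) (i : Fin d) : |x i - c i| ≤ R / 2 + τ / 4 + T.width := by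
  have hxc : x ∈ closure Ω := by
    by_contra hc
    exact hx (T.interpError_of_notMem η hg hc)
  obtain ⟨s, hs, hxs⟩ := T.mem_closure_iff.1 hxc
  refine hη.near_of_relevant hs ?_ hxs i
  by_contra hc
  exact hx (interpError_eq_zero_of_irrelevant hs hc hxs)

theorem isClosed_near (c : Rd d) (r : ℝ) : IsClosed {x : Rd d | ∀ i, |x i - c i| ≤ r} := by
  simp only [ofPred_forall]
  refine isClosed_iInter fun i => isClosed_le ?_ continuous_const
  fun_prop

/-- The lateral growth is at most `τ / 4 + h ≤ τ / 4 + τ / 16`, less than the available `τ / 2`. -/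
theorem tsupport_interp_subset (hη : IsCutoff η c R τ C) (hτ : 0 < τ) (hR : 0 < R)
    (hhτ : 16 * T.width ≤ τ) :
    tsupport (T.interp (fun y => η (y, 0) ^ 2 * g y)) ⊆
      {x : Rd d | (x, (0 : ℝ)) ∈ closure (box c (R + τ))} := by
  refine (closure_minimal (fun x hx => near_of_interp_ne_zero hη hx)
    (isClosed_near c (R / 2 + τ / 4 + T.width))).trans fun x hx => ?_
  rw [mem_ofPred_eq, box, closure_prod_eq, closure_Ioo (by linarith)]
  refine ⟨subset_closure fun i => (hx i).trans_lt ?_, le_rfl, by linarith⟩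
  linarith

end

/-- On each element, the interpolation error is estimated by the energy on the prism over it. -/
theorem Mesh.exists_element_bounds (T : Mesh Ω) (hd : 0 < d) {γ : ℝ} (hγ : T.ShapeRegular γ) {α : ℝ}
    (hα : α ∈ Ioo (-1 : ℝ) 1) {w : BeppoLevi d α} {g : Rd d → ℝ} (hg : g ∈ T.S10)
    (ht : HasTrace w g) {c : Rd d} {η : Rd1 d → ℝ} {R τ C D Γ : ℝ} (hη : IsCutoff η c R τ C)
    (hC : 1 ≤ C) (hD : 1 ≤ D) (hτ : 0 < τ) (hhR : T.width ≤ R)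
    (hΓ1 : 1 ≤ Γ) (hΓ : (2 * |γ|) ^ d ≤ Γ) {s : Finset (Rd d)} (hs : s ∈ T.tops) :
    ∃ S L : ℝ, 0 ≤ L ∧
      (∀ x ∈ convexHull ℝ (s : Set (Rd d)), |T.interpError η g x| ≤ S) ∧
      (∀ x ∈ convexHull ℝ (s : Set (Rd d)), ∀ y ∈ convexHull ℝ (s : Set (Rd d)),
        |T.interpError η g x - T.interpError η g y| ≤ L * ‖x - y‖) ∧
      ((¬ ∃ y ∈ convexHull ℝ (s : Set (Rd d)), η (y, 0) ≠ 0) → S = 0 ∧ L = 0) ∧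
      (ENNReal.ofReal (L ^ 2) * volume (convexHull ℝ (s : Set (Rd d)))) *
          ENNReal.ofReal ((1 - α) / (1 + α) * T.width ^ (1 + α)) +
        (ENNReal.ofReal (S ^ 2) * volume (convexHull ℝ (s : Set (Rd d)))) *
          ENNReal.ofReal (D * ((1 - α) / (1 + α) * T.width ^ (1 + α)) / T.width ^ 2) ≤
      ENNReal.ofReal (interpConst d Γ C D * (T.width / τ) ^ 2) *
        (ENNReal.ofReal (1 / τ ^ 2) * (∫⁻ y in convexHull ℝ (s : Set (Rd d)) ×ˢ
            Ioo 0 (Metric.diam (convexHull ℝ (s : Set (Rd d)))), ‖w.toFun y‖ₑ ^ 2 ∂(wvol d α)) +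
          ENNReal.ofReal ((T.width / τ) ^ 2) * (∫⁻ y in convexHull ℝ (s : Set (Rd d)) ×ˢ
            Ioo 0 (Metric.diam (convexHull ℝ (s : Set (Rd d)))), ‖w.grad y‖ₑ ^ 2 ∂(wvol d α)) +
          ∫⁻ y in convexHull ℝ (s : Set (Rd d)) ×ˢ
            Ioo 0 (Metric.diam (convexHull ℝ (s : Set (Rd d)))),
            ‖η y • w.grad y‖ₑ ^ 2 ∂(wvol d α)) := by
  -- Elements that do not meet the support of the cutoff get zero bounds; their prisms may lie
  -- outside the large box and must not enter the final sum.
  by_cases hr : ∃ y ∈ convexHull ℝ (s : Set (Rd d)), η (y, 0) ≠ 0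
  swap
  · refine ⟨0, 0, le_rfl, fun x hx => ?_, fun x hx y hy => ?_, fun _ => ⟨rfl, rfl⟩, ?_⟩
    · rw [interpError_eq_zero_of_irrelevant hs hr hx, abs_zero]
    · rw [interpError_eq_zero_of_irrelevant hs hr hx, interpError_eq_zero_of_irrelevant hs hr hy]
      simp
    · simp
  have hss := T.isSimplex hs
  obtain ⟨z, hz, -⟩ := id hr
  obtain ⟨A, hA⟩ := hg.2.2 _ (T.hull_mem_elements hs)
  have hH0 := diam_hull_pos hss hd
  have hHh := T.diam_le_width hs
  obtain ⟨S, L, hS0, hL0, hS, hL, hE⟩ := exists_interp_error hα hg.1 ht hss hH0 le_rfl hHh hhR hτ hC hD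
    hΓ1 (fun v => (norm_affGrad_bary_le hss hd (hγ _ (T.hull_mem_elements hs)) v).trans hΓ) hA hη hz
  refine ⟨S, L, hL0, fun x hx => ?_, fun x hx y hy => ?_, fun h => absurd hr h, ?_⟩
  · rw [T.interpError_eq η g hs hx]; exact hS x hx
  · rw [T.interpError_eq η g hs hx, T.interpError_eq η g hs hy]; exact hL x hx y hy
  set K := convexHull ℝ (s : Set (Rd d)) with hK
  set H := Metric.diam K with hH
  set h := T.width with hh
  have hh0 : 0 < h := hH0.trans_le hHh
  have hVf : volume K ≠ ⊤ := (isBounded_hull s).measure_lt_top.ne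
  have hX0 : 0 ≤ (1 - α) / (1 + α) * h ^ (1 + α) := by
    have h1 : 0 < 1 - α := by linarith [hα.2]
    have h2 : 0 < 1 + α := by linarith [hα.1]
    positivity
  have hb : Bornology.IsBounded (K ×ˢ Ioo 0 H) := (isBounded_hull s).prod (Metric.isBounded_Ioo 0 H)
  have hWf : ∫⁻ y in K ×ˢ Ioo 0 H, ‖w.toFun y‖ₑ ^ 2 ∂(wvol d α) ≠ ⊤ :=
    lintegral_sq_ne_top (ht.memLp_restrict hα.1 hb)
  have hAf : ∫⁻ y in K ×ˢ Ioo 0 H, ‖w.grad y‖ₑ ^ 2 ∂(wvol d α) ≠ ⊤ :=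
    lintegral_sq_ne_top (w.memLp_grad.restrict _)
  have hZf : ∫⁻ y in K ×ˢ Ioo 0 H, ‖η y • w.grad y‖ₑ ^ 2 ∂(wvol d α) ≠ ⊤ := by
    refine ne_top_of_le_ne_top hAf (lintegral_mono fun y => pow_le_pow_left' ?_ 2)
    rw [enorm_smul, Real.enorm_eq_ofReal (hη.nonneg y)]
    exact mul_le_of_le_one_left' (ENNReal.ofReal_le_one.2 (hη.le_one y))
  rw [← ENNReal.ofReal_toReal hWf, ← ENNReal.ofReal_toReal hAf, ← ENNReal.ofReal_toReal hZf,
    ← ENNReal.ofReal_toReal hVf, ← ENNReal.ofReal_mul (by positivity),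
    ← ENNReal.ofReal_mul (by positivity), ← ENNReal.ofReal_mul (by positivity),
    ← ENNReal.ofReal_mul (by positivity), ← ENNReal.ofReal_mul (by positivity),
    ← ENNReal.ofReal_mul (by positivity), ← ENNReal.ofReal_add (by positivity) (by positivity),
    ← ENNReal.ofReal_add (by positivity) (by positivity),
    ← ENNReal.ofReal_add (by positivity) (by positivity),
    ← ENNReal.ofReal_mul (by rw [interpConst]; positivity)]
  refine ENNReal.ofReal_le_ofReal (le_trans (le_of_eq ?_) hE)
  change L ^ 2 * volume.real K * _ + S ^ 2 * volume.real K * _ = _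
  ring

/-- The interpolation error of the localized trace has an extension of small energy. -/
theorem Mesh.exists_correction (T : Mesh Ω) (hΩ : Bornology.IsBounded Ω) (hd : 0 < d) {γ : ℝ}
    (hγ : T.ShapeRegular γ) {α : ℝ}
    (hα : α ∈ Ioo (-1 : ℝ) 1) {w : BeppoLevi d α} {g : Rd d → ℝ} (hg : g ∈ T.S10)
    (ht : HasTrace w g) {c : Rd d} {η : Rd1 d → ℝ} {R τ C D Γ : ℝ} (hη : IsCutoff η c R τ C)
    (hC : 1 ≤ C) (hD : 1 ≤ D) (hτ : 0 < τ) (hh : 0 < T.width) (hhτ : 16 * T.width ≤ τ)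
    (hhR : T.width ≤ R) (hΓ1 : 1 ≤ Γ) (hΓ : (2 * |γ|) ^ d ≤ Γ) {χ : ℝ → ℝ} (hχ : ContDiff ℝ ∞ χ)
    (hχ0 : χ 0 = 1) (hχh : ∀ t, T.width ≤ |t| → χ t = 0)
    (hχX : ∫⁻ t, ‖χ t‖ₑ ^ 2 ∂(wline α) ≤
      ENNReal.ofReal ((1 - α) / (1 + α) * T.width ^ (1 + α)))
    (hχY : ∫⁻ t, ‖deriv χ t‖ₑ ^ 2 ∂(wline α) ≤
      ENNReal.ofReal (D * ((1 - α) / (1 + α) * T.width ^ (1 + α)) / T.width ^ 2)) :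
    ∃ e : BeppoLevi d α, HasTrace e (T.interpError η g) ∧
      (∀ z ∈ halfSpace d, z ∉ box c (R + τ) → e.grad z = 0) ∧
      ∫⁻ z, ‖e.grad z‖ₑ ^ 2 ∂(wvol d α) ≤
        ENNReal.ofReal (interpConst d Γ C D * (T.width / τ) ^ 2) *
          (ENNReal.ofReal (1 / τ ^ 2) * (∫⁻ z in box c (R + τ), ‖w.toFun z‖ₑ ^ 2 ∂(wvol d α)) +
            ENNReal.ofReal ((T.width / τ) ^ 2) *
              (∫⁻ z in box c (R + τ), ‖w.grad z‖ₑ ^ 2 ∂(wvol d α)) +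
            ∫⁻ z in box c (R + τ), ‖η z • w.grad z‖ₑ ^ 2 ∂(wvol d α)) := by
  classical
  have hel := fun s (hs : s ∈ T.tops) => T.exists_element_bounds hd hγ hα hg ht hη hC hD hτ hhR hΓ1 hΓ hs
  choose! S L hL0 hS hL hirr hE using hel
  set e₀ := T.interpError η g with he₀
  have h0 : ∀ x ∉ closure Ω, e₀ x = 0 := fun x hx => T.interpError_of_notMem η hg hx
  obtain ⟨C₀, hLip⟩ := T.lipschitzWith_of_elements
    (T.continuous_interpError hη.contDiff.continuous hg) h0 fun s hs => ⟨L s, hL s hs⟩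
  have hc : HasCompactSupport e₀ := HasCompactSupport.intro hΩ.isCompact_closure h0
  have hχc : HasCompactSupport χ := HasCompactSupport.intro (isCompact_Icc (a := -T.width)
    (b := T.width)) fun t ht => hχh t <| by
      by_contra hlt
      exact ht (abs_le.1 (not_le.1 hlt).le)
  obtain ⟨C₁, hLip₁⟩ := lipschitzWith_tensor hLip hc hχ hχc
  have hc₁ := hasCompactSupport_tensor hc hχc
  -- The lifting is `e₀(x) χ(t)`; its trace is `e₀` because `χ 0 = 1`, and its support has height at
  -- most the mesh width.
  refine ⟨BeppoLevi.ofLipschitz hα.1 _ hLip₁ hc₁, ?_, fun z hz hzD => ?_, ?_⟩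
  · have := hasTrace_ofLipschitz hα.1 _ hLip₁ hc₁
    simpa only [hχ0, mul_one] using this
  · have hcl : IsClosed ({x : Rd d | ∀ i, |x i - c i| ≤ R / 2 + τ / 4 + T.width} ×ˢ
        {t : ℝ | |t| ≤ T.width}) :=
      (isClosed_near c _).prod (isClosed_le continuous_abs continuous_const)
    have hts : z ∉ tsupport fun z : Rd1 d => e₀ z.1 * χ z.2 := by
      intro hzt
      have hsub : Function.support (fun z : Rd1 d => e₀ z.1 * χ z.2) ⊆
          {x : Rd d | ∀ i, |x i - c i| ≤ R / 2 + τ / 4 + T.width} ×ˢ {t : ℝ | |t| ≤ T.width} := by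
        intro y hy
        refine ⟨fun i => near_of_interpError_ne_zero hη hg (left_ne_zero_of_mul hy) i, ?_⟩
        by_contra hlt
        exact right_ne_zero_of_mul hy (hχh _ (not_le.1 hlt).le)
      have hz2 := closure_minimal hsub hcl hzt
      have hz0 : 0 < z.2 := hz
      have hz3 : |z.2| ≤ T.width := hz2.2
      refine hzD ⟨fun i => (hz2.1 i).trans_lt (by linarith), hz0, ?_⟩
      linarith [le_abs_self z.2]
    change gradOf (fderiv ℝ _ z) = 0
    rw [fderiv_eq_zero_of_notMem_tsupport hts, map_zero]
  · change ∫⁻ z, ‖gradOf (fderiv ℝ (fun z : Rd1 d => e₀ z.1 * χ z.2) z)‖ₑ ^ 2 ∂(wvol d α) ≤ _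
    rw [lintegral_gradOf_tensor α hLip hχ]
    obtain ⟨hb1, hb2⟩ := T.lintegral_le_sum h0 hS hL0 hL
    have hi1 := (lintegral_mono_ae hb1).trans_eq (lintegral_sum_indicator _ _)
    have hi2 := (lintegral_mono_ae hb2).trans_eq (lintegral_sum_indicator _ _)
    set F := T.tops_finite.toFinset with hF
    have hFm : ∀ s ∈ F, s ∈ T.tops := fun s hs => T.tops_finite.mem_toFinset.1 hs
    let rel : Finset (Rd d) → Prop := fun s => ∃ y ∈ convexHull ℝ (s : Set (Rd d)), η (y, 0) ≠ 0
    have hrel : ∀ s ∈ F.filter rel, s ∈ T.tops := fun s hs => hFm s (Finset.mem_filter.1 hs).1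
    have hsubD : ∀ s ∈ F.filter rel, convexHull ℝ (s : Set (Rd d)) ×ˢ
        Ioo 0 (Metric.diam (convexHull ℝ (s : Set (Rd d)))) ⊆ box c (R + τ) := by
      rintro s hs z ⟨hz1, hz2⟩
      have hst := hrel s hs
      refine ⟨fun i => (hη.near_of_relevant hst (Finset.mem_filter.1 hs).2 hz1 i).trans_lt ?_,
        hz2.1, ?_⟩
      · linarith
      · linarith [hz2.2, T.diam_le_width hst]
    have hint := fun f => T.sum_setLIntegral_le (α := α) hrel _ hsubD f
    calc _ ≤ (∑ s ∈ F, ENNReal.ofReal (L s ^ 2) * volume (convexHull ℝ (s : Set (Rd d)))) *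
            ENNReal.ofReal ((1 - α) / (1 + α) * T.width ^ (1 + α)) +
          (∑ s ∈ F, ENNReal.ofReal (S s ^ 2) * volume (convexHull ℝ (s : Set (Rd d)))) *
            ENNReal.ofReal (D * ((1 - α) / (1 + α) * T.width ^ (1 + α)) / T.width ^ 2) :=
          add_le_add (mul_le_mul' hi1 hχX) (mul_le_mul' hi2 hχY)
      _ = ∑ s ∈ F, ((ENNReal.ofReal (L s ^ 2) * volume (convexHull ℝ (s : Set (Rd d)))) *
            ENNReal.ofReal ((1 - α) / (1 + α) * T.width ^ (1 + α)) +
          (ENNReal.ofReal (S s ^ 2) * volume (convexHull ℝ (s : Set (Rd d)))) *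
            ENNReal.ofReal (D * ((1 - α) / (1 + α) * T.width ^ (1 + α)) / T.width ^ 2)) := by
          rw [Finset.sum_mul, Finset.sum_mul, Finset.sum_add_distrib]
      _ = ∑ s ∈ F.filter rel, ((ENNReal.ofReal (L s ^ 2) * volume (convexHull ℝ (s : Set (Rd d)))) *
            ENNReal.ofReal ((1 - α) / (1 + α) * T.width ^ (1 + α)) +
          (ENNReal.ofReal (S s ^ 2) * volume (convexHull ℝ (s : Set (Rd d)))) *
            ENNReal.ofReal (D * ((1 - α) / (1 + α) * T.width ^ (1 + α)) / T.width ^ 2)) := by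
          -- Only elements meeting the support of the cutoff contribute; their prisms lie in the
          -- large box and overlap in null sets, so the local energies add up.
          refine (Finset.sum_filter_of_ne fun s hs hne => ?_).symm
          by_contra hc
          obtain ⟨h1, h2⟩ := hirr s (hFm s hs) hc
          exact hne (by simp [h1, h2])
      _ ≤ _ := Finset.sum_le_sum fun s hs => hE s (hrel s hs)
      _ ≤ _ := by
          rw [← Finset.mul_sum, Finset.sum_add_distrib, Finset.sum_add_distrib, ← Finset.mul_sum,
            ← Finset.mul_sum]
          gcongr
          · exact hint _
          · exact hint _
          · exact hint _

/-! ### The Caccioppoli inequality -/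

theorem integral_norm_sq_eq {X E : Type*} [MeasurableSpace X] [NormedAddCommGroup E] {f : X → E}
    {μ : Measure X} (hf : MemLp f 2 μ) :
    ∫ x, ‖f x‖ ^ 2 ∂μ = (∫⁻ x, ‖f x‖ₑ ^ 2 ∂μ).toReal := by
  have hm : AEStronglyMeasurable (fun x => ‖f x‖ ^ 2) μ := hf.1.norm.pow 2
  rw [integral_eq_lintegral_of_nonneg_ae (Eventually.of_forall fun _ => by positivity) hm]
  congr 1
  refine lintegral_congr fun x => ?_
  rw [ENNReal.ofReal_pow (norm_nonneg _), ofReal_norm]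

theorem integrable_norm_sq {X E : Type*} [MeasurableSpace X] [NormedAddCommGroup E] {f : X → E}
    {μ : Measure X} (hf : MemLp f 2 μ) : Integrable (fun x => ‖f x‖ ^ 2) μ :=
  hf.integrable_norm_pow two_ne_zero

theorem measurableSet_box (c : Rd d) (R : ℝ) : MeasurableSet (box c R) := by
  refine MeasurableSet.prod ?_ measurableSet_Ioo
  simp only [cube, ofPred_forall]
  refine MeasurableSet.iInter fun i => measurableSet_lt ?_ measurable_const
  fun_prop

theorem isOpen_box (c : Rd d) (R : ℝ) : IsOpen (box c R) := by
  refine IsOpen.prod ?_ isOpen_Ioo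
  simp only [cube, ofPred_forall]
  refine isOpen_iInter_of_finite fun i => isOpen_lt ?_ continuous_const
  fun_prop

theorem isBounded_box (c : Rd d) (R : ℝ) : Bornology.IsBounded (box c R) := by
  refine Bornology.IsBounded.prod ?_ (Metric.isBounded_Ioo 0 R)
  refine ((PiLp.antilipschitzWith_ofLp 2 (fun _ : Fin d => ℝ)).isBounded_preimage
    (Metric.isBounded_closedBall (x := WithLp.ofLp c) (r := |R / 2|))).subset fun x hx => ?_
  rw [mem_preimage, Metric.mem_closedBall, dist_pi_le_iff (abs_nonneg _)]
  exact fun i => (hx i).le.trans (le_abs_self _)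

theorem integral_le_of_ae_le_add {X : Type*} [MeasurableSpace X] {μ : Measure X}
    {f g a b c e : X → ℝ} {p q r s : ℝ} (hf : Integrable f μ) (hg : Integrable g μ)
    (ha : Integrable a μ) (hb : Integrable b μ) (hc : Integrable c μ) (he : Integrable e μ)
    (h : ∀ᵐ x ∂μ, f x ≤ g x + (p * a x + q * b x + r * c x + s * e x)) :
    ∫ x, f x ∂μ ≤ ∫ x, g x ∂μ +
      (p * ∫ x, a x ∂μ + q * ∫ x, b x ∂μ + r * ∫ x, c x ∂μ + s * ∫ x, e x ∂μ) := by
  have k1 : Integrable (fun x => p * a x + q * b x) μ := (ha.const_mul p).add (hb.const_mul q)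
  have k2 : Integrable (fun x => p * a x + q * b x + r * c x) μ := k1.add (hc.const_mul r)
  have k3 : Integrable (fun x => p * a x + q * b x + r * c x + s * e x) μ :=
    k2.add (he.const_mul s)
  refine (integral_mono_ae hf (hg.add k3) h).trans_eq ?_
  change ∫ x, g x + (p * a x + q * b x + r * c x + s * e x) ∂μ = _
  rw [integral_add hg k3, integral_add k2 (he.const_mul s), integral_add k1 (hc.const_mul r),
    integral_add (ha.const_mul p) (hb.const_mul q), integral_const_mul, integral_const_mul,
    integral_const_mul, integral_const_mul]

theorem IsCutoff.mem_box {η : Rd1 d → ℝ} {c : Rd d} {R τ C : ℝ} (h : IsCutoff η c R τ C)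
    (hτ : 0 < τ) {z : Rd1 d} (hz : z ∈ halfSpace d) (h0 : η z ≠ 0) : z ∈ box c (R + τ) := by
  obtain ⟨h1, h2⟩ := h.of_ne_zero z h0
  exact ⟨fun i => (h1 i).trans (by linarith), hz, by linarith [le_abs_self z.2]⟩

theorem ae_mem_halfSpace (α : ℝ) : ∀ᵐ z ∂(wvol d α), z ∈ halfSpace d :=
  (withDensity_absolutelyContinuous _ _).ae_le (ae_restrict_mem isOpen_halfSpace.measurableSet)

/-- The energy argument: testing with the localized function minus a correction. -/
theorem energy_le {α : ℝ} {w e v : BeppoLevi d α} {c : Rd d} {η : Rd1 d → ℝ} {R τ C B θ : ℝ}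
    (hη : IsCutoff η c R τ C) (hτ : 0 < τ) (hB : 0 < B) (hθ : 0 < θ)
    (hw : MemLp w.toFun 2 ((wvol d α).restrict (box c (R + τ))))
    (hv : ∀ z, v.grad z = η z ^ 2 • w.grad z + w.toFun z • classicalGrad (fun y => η y ^ 2) z -
      e.grad z) (ha : w.a v = 0)
    (he0 : ∀ z ∈ halfSpace d, z ∉ box c (R + τ) → e.grad z = 0)
    (he : ∫⁻ z, ‖e.grad z‖ₑ ^ 2 ∂(wvol d α) ≤ ENNReal.ofReal (B * θ) *
      (ENNReal.ofReal (1 / τ ^ 2) * (∫⁻ z in box c (R + τ), ‖w.toFun z‖ₑ ^ 2 ∂(wvol d α)) +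
        ENNReal.ofReal θ * (∫⁻ z in box c (R + τ), ‖w.grad z‖ₑ ^ 2 ∂(wvol d α)) +
        ∫⁻ z in box c (R + τ), ‖η z • w.grad z‖ₑ ^ 2 ∂(wvol d α))) :
    ∫⁻ z in box c (R + τ), ‖η z • w.grad z‖ₑ ^ 2 ∂(wvol d α) ≤
      ENNReal.ofReal (32 * C ^ 2 + 2 * B + 1) *
      (ENNReal.ofReal (1 / τ ^ 2) * (∫⁻ z in box c (R + τ), ‖w.toFun z‖ₑ ^ 2 ∂(wvol d α)) +
        ENNReal.ofReal θ * (∫⁻ z in box c (R + τ), ‖w.grad z‖ₑ ^ 2 ∂(wvol d α))) := by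
  set Q := box c (R + τ) with hQ
  set μ := wvol d α with hμ
  have hQm : MeasurableSet Q := measurableSet_box c _
  have hF : MemLp w.grad 2 (μ.restrict Q) := w.memLp_grad.restrict Q
  have hZm : MemLp (fun z => η z • w.grad z) 2 μ :=
    w.memLp_grad.of_le (hη.contDiff.continuous.aestronglyMeasurable.smul w.memLp_grad.1)
      (Eventually.of_forall fun z => by
        rw [norm_smul, Real.norm_eq_abs, abs_of_nonneg (hη.nonneg z)]
        exact mul_le_of_le_one_left (norm_nonneg _) (hη.le_one z))
  have hZr : MemLp (fun z => η z • w.grad z) 2 (μ.restrict Q) := hZm.restrict Q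
  set IW := ∫⁻ z in Q, ‖w.toFun z‖ₑ ^ 2 ∂μ with hIW
  set IA := ∫⁻ z in Q, ‖w.grad z‖ₑ ^ 2 ∂μ with hIA
  set Z := ∫⁻ z in Q, ‖η z • w.grad z‖ₑ ^ 2 ∂μ with hZ
  set EE := ∫⁻ z, ‖e.grad z‖ₑ ^ 2 ∂μ with hEE
  have fW : IW ≠ ⊤ := lintegral_sq_ne_top hw
  have fA : IA ≠ ⊤ := lintegral_sq_ne_top hF
  have fZ : Z ≠ ⊤ := lintegral_sq_ne_top hZr
  have fE : EE ≠ ⊤ := lintegral_sq_ne_top e.memLp_grad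
  rw [← ENNReal.ofReal_toReal fW, ← ENNReal.ofReal_toReal fA, ← ENNReal.ofReal_toReal fZ] at he ⊢
  rw [← ENNReal.ofReal_toReal fE] at he
  rw [← ENNReal.ofReal_mul (by positivity), ← ENNReal.ofReal_mul (by positivity),
    ← ENNReal.ofReal_add (by positivity) (by positivity)] at he ⊢
  rw [← ENNReal.ofReal_add (by positivity) (by positivity), ← ENNReal.ofReal_mul (by positivity),
    ENNReal.ofReal_le_ofReal_iff (by positivity)] at he
  rw [← ENNReal.ofReal_mul (by positivity)]
  refine ENNReal.ofReal_le_ofReal ?_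
  have iW := integral_norm_sq_eq hw
  have iA := integral_norm_sq_eq hF
  have iZ := integral_norm_sq_eq hZr
  have iE := integral_norm_sq_eq e.memLp_grad
  -- the pointwise inequality
  have hpt : ∀ᵐ z ∂μ, Q.indicator (fun z => ‖η z • w.grad z‖ ^ 2) z ≤
      inner ℝ (w.grad z) (v.grad z) + (1 / 4 * Q.indicator (fun z => ‖η z • w.grad z‖ ^ 2) z +
        16 * C ^ 2 / τ ^ 2 * Q.indicator (fun z => ‖w.toFun z‖ ^ 2) z +
        B * θ * Q.indicator (fun z => ‖w.grad z‖ ^ 2) z + 1 / (4 * (B * θ)) * ‖e.grad z‖ ^ 2) := by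
    filter_upwards [ae_mem_halfSpace α] with z hz
    have hcg : ‖classicalGrad (fun y => η y ^ 2) z‖ ≤ 4 * η z * (C / τ) := by
      have hdf : DifferentiableAt ℝ (fun y => η y ^ 2) z :=
        (hη.contDiff.differentiable (by simp) z).pow 2
      rw [classicalGrad_eq_gradOf hdf]
      refine (norm_gradOf_le _).trans ?_
      linarith [hη.norm_fderiv_sq_le z]
    by_cases hzQ : z ∈ Q
    · simp only [indicator_of_mem hzQ]
      rw [hv z, inner_sub_right, inner_add_right, real_inner_smul_right, real_inner_smul_right,
        real_inner_self_eq_norm_sq, norm_smul, mul_pow, Real.norm_eq_abs, Real.norm_eq_abs, sq_abs]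
      -- Young's inequality, with the coefficient `1 / 4` chosen for later absorption of the
      -- localized energy.
      have h1 : |w.toFun z * inner ℝ (w.grad z) (classicalGrad (fun y => η y ^ 2) z)| ≤
          1 / 4 * (η z ^ 2 * ‖w.grad z‖ ^ 2) + 16 * C ^ 2 / τ ^ 2 * |w.toFun z| ^ 2 := by
        rw [abs_mul]
        calc _ ≤ |w.toFun z| * (‖w.grad z‖ * (4 * η z * (C / τ))) := by
              gcongr
              exact (abs_real_inner_le_norm _ _).trans (by gcongr)
          _ = 2 * (1 / 2 * (η z * ‖w.grad z‖)) * (4 * C / τ * |w.toFun z|) := by ring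
          _ ≤ (1 / 2 * (η z * ‖w.grad z‖)) ^ 2 + (4 * C / τ * |w.toFun z|) ^ 2 :=
              two_mul_le_add_sq _ _
          _ = _ := by ring
      -- Young's inequality with weight `B θ`, matched to the bound for `e`: the unlocalized energy
      -- of `w` receives the small factor `θ`.
      have h2 : inner ℝ (w.grad z) (e.grad z) ≤
          B * θ * ‖w.grad z‖ ^ 2 + 1 / (4 * (B * θ)) * ‖e.grad z‖ ^ 2 := by
        refine (real_inner_le_norm _ _).trans ?_
        have hl : 0 < B * θ := by positivity
        have e1 : B * θ * ‖w.grad z‖ ^ 2 + 1 / (4 * (B * θ)) * ‖e.grad z‖ ^ 2 -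
            ‖w.grad z‖ * ‖e.grad z‖ =
            (2 * (B * θ) * ‖w.grad z‖ - ‖e.grad z‖) ^ 2 / (4 * (B * θ)) := by
          field_simp; ring
        have : 0 ≤ (2 * (B * θ) * ‖w.grad z‖ - ‖e.grad z‖) ^ 2 / (4 * (B * θ)) := by positivity
        linarith
      have h3 := neg_abs_le (w.toFun z * inner ℝ (w.grad z) (classicalGrad (fun y => η y ^ 2) z))
      linarith
    · have hη0 : η z = 0 := by
        by_contra h
        exact hzQ (hη.mem_box hτ hz h)
      have hc0 : classicalGrad (fun y => η y ^ 2) z = 0 := by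
        rw [hη0] at hcg
        exact norm_le_zero_iff.1 (hcg.trans (by simp))
      simp only [indicator_of_notMem hzQ]
      rw [hv z, hη0, hc0, he0 z hz hzQ]
      simp
  have jZ : Integrable (Q.indicator fun z => ‖η z • w.grad z‖ ^ 2) μ :=
    (integrable_norm_sq hZm).indicator hQm
  have jW : Integrable (Q.indicator fun z => ‖w.toFun z‖ ^ 2) μ :=
    (integrable_indicator_iff hQm).2 (integrable_norm_sq hw)
  have jA : Integrable (Q.indicator fun z => ‖w.grad z‖ ^ 2) μ :=
    (integrable_norm_sq w.memLp_grad).indicator hQm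
  have jE := integrable_norm_sq e.memLp_grad
  have jv : Integrable (fun z => inner ℝ (w.grad z) (v.grad z)) μ :=
    ((integrable_norm_sq w.memLp_grad).add (integrable_norm_sq v.memLp_grad)).mono'
      (w.memLp_grad.1.inner v.memLp_grad.1) (Eventually.of_forall fun z => by
        refine (norm_inner_le_norm _ _).trans ?_
        change _ ≤ ‖w.grad z‖ ^ 2 + ‖v.grad z‖ ^ 2
        nlinarith [sq_nonneg (‖w.grad z‖ - ‖v.grad z‖), sq_nonneg ‖w.grad z‖, sq_nonneg ‖v.grad z‖])
  have h := integral_le_of_ae_le_add jZ jv jZ jW jA jE hpt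
  rw [integral_indicator hQm, integral_indicator hQm, integral_indicator hQm, iZ, iW, iA, iE] at h
  have ha' : ∫ z, inner ℝ (w.grad z) (v.grad z) ∂μ = 0 := ha
  rw [ha', zero_add] at h
  -- The prefactor `B θ` of the correction's energy cancels, so the localized energy returns with
  -- coefficient `1 / 4`. With the earlier `1 / 4` only half of it is on the right, and doubling the
  -- rest gives the stated constant.
  have hE4 : 1 / (4 * (B * θ)) * EE.toReal ≤
      1 / 4 * (1 / τ ^ 2 * IW.toReal + θ * IA.toReal + Z.toReal) := by
    calc _ ≤ 1 / (4 * (B * θ)) * (B * θ * (1 / τ ^ 2 * IW.toReal + θ * IA.toReal + Z.toReal)) := by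
          gcongr
      _ = _ := by field_simp
  have pW : 0 ≤ 1 / τ ^ 2 * IW.toReal := by positivity
  have pA : 0 ≤ θ * IA.toReal := by positivity
  have e1 : 16 * C ^ 2 / τ ^ 2 * IW.toReal = 16 * (C ^ 2 * (1 / τ ^ 2 * IW.toReal)) := by ring
  have pC : 0 ≤ C ^ 2 * (θ * IA.toReal) := by positivity
  have pB : 0 ≤ B * (1 / τ ^ 2 * IW.toReal) := by positivity
  rw [e1] at h
  linarith

/-! ### The estimate for the Beppo-Levi extension -/

theorem HasWeakGradOn.mono {D D' : Set (Rd1 d)} (h : D' ⊆ D) {u : Rd1 d → ℝ} {G : Rd1 d → Vec d}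
    (hu : HasWeakGradOn D u G) : HasWeakGradOn D' u G where
  locInt := hu.locInt.mono_set h
  locInt_grad := hu.locInt_grad.mono_set h
  integral_eq := fun φ hφ hc hs e => hu.integral_eq φ hφ hc (hs.trans h) e

theorem box_subset_halfSpace (c : Rd d) (R : ℝ) : box c R ⊆ halfSpace d := fun _ hz => hz.2.1

theorem ae_wvol_restrict {α : ℝ} {D : Set (Rd1 d)} {P : Rd1 d → Prop}
    (h : ∀ᵐ z ∂(volume.restrict D), P z) : ∀ᵐ z ∂((wvol d α).restrict D), P z :=
  ((wvol_absolutelyContinuous α).restrict D).ae_le h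

/-- A nonempty range for `R` means that `Ω` has positive diameter; this rules out dimension zero and
the empty mesh. -/
theorem Mesh.pos_of_diam_pos (T : Mesh Ω) (h : 0 < Metric.diam Ω) : 0 < d ∧ 0 < T.width := by
  have hd : 0 < d := by
    rcases Nat.eq_zero_or_pos d with rfl | hd
    · rw [Metric.diam_subsingleton subsingleton_of_subsingleton] at h
      exact absurd h (lt_irrefl _)
    · exact hd
  obtain ⟨x, hx⟩ : Ω.Nonempty := by
    rw [nonempty_iff_ne_empty]
    rintro rfl
    simp at h
  obtain ⟨s, hs, -⟩ := T.mem_closure_iff.1 (subset_closure hx)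
  exact ⟨hd, (diam_hull_pos (T.isSimplex hs) hd).trans_le (T.diam_le_width hs)⟩

/-- The Caccioppoli inequality for Beppo-Levi functions that satisfy the orthogonality conditions. -/
theorem exists_caccioppoli (d : ℕ) (γ : ℝ) : ∃ K : ℝ, 1 ≤ K ∧
    ∀ (Ω : Set (Rd d)) (T : Mesh Ω), Bornology.IsBounded Ω → T.ShapeRegular γ → 0 < d →
      0 < T.width → ∀ α ∈ Ioo (-1 : ℝ) 1, ∀ (c : Rd d) (R τ : ℝ), 0 < τ → τ ≤ R →
      16 * T.width ≤ τ → ∀ w : BeppoLevi d α, (∃ g ∈ T.S10, HasTrace w g) →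
      (∀ v : BeppoLevi d α, ∀ g ∈ T.S10, HasTrace v g →
        tsupport g ⊆ {x : Rd d | (x, (0 : ℝ)) ∈ closure (box c (R + τ))} → w.a v = 0) →
      ∫⁻ z in box c R, ‖w.grad z‖ₑ ^ 2 ∂(wvol d α) ≤ ENNReal.ofReal K *
        (ENNReal.ofReal (1 / τ ^ 2) * (∫⁻ z in box c (R + τ), ‖w.toFun z‖ₑ ^ 2 ∂(wvol d α)) +
          ENNReal.ofReal ((T.width / τ) ^ 2) *
            (∫⁻ z in box c (R + τ), ‖w.grad z‖ₑ ^ 2 ∂(wvol d α))) := by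
  obtain ⟨C, hC, hcut⟩ := exists_cutoff d
  obtain ⟨D, hD, hprof⟩ := exists_profile
  set Γ := max 1 ((2 * |γ|) ^ d) with hΓ
  have hΓ1 : 1 ≤ Γ := le_max_left _ _
  have hB : 0 < interpConst d Γ C D := by rw [interpConst]; positivity
  refine ⟨32 * C ^ 2 + 2 * interpConst d Γ C D + 1, by nlinarith, ?_⟩
  intro Ω T hΩ hγ hd hh α hα c R τ hτ hτR hhτ w ⟨g, hg, ht⟩ horth
  have hR : 0 < R := hτ.trans_le hτR
  obtain ⟨η, h1, h2, h3, h4, h5, h6, h7, h8, h9⟩ := hcut c R τ hR hτ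
  have hη : IsCutoff η c R τ C := ⟨h1, h2, h3, h4, h5, h6, h7, h8, h9⟩
  obtain ⟨χ, hχ, hχ0, hχh, hχX, hχY⟩ := hprof α hα T.width hh
  obtain ⟨e, het, he0, hE⟩ := T.exists_correction hΩ hd hγ hα hg ht hη hC hD hτ hh hhτ
    (by linarith) hΓ1 (le_max_right _ _) hχ hχ0 hχh hχX hχY
  have hm : ContDiff ℝ ∞ fun z => η z ^ 2 := h1.pow 2
  have hmc : HasCompactSupport fun z => η z ^ 2 :=
    h2.comp_left (g := fun r : ℝ => r ^ 2) (by norm_num)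
  -- The test function `η² w - e`: its trace is the nodal interpolant of `η² g`, and hence
  -- admissible.
  have hvt := (ht.mulSmooth hα.1 hm hmc).sub het
  have hp : (fun x => η (x, 0) ^ 2 * g x - T.interpError η g x) =
      T.interp (fun y => η (y, 0) ^ 2 * g y) := by
    funext x; rw [Mesh.interpError]; ring
  rw [hp] at hvt
  have ha := horth _ _ (T.interp_mem η hg) hvt (tsupport_interp_subset hη hτ hR hhτ)
  refine le_trans ?_ (energy_le hη hτ hB (by positivity)
    (ht.memLp_restrict hα.1 (isBounded_box c _)) (fun z => rfl) ha he0 hE)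
  have hsub : box c R ⊆ box c (R + τ) := fun z hz =>
    ⟨fun i => (hz.1 i).trans (by linarith), hz.2.1, by linarith [hz.2.2]⟩
  refine le_trans (le_of_eq ?_) (lintegral_mono_set hsub)
  refine setLIntegral_congr_fun (measurableSet_box c R) fun z hz => ?_
  rw [h5 z hz, one_smul]

/-- A change of scale from `δ R` to `(1 + δ) R`, which costs the factor `(1 + δ) / δ`. As `1 ≤ K`,
the bound `K ≤ K ^ 2` avoids a square root in the constant. -/
theorem le_hNorm_of_sq_le {α h K δ R : ℝ} {c : Rd d} {u : Rd1 d → ℝ} {G : Rd1 d → Vec d} {N : ℝ≥0∞}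
    (hK : 1 ≤ K) (hδ : 0 < δ) (hR : 0 < R)
    (hN : N ^ 2 ≤ ENNReal.ofReal K * (ENNReal.ofReal (1 / (δ * R) ^ 2) *
        eLpNorm u 2 ((wvol d α).restrict (box c ((1 + δ) * R))) ^ 2 +
      ENNReal.ofReal ((h / (δ * R)) ^ 2) *
        eLpNorm G 2 ((wvol d α).restrict (box c ((1 + δ) * R))) ^ 2)) :
    N ≤ ENNReal.ofReal (K * ((1 + δ) / δ)) * hNorm α h c ((1 + δ) * R) u G := by
  refine (ENNReal.pow_right_strictMono two_ne_zero).le_iff_le.1 (hN.trans ?_)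
  have hsq : hNorm α h c ((1 + δ) * R) u G ^ 2 =
      ENNReal.ofReal ((h / ((1 + δ) * R)) ^ 2) *
        eLpNorm G 2 ((wvol d α).restrict (box c ((1 + δ) * R))) ^ 2 +
      ENNReal.ofReal (1 / ((1 + δ) * R) ^ 2) *
        eLpNorm u 2 ((wvol d α).restrict (box c ((1 + δ) * R))) ^ 2 := by
    rw [hNorm, ← ENNReal.rpow_natCast, ← ENNReal.rpow_mul]
    norm_num
  have hq : 0 < (1 + δ) / δ := by positivity
  have e1 : 1 / (δ * R) ^ 2 = ((1 + δ) / δ) ^ 2 * (1 / ((1 + δ) * R) ^ 2) := by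
    field_simp
  have e2 : (h / (δ * R)) ^ 2 = ((1 + δ) / δ) ^ 2 * (h / ((1 + δ) * R)) ^ 2 := by
    field_simp
  rw [mul_pow (ENNReal.ofReal _), hsq, e1, e2, ENNReal.ofReal_mul (by positivity), ENNReal.ofReal_mul (by positivity),
    ← ENNReal.ofReal_pow (by positivity), mul_pow K, ENNReal.ofReal_mul (by positivity)]
  have hKK : ENNReal.ofReal K ≤ ENNReal.ofReal (K ^ 2) := ENNReal.ofReal_le_ofReal (by nlinarith)
  calc _ = ENNReal.ofReal K * (ENNReal.ofReal (((1 + δ) / δ) ^ 2) *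
        (ENNReal.ofReal ((h / ((1 + δ) * R)) ^ 2) *
          eLpNorm G 2 ((wvol d α).restrict (box c ((1 + δ) * R))) ^ 2 +
        ENNReal.ofReal (1 / ((1 + δ) * R) ^ 2) *
          eLpNorm u 2 ((wvol d α).restrict (box c ((1 + δ) * R))) ^ 2)) := by ring
    _ ≤ _ := by
        rw [mul_assoc]
        gcongr

end FracCacc

end

theorem mainTheorem4 (d : ℕ) (Ω : Set (FracCacc.Rd d)) (hΩ_open : IsOpen Ω)
    (hΩ_bdd : Bornology.IsBounded Ω) (γ : ℝ) :
    ∃ C : ℝ, 0 < C ∧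
      ∀ s ∈ Ioo (0 : ℝ) 1, ∀ T : FracCacc.Mesh Ω, T.ShapeRegular γ →
      ∀ R ∈ Ioo (0 : ℝ) (8 * Metric.diam Ω), ∀ δ ∈ Ioo (0 : ℝ) 1, 16 * T.width ≤ δ * R →
      ∀ (c : FracCacc.Rd d) (u : FracCacc.Rd1 d → ℝ) (G : FracCacc.Rd1 d → FracCacc.Vec d),
        FracCacc.MemHh0 s T (FracCacc.box c ((1 + δ) * R)) u →
        FracCacc.HasWeakGradOn (FracCacc.box c ((1 + δ) * R)) u G →
        eLpNorm G 2 ((FracCacc.wvol d (1 - 2 * s)).restrict (FracCacc.box c R)) ≤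
          ENNReal.ofReal (C * ((1 + δ) / δ)) *
            FracCacc.hNorm (1 - 2 * s) T.width c ((1 + δ) * R) u G := by
  obtain ⟨K, hK, hmain⟩ := FracCacc.exists_caccioppoli d γ
  refine ⟨K, by linarith, ?_⟩
  intro s hs T hT R hR δ hδ hh c u G hu hG
  obtain ⟨-, w, hw, huw, -, horth⟩ := hu
  have hα : 1 - 2 * s ∈ Ioo (-1 : ℝ) 1 := ⟨by linarith [hs.2], by linarith [hs.1]⟩
  obtain ⟨hd, hw0⟩ := T.pos_of_diam_pos (by linarith [hR.1, hR.2])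
  -- On the large box `G` agrees with the gradient of the Beppo-Levi extension, so the claim may be
  -- proved for the latter.
  have hGw := hG.ae_eq (FracCacc.isOpen_box _ _)
    (w.hasWeakGrad.mono (FracCacc.box_subset_halfSpace _ _)) huw
  have hb : (1 + δ) * R = R + δ * R := by ring
  have hτ : 0 < δ * R := mul_pos hδ.1 hR.1
  have hsub : FracCacc.box c R ⊆ FracCacc.box c ((1 + δ) * R) := fun z hz =>
    ⟨fun i => (hz.1 i).trans (by linarith), hz.2.1, by linarith [hz.2.2]⟩
  refine FracCacc.le_hNorm_of_sq_le hK hδ.1 hR.1 ?_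
  rw [eLpNorm_congr_ae (FracCacc.ae_wvol_restrict (ae_restrict_of_ae_restrict_of_subset hsub hGw)),
    eLpNorm_congr_ae (FracCacc.ae_wvol_restrict hGw), eLpNorm_congr_ae (FracCacc.ae_wvol_restrict huw),
    FracCacc.eLpNorm_two_sq, FracCacc.eLpNorm_two_sq, FracCacc.eLpNorm_two_sq, hb]
  rw [hb] at horth
  exact hmain Ω T hΩ_bdd hT hd hw0 _ hα c R (δ * R) hτ (by nlinarith [hδ.2, hR.1]) hh w hw horth
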